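/- Let $n\ge 2$ and $S=\mathbb Z/n$. Let $k$ be a commutative ring and let $\mathfrak h^*$ be a finite free $k$-module with simple roots $\alpha_i\in\mathfrak h^*$ and simple coroots $\alpha_i^\vee\in\operatorname{Hom}_k(\mathfrak h^*,k)$ ($i\in S$) such that $\langle\alpha_i^\vee,\alpha_j\rangle$ is the standard Cartan matrix of affine type $\tilde A_{n-1}$, each $\alpha_i^\vee$ and each pairing with $\alpha_i$ takes the value $1$, and with an automorphism $\tau$ of $\mathfrak h^*$ such that $\tau(\alpha_i)=\alpha_{i+1}$ and $\langle\alpha_{i+1}^\vee,\tau x\rangle=\langle\alpha_i^\vee,x\rangle$. Put $\delta=\sum_{i\in S}\alpha_i$. Let $\mathcal D_{\mathrm{ext}}$ be the extended diagrammatic Hecke category of this realization: the strict $k$-linear graded monoidal category generated by objects $B_i$ ($i\in S$) and mutually inverse objects $\Omega=\Omega^{+},\Omega^{-}$, with morphisms generated by polynomials, dots, trivalent, $4$-valent and $6$-valent vertices, oriented black cups and caps and mixed crossings, subject to the Elias--Williamson relations of affine type $A$ and to the relations which make $\Omega B_i\cong B_{i+1}\Omega$ and allow all diagrams to be pulled through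 black strands (with $\Omega x=\tau(x)\Omega$ for $x\in\mathfrak h^*$); finite direct sums of shifts are adjoined. For a proper subset $X\subsetneq S$ and $c\in S\setminus X$, write $X=\{x_1<\dots<x_d\}$ in the order $c<c+1<\dots<c-1$. The element $h_X=s_{x_d}\cdots s_{x_1}$ does not depend on $c$; choose $c=\aleph(X)\notin X$ for each $X$ and let $B_X=B_{x_d}\cdots B_{x_1}$ for this choice. Reduced expressions of $h_X$ are identified by signed rex moves (products of $4$-valent vertices, each with a sign $-1$). For $i\notin X$ with $X\cup\{i\}\ne S$, the signed dots $B_X\to B_{X\cup i}(1)$ and $B_{X\cup i}\to B_X(1)$ are the startdot and the enddot on the strand $i$, multiplied by $(-1)^l$, where $l$ is the number of strands to the left of the strand $i$, combined with signed rex moves to the chosen expressions. For $p\in\mathbb Z$ let $P_p$ be the set of $X\subsetneq S$ with $|X|\le n-1-|p|$ and $n-1-p-|X|$ even. Let $\mathcal F$ have the chain object $\mathcal F^p=\bigoplus_{X\in P_p}B_X(p)$ in homological degree $p$, with differential the sum of all signed dots from the summands of $\mathcal F^p$ to those of $\mathcal F^{p+1}$, and let $\mathcal V=\Omega\otimes\mathcal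 F$ be the standard Gaitsgory complex. A pseudocomplex is a bounded sequence of objects and degree-zero maps such that every matrix coefficient of $d^2$ has the form $\mu\,\delta$ with $\mu$ a morphism of the appropriate degree and $\delta$ placed at the right; it is a complex if $d^2=0$. For $1\le i\le n$ let $y_i=f_{i-1}^{-1}\cdots f_1^{-1}\,\omega\, f_{n-1}\cdots f_{i+1}f_i=\omega f_{i-2}^{-1}\cdots f_0^{-1}f_{n-1}\cdots f_{i+1}f_i$ in the extended affine braid group generated by $f_j$ ($j\in S$) and $\omega$, with $\omega f_j\omega^{-1}=f_{j+1}$ and the braid relations between the $f_j$. For $\lambda\in\mathbb Z^n$ let $W(\lambda)$, the Wakimoto complex, be the minimal complex of the Rouquier complex of $y_1^{\lambda_1}\cdots y_n^{\lambda_n}$, where the Rouquier complexes of $f_j$, $f_j^{-1}$, $\omega$ are $(B_j\to R(1))$, $(R(-1)\to B_j)$ and $\Omega$, with $B_j$ and $\Omega$ in degree $0$. Let $\varepsilon_1,\dots,\varepsilon_n$ be the standard basis of $\mathbb Z^n$, and put $Y_i=W(\varepsilon_i)$, the Rouquier complex of $y_i$. Theorem. The standard Gaitsgory complex $\mathcal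 V$ has a Wakimoto filtration compatible with the weight filtration of the standard representation $V=\mathbb C^n$ of $\mathfrak{gl}_n$. That is: (1) $\mathcal V$ is a pseudocomplex, and is a complex if $\delta=0$. (2) $\mathcal V$ and $Y_1,\dots,Y_n$ are perverse (hence minimal): each of their summands in homological degree $p$ is of the form $\Omega B_{i_1}\cdots B_{i_d}(p)$ with pairwise distinct $i_1,\dots,i_d$. (3) $\mathcal V$ is isomorphic, by degree-zero isomorphisms of the chain objects that commute with the differentials, to a convolution of the Wakimoto complexes $Y_1,\dots,Y_n$, each occurring exactly once: a (pseudo)complex with the chain objects of $Y_1\oplus\dots\oplus Y_n$ whose differential has the differential of $Y_i$ as its component $Y_i\to Y_i$ and has zero component $Y_i\to Y_j$ for all $j>i$. So $Y_1\oplus\cdots\oplus Y_i$ is preserved by the differential for each $i$, with $Y_1$ a subcomplex and $Y_n$ a quotient complex. (4) In the same order, $\varepsilon_1,\dots,\varepsilon_n$ are the weights of the weight filtration of $V$: they are pairwise distinct, their weight spaces $V_{\varepsilon_i}$ have dimension one, $V=\bigoplus_i V_{\varepsilon_i}$, and each $V_{\varepsilon_1}\oplus\cdots\oplus V_{\varepsilon_i}$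 is stable under the upper triangular matrices. -/

import Mathlib

universe u v

/-! ### Realizations of affine type A with a rotation -/

/-- The Cartan matrix of affine type `A` with simple reflections indexed by `ZMod n`
(for `n = 2` the two off-diagonal entries are `-2`). -/
def affineCartan (n : ℕ) (i j : ZMod n) : ℤ :=
  if i = j then 2 else if n = 2 then -2 else if j = i + 1 ∨ i = j + 1 then -1 else 0

/-- A realization of the affine Weyl group of type `A` (with simple reflections `s_i`, `i ∈ ℤ/n`)
over a commutative ring `k`, with the standard Cartan matrix, together with an automorphism `tau`
lifting the rotation `s_i ↦ s_{i+1}`.  The module `H` is the dual space `𝔥*` that contains the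
simple roots; the simple coroots are linear forms on it.  The reflection `s_i` acts on `H` by
`x ↦ x - ⟨α_i^∨, x⟩ α_i`. -/
structure AffineRealization (k : Type u) [CommRing k] (n : ℕ) (H : Type v) [AddCommGroup H]
    [Module k H] where
  root : ZMod n → H
  coroot : ZMod n → Module.Dual k H
  cartan : ∀ i j, coroot i (root j) = (affineCartan n i j : k)
  root_surj : ∀ i, ∃ f : Module.Dual k H, f (root i) = 1
  coroot_surj : ∀ i, ∃ x : H, coroot i x = 1
  tau : H ≃ₗ[k] H
  tau_root : ∀ i, tau (root i) = root (i + 1)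
  tau_coroot : ∀ i x, coroot (i + 1) (tau x) = coroot i x

/-- The element `δ`, the sum of the simple roots. -/
def AffineRealization.delta {k : Type u} [CommRing k] {n : ℕ} [NeZero n] {H : Type v}
    [AddCommGroup H] [Module k H] (ρ : AffineRealization k n H) : H := ∑ i, ρ.root i

/-- The action of the simple reflection `s_i` on `𝔥*`. -/
def AffineRealization.refl {k : Type u} [CommRing k] {n : ℕ} {H : Type v}
    [AddCommGroup H] [Module k H] (ρ : AffineRealization k n H) (i : ZMod n) (x : H) : H :=
  x - ρ.coroot i x • ρ.root i

/-! ### The extended diagrammatic Hecke category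

A strict monoidal category given by generators and relations.  Its objects are words in the
letters `B_i`, `Ω⁺`, `Ω⁻`; the tensor product of objects is concatenation.  Diagrams are read from
bottom to top, i.e. from the source word to the target word. -/

/-- The generating objects: `col i` is `B_i`, `up` is `Ω⁺` and `down` is `Ω⁻`. -/
inductive Letter (n : ℕ) : Type
  | col (i : ZMod n) : Letter n
  | up : Letter n
  | down : Letter n

/-- Distinct indices whose simple reflections commute. -/
def Far {n : ℕ} (i j : ZMod n) : Prop := i ≠ j ∧ j ≠ i + 1 ∧ i ≠ j + 1

instance {n : ℕ} (i j : ZMod n) : Decidable (Far i j) :=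
  inferInstanceAs (Decidable (_ ∧ _))

/-- Indices whose simple reflections generate a symmetric group `S_3`. -/
def Adjacent {n : ℕ} (i j : ZMod n) : Prop := 3 ≤ n ∧ (j = i + 1 ∨ i = j + 1)

/-- The generating morphisms: a box labelled by a linear polynomial `x ∈ 𝔥*` (polynomials of higher
degree are products of boxes), the startdot and enddot, the two trivalent vertices, the 4-valent
and 6-valent vertices, the oriented black cups and caps, and the mixed crossings. -/
inductive Gen (n : ℕ) (H : Type v) : Type v
  | box (x : H) : Gen n H
  | startdot (i : ZMod n) : Gen n H
  | enddot (i : ZMod n) : Gen n H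
  | merge (i : ZMod n) : Gen n H
  | split (i : ZMod n) : Gen n H
  | four (i j : ZMod n) (h : Far i j) : Gen n H
  | six (i j : ZMod n) (h : Adjacent i j) : Gen n H
  | cupUD : Gen n H
  | cupDU : Gen n H
  | capUD : Gen n H
  | capDU : Gen n H
  | crossU (i : ZMod n) : Gen n H
  | crossUinv (i : ZMod n) : Gen n H
  | crossD (i : ZMod n) : Gen n H
  | crossDinv (i : ZMod n) : Gen n H

open Letter in
/-- Source of a generating morphism. -/
def Gen.src {n : ℕ} {H : Type v} : Gen n H → List (Letter n)
  | .box _ => []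
  | .startdot _ => []
  | .enddot i => [col i]
  | .merge i => [col i, col i]
  | .split i => [col i]
  | .four i j _ => [col i, col j]
  | .six i j _ => [col i, col j, col i]
  | .cupUD => []
  | .cupDU => []
  | .capUD => [up, down]
  | .capDU => [down, up]
  | .crossU i => [up, col i]
  | .crossUinv i => [col (i + 1), up]
  | .crossD i => [down, col (i + 1)]
  | .crossDinv i => [col i, down]

open Letter in
/-- Target of a generating morphism. -/
def Gen.tgt {n : ℕ} {H : Type v} : Gen n H → List (Letter n)
  | .box _ => []
  | .startdot i => [col i]
  | .enddot _ => []
  | .merge i => [col i]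
  | .split i => [col i, col i]
  | .four i j _ => [col j, col i]
  | .six i j _ => [col j, col i, col j]
  | .cupUD => [up, down]
  | .cupDU => [down, up]
  | .capUD => []
  | .capDU => []
  | .crossU i => [col (i + 1), up]
  | .crossUinv i => [up, col i]
  | .crossD i => [col i, down]
  | .crossDinv i => [down, col (i + 1)]

/-- Degree of a generating morphism. -/
def Gen.degree {n : ℕ} {H : Type v} : Gen n H → ℤ
  | .box _ => 2
  | .startdot _ => 1
  | .enddot _ => 1
  | .merge _ => -1
  | .split _ => -1
  | _ => 0

/-- Linear combinations of diagrams, before relations are imposed.  `gen g r` is the generator `g`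
with the identity of the word `r` on its right, `cons x f` is `f` with the identity of the letter
`x` on its left, and `comp f g` is `f` followed by `g` (stacked on top). -/
inductive Diag (k : Type u) (n : ℕ) (H : Type v) :
    List (Letter n) → List (Letter n) → Type (max u v)
  | id (a : List (Letter n)) : Diag k n H a a
  | comp {a b c : List (Letter n)} (f : Diag k n H a b) (g : Diag k n H b c) : Diag k n H a c
  | cons (x : Letter n) {a b : List (Letter n)} (f : Diag k n H a b) :
      Diag k n H (x :: a) (x :: b)
  | gen (g : Gen n H) (r : List (Letter n)) : Diag k n H (g.src ++ r) (g.tgt ++ r)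
  | zero (a b : List (Letter n)) : Diag k n H a b
  | add {a b : List (Letter n)} (f g : Diag k n H a b) : Diag k n H a b
  | smul {a b : List (Letter n)} (c : k) (f : Diag k n H a b) : Diag k n H a b

namespace Diag

section
variable {k : Type u} {n : ℕ} {H : Type v}

/-- The identity of the word `w` placed on the left of `f`. -/
def consList : (w : List (Letter n)) → {a b : List (Letter n)} → Diag k n H a b →
    Diag k n H (w ++ a) (w ++ b)
  | [], _, _, f => f
  | x :: w, _, _, f => cons x (consList w f)

infixl:80 " ⬝ " => Diag.comp

end

section
variable (k : Type u) {n : ℕ} {H : Type v}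
open Letter

def box (x : H) (r : List (Letter n)) : Diag k n H r r := gen (.box x) r

variable (H) in
def startdot (i : ZMod n) (r : List (Letter n)) : Diag k n H r (col i :: r) :=
  gen (.startdot i) r

variable (H) in
def enddot (i : ZMod n) (r : List (Letter n)) : Diag k n H (col i :: r) r :=
  gen (.enddot i) r

variable (H) in
def merge (i : ZMod n) (r : List (Letter n)) : Diag k n H (col i :: col i :: r) (col i :: r) :=
  gen (.merge i) r

variable (H) in
def split (i : ZMod n) (r : List (Letter n)) : Diag k n H (col i :: r) (col i :: col i :: r) :=
  gen (.split i) r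

variable (H) in
def four {i j : ZMod n} (h : Far i j) (r : List (Letter n)) :
    Diag k n H (col i :: col j :: r) (col j :: col i :: r) :=
  gen (.four i j h) r

variable (H) in
def six {i j : ZMod n} (h : Adjacent i j) (r : List (Letter n)) :
    Diag k n H (col i :: col j :: col i :: r) (col j :: col i :: col j :: r) :=
  gen (.six i j h) r

variable (H) in
/-- The cup on the colour `i`. -/
def cup (i : ZMod n) (r : List (Letter n)) : Diag k n H r (col i :: col i :: r) :=
  startdot k H i r ⬝ split k H i r

variable (H) in
/-- The cap on the colour `i`. -/
def cap (i : ZMod n) (r : List (Letter n)) : Diag k n H (col i :: col i :: r) r :=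
  merge k H i r ⬝ enddot k H i r

variable (H) in
def cupUD (r : List (Letter n)) : Diag k n H r (up :: down :: r) := gen .cupUD r

variable (H) in
def cupDU (r : List (Letter n)) : Diag k n H r (down :: up :: r) := gen .cupDU r

variable (H) in
def capUD (r : List (Letter n)) : Diag k n H (up :: down :: r) r := gen .capUD r

variable (H) in
def capDU (r : List (Letter n)) : Diag k n H (down :: up :: r) r := gen .capDU r

variable (H) in
def crossU (i : ZMod n) (r : List (Letter n)) :
    Diag k n H (up :: col i :: r) (col (i + 1) :: up :: r) := gen (.crossU i) r

variable (H) in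
def crossUinv (i : ZMod n) (r : List (Letter n)) :
    Diag k n H (col (i + 1) :: up :: r) (up :: col i :: r) := gen (.crossUinv i) r

variable (H) in
def crossD (i : ZMod n) (r : List (Letter n)) :
    Diag k n H (down :: col (i + 1) :: r) (col i :: down :: r) := gen (.crossD i) r

variable (H) in
def crossDinv (i : ZMod n) (r : List (Letter n)) :
    Diag k n H (col i :: down :: r) (down :: col (i + 1) :: r) := gen (.crossDinv i) r

variable (H) in
/-- A strand of colour `l` at the right of three strands `a`, `b`, `c` is moved to their left. -/
def slide {a b c l : ZMod n} (ha : Far a l) (hb : Far b l) (hc : Far c l) (r : List (Letter n)) :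
    Diag k n H (col a :: col b :: col c :: col l :: r) (col l :: col a :: col b :: col c :: r) :=
  consList [col a, col b] (four k H hc r) ⬝ cons (col a) (four k H hb (col c :: r)) ⬝
    four k H ha (col b :: col c :: r)

end

/-- `f.HasDegree d`: the diagrams in `f` are homogeneous of degree `d`. -/
inductive HasDegree {k : Type u} {n : ℕ} {H : Type v} :
    ∀ {a b : List (Letter n)}, Diag k n H a b → ℤ → Prop
  | id (a : List (Letter n)) : HasDegree (Diag.id a) 0
  | comp {a b c : List (Letter n)} {f : Diag k n H a b} {g : Diag k n H b c} {d e : ℤ} :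
      HasDegree f d → HasDegree g e → HasDegree (f ⬝ g) (d + e)
  | cons (x : Letter n) {a b : List (Letter n)} {f : Diag k n H a b} {d : ℤ} :
      HasDegree f d → HasDegree (Diag.cons x f) d
  | gen (g : Gen n H) (r : List (Letter n)) : HasDegree (Diag.gen g r) g.degree
  | zero (a b : List (Letter n)) (d : ℤ) : HasDegree (Diag.zero a b) d
  | add {a b : List (Letter n)} {f g : Diag k n H a b} {d : ℤ} :
      HasDegree f d → HasDegree g d → HasDegree (Diag.add f g) d
  | smul {a b : List (Letter n)} (c : k) {f : Diag k n H a b} {d : ℤ} :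
      HasDegree f d → HasDegree (Diag.smul c f) d

end Diag

section
open Letter Diag

/-- The relations of the extended diagrammatic Hecke category. -/
inductive HeckeRel {k : Type u} [CommRing k] {n : ℕ} {H : Type v} [AddCommGroup H] [Module k H]
    (ρ : AffineRealization k n H) :
    ∀ {a b : List (Letter n)}, Diag k n H a b → Diag k n H a b → Prop
  -- equivalence relation, compatible with all operations
  | refl {a b} (f : Diag k n H a b) : HeckeRel ρ f f
  | symm {a b} {f g : Diag k n H a b} : HeckeRel ρ f g → HeckeRel ρ g f
  | trans {a b} {f g h : Diag k n H a b} : HeckeRel ρ f g → HeckeRel ρ g h → HeckeRel ρ f h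
  | comp_congr {a b c} {f f' : Diag k n H a b} {g g' : Diag k n H b c} :
      HeckeRel ρ f f' → HeckeRel ρ g g' → HeckeRel ρ (f ⬝ g) (f' ⬝ g')
  | cons_congr (x : Letter n) {a b} {f f' : Diag k n H a b} :
      HeckeRel ρ f f' → HeckeRel ρ (cons x f) (cons x f')
  | add_congr {a b} {f f' g g' : Diag k n H a b} :
      HeckeRel ρ f f' → HeckeRel ρ g g' → HeckeRel ρ (add f g) (add f' g')
  | smul_congr {a b} (c : k) {f f' : Diag k n H a b} :
      HeckeRel ρ f f' → HeckeRel ρ (smul c f) (smul c f')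
  -- the morphism spaces are `k`-modules
  | add_assoc {a b} (f g h : Diag k n H a b) : HeckeRel ρ (add (add f g) h) (add f (add g h))
  | add_comm {a b} (f g : Diag k n H a b) : HeckeRel ρ (add f g) (add g f)
  | zero_add {a b} (f : Diag k n H a b) : HeckeRel ρ (add (zero a b) f) f
  | smul_add {a b} (c : k) (f g : Diag k n H a b) :
      HeckeRel ρ (smul c (add f g)) (add (smul c f) (smul c g))
  | add_smul {a b} (c d : k) (f : Diag k n H a b) :
      HeckeRel ρ (smul (c + d) f) (add (smul c f) (smul d f))
  | mul_smul {a b} (c d : k) (f : Diag k n H a b) : HeckeRel ρ (smul (c * d) f) (smul c (smul d f))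
  | one_smul {a b} (f : Diag k n H a b) : HeckeRel ρ (smul 1 f) f
  | zero_smul {a b} (f : Diag k n H a b) : HeckeRel ρ (smul 0 f) (zero a b)
  -- `k`-linear category
  | id_comp {a b} (f : Diag k n H a b) : HeckeRel ρ (Diag.id a ⬝ f) f
  | comp_id {a b} (f : Diag k n H a b) : HeckeRel ρ (f ⬝ Diag.id b) f
  | assoc {a b c d} (f : Diag k n H a b) (g : Diag k n H b c) (h : Diag k n H c d) :
      HeckeRel ρ (f ⬝ g ⬝ h) (f ⬝ (g ⬝ h))
  | comp_add {a b c} (f : Diag k n H a b) (g h : Diag k n H b c) :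
      HeckeRel ρ (f ⬝ add g h) (add (f ⬝ g) (f ⬝ h))
  | add_comp {a b c} (f g : Diag k n H a b) (h : Diag k n H b c) :
      HeckeRel ρ (add f g ⬝ h) (add (f ⬝ h) (g ⬝ h))
  | comp_smul {a b c} (t : k) (f : Diag k n H a b) (g : Diag k n H b c) :
      HeckeRel ρ (f ⬝ smul t g) (smul t (f ⬝ g))
  | smul_comp {a b c} (t : k) (f : Diag k n H a b) (g : Diag k n H b c) :
      HeckeRel ρ (smul t f ⬝ g) (smul t (f ⬝ g))
  -- strict `k`-linear monoidal structure
  | cons_id (x : Letter n) (a) : HeckeRel ρ (cons x (Diag.id a)) (Diag.id (x :: a))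
  | cons_comp (x : Letter n) {a b c} (f : Diag k n H a b) (g : Diag k n H b c) :
      HeckeRel ρ (cons x (f ⬝ g)) (cons x f ⬝ cons x g)
  | cons_add (x : Letter n) {a b} (f g : Diag k n H a b) :
      HeckeRel ρ (cons x (add f g)) (add (cons x f) (cons x g))
  | cons_smul (x : Letter n) {a b} (c : k) (f : Diag k n H a b) :
      HeckeRel ρ (cons x (smul c f)) (smul c (cons x f))
  | interchange (g : Gen n H) {r r'} (f : Diag k n H r r') :
      HeckeRel ρ (gen g r ⬝ consList g.tgt f) (consList g.src f ⬝ gen g r')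
  -- polynomials
  | box_add (x y : H) (r) : HeckeRel ρ (box k (x + y) r) (add (box k x r) (box k y r))
  | box_smul (c : k) (x : H) (r) : HeckeRel ρ (box k (c • x) r) (smul c (box k x r))
  -- one-colour relations: unit, counit, associativity, coassociativity, Frobenius, needle
  | unit_left (i : ZMod n) (r) :
      HeckeRel ρ (startdot k H i (col i :: r) ⬝ merge k H i r) (Diag.id (col i :: r))
  | unit_right (i : ZMod n) (r) :
      HeckeRel ρ (cons (col i) (startdot k H i r) ⬝ merge k H i r) (Diag.id (col i :: r))
  | counit_left (i : ZMod n) (r) :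
      HeckeRel ρ (split k H i r ⬝ enddot k H i (col i :: r)) (Diag.id (col i :: r))
  | counit_right (i : ZMod n) (r) :
      HeckeRel ρ (split k H i r ⬝ cons (col i) (enddot k H i r)) (Diag.id (col i :: r))
  | merge_assoc (i : ZMod n) (r) :
      HeckeRel ρ (merge k H i (col i :: r) ⬝ merge k H i r)
        (cons (col i) (merge k H i r) ⬝ merge k H i r)
  | split_coassoc (i : ZMod n) (r) :
      HeckeRel ρ (split k H i r ⬝ split k H i (col i :: r))
        (split k H i r ⬝ cons (col i) (split k H i r))
  | frobenius_left (i : ZMod n) (r) :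
      HeckeRel ρ (merge k H i r ⬝ split k H i r)
        (split k H i (col i :: r) ⬝ cons (col i) (merge k H i r))
  | frobenius_right (i : ZMod n) (r) :
      HeckeRel ρ (merge k H i r ⬝ split k H i r)
        (cons (col i) (split k H i r) ⬝ merge k H i (col i :: r))
  | needle (i : ZMod n) (r) : HeckeRel ρ (split k H i r ⬝ merge k H i r) (zero _ _)
  -- barbell and polynomial forcing
  | barbell (i : ZMod n) (r) :
      HeckeRel ρ (startdot k H i r ⬝ enddot k H i r) (box k (ρ.root i) r)
  | forcing (i : ZMod n) (x : H) (r) :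
      HeckeRel ρ (box k x (col i :: r))
        (add (cons (col i) (box k (ρ.refl i x) r))
          (smul (ρ.coroot i x) (enddot k H i r ⬝ startdot k H i r)))
  -- two commuting colours
  | four_four {i j : ZMod n} (h : Far i j) (h' : Far j i) (r) :
      HeckeRel ρ (four k H h r ⬝ four k H h' r) (Diag.id (col i :: col j :: r))
  | four_rotate {i j : ZMod n} (h : Far i j) (h' : Far j i) (r) :
      HeckeRel ρ (four k H h' r)
        (cup k H i (col j :: col i :: r) ⬝ cons (col i) (four k H h (col i :: r)) ⬝
          consList [col i, col j] (cap k H i r))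
  | four_merge {i j : ZMod n} (h : Far i j) (r) :
      HeckeRel ρ (merge k H i (col j :: r) ⬝ four k H h r)
        (cons (col i) (four k H h r) ⬝ four k H h (col i :: r) ⬝ cons (col j) (merge k H i r))
  | four_startdot {i j : ZMod n} (h : Far i j) (r) :
      HeckeRel ρ (startdot k H i (col j :: r) ⬝ four k H h r) (cons (col j) (startdot k H i r))
  | four_enddot {i j : ZMod n} (h : Far i j) (r) :
      HeckeRel ρ (four k H h r ⬝ cons (col j) (enddot k H i r)) (enddot k H i (col j :: r))
  -- two adjacent colours: cyclicity, two-colour associativity, dotting a vertex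
  | six_rotate {i j : ZMod n} (h : Adjacent i j) (h' : Adjacent j i) (r) :
      HeckeRel ρ (six k H h' r)
        (cup k H i (col j :: col i :: col j :: r) ⬝ cons (col i) (six k H h (col j :: r)) ⬝
          consList [col i, col j, col i] (cap k H j r))
  | six_merge {i j : ZMod n} (h : Adjacent i j) (r) :
      HeckeRel ρ (merge k H i (col j :: col i :: r) ⬝ six k H h r)
        (cons (col i) (six k H h r) ⬝ six k H h (col j :: r) ⬝
          consList [col j, col i] (merge k H j r))
  | six_enddot {i j : ZMod n} (h : Adjacent i j) (r) :
      HeckeRel ρ (six k H h r ⬝ enddot k H j (col i :: col j :: r))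
        (add (consList [col i, col j] (enddot k H i r))
          (cons (col i) (enddot k H j (col i :: r)) ⬝ merge k H i r ⬝
            cons (col i) (startdot k H j r)))
  -- three colours (types `A₁ × A₁ × A₁`, `A₂ × A₁`, `A₃`)
  | zam_AAA {i j l : ZMod n} (hij : Far i j) (hil : Far i l) (hjl : Far j l) (r) :
      HeckeRel ρ
        (four k H hij (col l :: r) ⬝ cons (col j) (four k H hil r) ⬝ four k H hjl (col i :: r))
        (cons (col i) (four k H hjl r) ⬝ four k H hil (col j :: r) ⬝
          cons (col l) (four k H hij r))
  | zam_AA {i j l : ZMod n} (hij : Adjacent i j) (hil : Far i l) (hjl : Far j l) (r) :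
      HeckeRel ρ (six k H hij (col l :: r) ⬝ slide k H hjl hil hjl r)
        (slide k H hil hjl hil r ⬝ cons (col l) (six k H hij r))
  | zam_A {i j l : ZMod n} (hij : Adjacent i j) (hjl : Adjacent j l) (hil : Far i l)
      (hli : Far l i) (r) :
      HeckeRel ρ
        -- iji lji, jij lji, jil jli, jli jli, jli jil, jlj ijl, ljl ijl
        (six k H hij (col l :: col j :: col i :: r) ⬝
          consList [col j, col i] (six k H hjl (col i :: r)) ⬝
          cons (col j) (four k H hil (col j :: col l :: col i :: r)) ⬝
          consList [col j, col l, col i, col j] (four k H hli r) ⬝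
          consList [col j, col l] (six k H hij (col l :: r)) ⬝
          six k H hjl (col i :: col j :: col l :: r))
        -- iji lji, ijl iji, ijl jij, ilj lij, lij lij, lij ilj, lji jlj, ljil jl, ljl ijl
        (consList [col i, col j] (four k H hil (col j :: col i :: r)) ⬝
          consList [col i, col j, col l] (six k H hij r) ⬝
          cons (col i) (six k H hjl (col i :: col j :: r)) ⬝
          four k H hil (col j :: col l :: col i :: col j :: r) ⬝
          consList [col l, col i, col j] (four k H hli (col j :: r)) ⬝
          cons (col l) (six k H hij (col l :: col j :: r)) ⬝
          consList [col l, col j, col i] (six k H hjl r) ⬝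
          consList [col l, col j] (four k H hil (col j :: col l :: r)))
  -- black strands
  | zigzag_up_left (r) :
      HeckeRel ρ (cupUD k H (up :: r) ⬝ cons up (capDU k H r)) (Diag.id (up :: r))
  | zigzag_up_right (r) :
      HeckeRel ρ (cons up (cupDU k H r) ⬝ capUD k H (up :: r)) (Diag.id (up :: r))
  | zigzag_down_left (r) :
      HeckeRel ρ (cupDU k H (down :: r) ⬝ cons down (capUD k H r)) (Diag.id (down :: r))
  | zigzag_down_right (r) :
      HeckeRel ρ (cons down (cupUD k H r) ⬝ capDU k H (down :: r)) (Diag.id (down :: r))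
  | circle_UD (r) : HeckeRel ρ (cupUD k H r ⬝ capUD k H r) (Diag.id r)
  | circle_DU (r) : HeckeRel ρ (cupDU k H r ⬝ capDU k H r) (Diag.id r)
  | break_UD (r) : HeckeRel ρ (capUD k H r ⬝ cupUD k H r) (Diag.id (up :: down :: r))
  | break_DU (r) : HeckeRel ρ (capDU k H r ⬝ cupDU k H r) (Diag.id (down :: up :: r))
  -- mixed crossings: inverses and cyclicity
  | crossU_inv (i : ZMod n) (r) :
      HeckeRel ρ (crossU k H i r ⬝ crossUinv k H i r) (Diag.id (up :: col i :: r))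
  | crossUinv_cross (i : ZMod n) (r) :
      HeckeRel ρ (crossUinv k H i r ⬝ crossU k H i r) (Diag.id (col (i + 1) :: up :: r))
  | crossD_inv (i : ZMod n) (r) :
      HeckeRel ρ (crossD k H i r ⬝ crossDinv k H i r) (Diag.id (down :: col (i + 1) :: r))
  | crossDinv_cross (i : ZMod n) (r) :
      HeckeRel ρ (crossDinv k H i r ⬝ crossD k H i r) (Diag.id (col i :: down :: r))
  | cross_rotate_black (i : ZMod n) (r) :
      HeckeRel ρ (crossD k H i r)
        (consList [down, col (i + 1)] (cupUD k H r) ⬝ cons down (crossUinv k H i (down :: r)) ⬝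
          capDU k H (col i :: down :: r))
  | cross_rotate_colour (i : ZMod n) (r) :
      HeckeRel ρ (crossUinv k H i r)
        (consList [col (i + 1), up] (cup k H i r) ⬝
          cons (col (i + 1)) (crossU k H i (col i :: r)) ⬝ cap k H (i + 1) (up :: col i :: r))
  -- diagrams can be pulled through a black strand
  | pull_box (x : H) (r) : HeckeRel ρ (cons up (box k x r)) (box k (ρ.tau x) (up :: r))
  | pull_startdot (i : ZMod n) (r) :
      HeckeRel ρ (cons up (startdot k H i r) ⬝ crossU k H i r) (startdot k H (i + 1) (up :: r))
  | pull_enddot (i : ZMod n) (r) :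
      HeckeRel ρ (crossU k H i r ⬝ enddot k H (i + 1) (up :: r)) (cons up (enddot k H i r))
  | pull_merge (i : ZMod n) (r) :
      HeckeRel ρ (cons up (merge k H i r) ⬝ crossU k H i r)
        (crossU k H i (col i :: r) ⬝ cons (col (i + 1)) (crossU k H i r) ⬝
          merge k H (i + 1) (up :: r))
  | pull_split (i : ZMod n) (r) :
      HeckeRel ρ (cons up (split k H i r) ⬝ crossU k H i (col i :: r) ⬝
          cons (col (i + 1)) (crossU k H i r))
        (crossU k H i r ⬝ split k H (i + 1) (up :: r))
  | pull_four {i j : ZMod n} (h : Far i j) (h' : Far (i + 1) (j + 1)) (r) :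
      HeckeRel ρ (cons up (four k H h r) ⬝ crossU k H j (col i :: r) ⬝
          cons (col (j + 1)) (crossU k H i r))
        (crossU k H i (col j :: r) ⬝ cons (col (i + 1)) (crossU k H j r) ⬝
          four k H h' (up :: r))
  | pull_six {i j : ZMod n} (h : Adjacent i j) (h' : Adjacent (i + 1) (j + 1)) (r) :
      HeckeRel ρ (cons up (six k H h r) ⬝ crossU k H j (col i :: col j :: r) ⬝
          cons (col (j + 1)) (crossU k H i (col j :: r)) ⬝
          consList [col (j + 1), col (i + 1)] (crossU k H j r))
        (crossU k H i (col j :: col i :: r) ⬝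
          cons (col (i + 1)) (crossU k H j (col i :: r)) ⬝
          consList [col (i + 1), col (j + 1)] (crossU k H i r) ⬝ six k H h' (up :: r))

end

section
variable {k : Type u} [CommRing k] {n : ℕ} {H : Type v} [AddCommGroup H] [Module k H]
variable (ρ : AffineRealization k n H)

/-- The relations as a setoid on diagrams with fixed source and target. -/
def relSetoid (a b : List (Letter n)) : Setoid (Diag k n H a b) where
  r := HeckeRel ρ
  iseqv := ⟨HeckeRel.refl, HeckeRel.symm, HeckeRel.trans⟩

/-- Morphisms (of all degrees) between two words in the extended diagrammatic Hecke category. -/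
def EHom (a b : List (Letter n)) : Type (max u v) := Quotient (relSetoid ρ a b)

namespace EHom

variable {ρ}

def mk (ρ : AffineRealization k n H) {a b : List (Letter n)} (f : Diag k n H a b) : EHom ρ a b :=
  Quotient.mk (relSetoid ρ a b) f

def id (ρ : AffineRealization k n H) (a : List (Letter n)) : EHom ρ a a := mk ρ (Diag.id a)

/-- Composition in diagrammatic order: `f` followed by `g`. -/
def comp {a b c : List (Letter n)} (f : EHom ρ a b) (g : EHom ρ b c) : EHom ρ a c :=
  Quotient.map₂ Diag.comp (fun _ _ h _ _ h' => HeckeRel.comp_congr h h') f g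

infixl:80 " ⊚ " => EHom.comp

/-- Identity of the letter `x` on the left. -/
def cons (x : Letter n) {a b : List (Letter n)} (f : EHom ρ a b) : EHom ρ (x :: a) (x :: b) :=
  Quotient.map (Diag.cons x) (fun _ _ h => HeckeRel.cons_congr x h) f

/-- The identity, for equal words. -/
def cast (ρ : AffineRealization k n H) {a b : List (Letter n)} (h : a = b) : EHom ρ a b :=
  h ▸ id ρ a

variable {a b : List (Letter n)}

instance : Zero (EHom ρ a b) := ⟨mk ρ (Diag.zero a b)⟩
instance : Add (EHom ρ a b) :=
  ⟨Quotient.map₂ Diag.add (fun _ _ h _ _ h' => HeckeRel.add_congr h h')⟩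
instance : SMul k (EHom ρ a b) :=
  ⟨fun c => Quotient.map (Diag.smul c) (fun _ _ h => HeckeRel.smul_congr c h)⟩

instance : Neg (EHom ρ a b) := ⟨fun f => (-1 : k) • f⟩

instance : AddCommGroup (EHom ρ a b) where
  add_assoc := by
    rintro ⟨f⟩ ⟨g⟩ ⟨h⟩; exact Quotient.sound (HeckeRel.add_assoc f g h)
  zero_add := by
    rintro ⟨f⟩; exact Quotient.sound (HeckeRel.zero_add f)
  add_zero := by
    rintro ⟨f⟩; exact Quotient.sound ((HeckeRel.add_comm _ _).trans (HeckeRel.zero_add f))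
  add_comm := by
    rintro ⟨f⟩ ⟨g⟩; exact Quotient.sound (HeckeRel.add_comm f g)
  nsmul := nsmulRec
  zsmul := zsmulRec
  neg_add_cancel := by
    rintro ⟨f⟩
    refine Quotient.sound (((HeckeRel.add_congr (HeckeRel.refl _) (HeckeRel.one_smul f).symm).trans
      (HeckeRel.add_smul (-1) 1 f).symm).trans ?_)
    rw [neg_add_cancel]
    exact HeckeRel.zero_smul f

instance : Module k (EHom ρ a b) where
  one_smul := by
    rintro ⟨f⟩; exact Quotient.sound (HeckeRel.one_smul f)
  mul_smul := by
    rintro c d ⟨f⟩; exact Quotient.sound (HeckeRel.mul_smul c d f)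
  smul_zero := by
    intro c
    refine Quotient.sound ((HeckeRel.smul_congr c (HeckeRel.zero_smul (Diag.zero a b)).symm).trans
      ((HeckeRel.mul_smul c 0 _).symm.trans ?_))
    rw [mul_zero]
    exact HeckeRel.zero_smul _
  smul_add := by
    rintro c ⟨f⟩ ⟨g⟩; exact Quotient.sound (HeckeRel.smul_add c f g)
  add_smul := by
    rintro c d ⟨f⟩; exact Quotient.sound (HeckeRel.add_smul c d f)
  zero_smul := by
    rintro ⟨f⟩; exact Quotient.sound (HeckeRel.zero_smul f)

/-- The morphism `f` is homogeneous of degree `d`. -/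
def HasDegree {a b : List (Letter n)} (f : EHom ρ a b) (d : ℤ) : Prop :=
  ∃ D : Diag k n H a b, D.HasDegree d ∧ mk ρ D = f

theorem HasDegree.zero (d : ℤ) : (0 : EHom ρ a b).HasDegree d :=
  ⟨_, Diag.HasDegree.zero a b d, rfl⟩

theorem HasDegree.add {f g : EHom ρ a b} {d : ℤ} (hf : f.HasDegree d) (hg : g.HasDegree d) :
    (f + g).HasDegree d := by
  obtain ⟨D, hD, rfl⟩ := hf
  obtain ⟨E, hE, rfl⟩ := hg
  exact ⟨_, hD.add hE, rfl⟩

theorem HasDegree.smul (c : k) {f : EHom ρ a b} {d : ℤ} (hf : f.HasDegree d) :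
    (c • f).HasDegree d := by
  obtain ⟨D, hD, rfl⟩ := hf
  exact ⟨_, hD.smul c, rfl⟩

theorem HasDegree.neg {f : EHom ρ a b} {d : ℤ} (hf : f.HasDegree d) : (-f).HasDegree d :=
  hf.smul (-1)

theorem HasDegree.sum {ι : Type*} (s : Finset ι) (f : ι → EHom ρ a b) {d : ℤ}
    (hf : ∀ i ∈ s, (f i).HasDegree d) : (∑ i ∈ s, f i).HasDegree d := by
  classical
  induction s using Finset.induction_on with
  | empty => simpa using HasDegree.zero d
  | insert i s hi ih =>
    rw [Finset.sum_insert hi]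
    exact (hf i (by simp)).add (ih fun j hj => hf j (by simp [hj]))

theorem HasDegree.comp {c : List (Letter n)} {f : EHom ρ a b} {g : EHom ρ b c} {d e t : ℤ}
    (hf : f.HasDegree d) (hg : g.HasDegree e) (h : d + e = t) : (f ⊚ g).HasDegree t := by
  obtain ⟨D, hD, rfl⟩ := hf
  obtain ⟨E, hE, rfl⟩ := hg
  exact ⟨_, h ▸ hD.comp hE, rfl⟩

theorem HasDegree.cons (x : Letter n) {f : EHom ρ a b} {d : ℤ} (hf : f.HasDegree d) :
    (cons x f).HasDegree d := by
  obtain ⟨D, hD, rfl⟩ := hf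
  exact ⟨_, hD.cons x, rfl⟩

theorem HasDegree.cast (h : a = b) : (cast ρ h).HasDegree 0 := by
  subst h
  exact ⟨_, Diag.HasDegree.id a, rfl⟩

/-- Startdot, enddot and 4-valent vertex as morphisms. -/
def startdot (ρ : AffineRealization k n H) (i : ZMod n) (r : List (Letter n)) :
    EHom ρ r (Letter.col i :: r) := mk ρ (Diag.startdot k H i r)

def enddot (ρ : AffineRealization k n H) (i : ZMod n) (r : List (Letter n)) :
    EHom ρ (Letter.col i :: r) r := mk ρ (Diag.enddot k H i r)

def four (ρ : AffineRealization k n H) {i j : ZMod n} (h : Far i j) (r : List (Letter n)) :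
    EHom ρ (Letter.col i :: Letter.col j :: r) (Letter.col j :: Letter.col i :: r) :=
  mk ρ (Diag.four k H h r)

theorem HasDegree.startdot (i : ZMod n) (r : List (Letter n)) :
    (startdot ρ i r).HasDegree 1 := ⟨_, Diag.HasDegree.gen (.startdot i) r, rfl⟩

theorem HasDegree.enddot (i : ZMod n) (r : List (Letter n)) :
    (enddot ρ i r).HasDegree 1 := ⟨_, Diag.HasDegree.gen (.enddot i) r, rfl⟩

theorem HasDegree.four {i j : ZMod n} (h : Far i j) (r : List (Letter n)) :
    (four ρ h r).HasDegree 0 := ⟨_, Diag.HasDegree.gen (.four i j h) r, rfl⟩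

/-- The box `x ∈ 𝔥*` placed at the right of the word `w`. -/
def rightBox (ρ : AffineRealization k n H) (x : H) : (w : List (Letter n)) → EHom ρ w w
  | [] => mk ρ (Diag.box k x [])
  | y :: w => cons y (rightBox ρ x w)

end EHom

end

/-! ### (Pseudo)complexes in the additive graded envelope -/

section
variable {k : Type u} [CommRing k] {n : ℕ} {H : Type v} [AddCommGroup H] [Module k H]

/-- A bounded sequence of objects and degree-zero maps in the additive graded envelope of the
extended diagrammatic Hecke category, with no condition on `d ∘ d`.  The chain object in
homological degree `p` is the finite direct sum, over the `a` with `deg a = p`, of the words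
`word a` with grading shift `(shift a)`; a map `B(s) → B'(s')` of degree zero is a morphism
`B → B'` of degree `s' - s`.  The matrix coefficient of the differential from the summand `a` to
the summand `b` is `d a b`. -/
structure PreComplex (ρ : AffineRealization k n H) where
  ι : Type
  [fintype : Fintype ι]
  word : ι → List (Letter n)
  shift : ι → ℤ
  deg : ι → ℤ
  d : ∀ a b, EHom ρ (word a) (word b)
  d_eq_zero : ∀ a b, deg b ≠ deg a + 1 → d a b = 0
  d_degree : ∀ a b, (d a b).HasDegree (shift b - shift a)

attribute [instance] PreComplex.fintype

namespace PreComplex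

variable {ρ : AffineRealization k n H}

/-- The matrix coefficients of the square of the differential. -/
def dSq (C : PreComplex ρ) (a b : C.ι) : EHom ρ (C.word a) (C.word b) :=
  ∑ c, C.d a c ⊚ C.d c b

/-- A genuine complex: `d² = 0`. -/
def IsComplex (C : PreComplex ρ) : Prop := ∀ a b, C.dSq a b = 0

/-- A pseudocomplex: every coefficient of `d²` is a right multiple `μ δ` of the sum `δ` of the
simple roots, with `μ` homogeneous. -/
def IsPseudocomplex [NeZero n] (C : PreComplex ρ) : Prop :=
  ∀ a b, ∃ μ : EHom ρ (C.word a) (C.word b), μ.HasDegree (C.shift b - C.shift a - 2) ∧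
    C.dSq a b = μ ⊚ EHom.rightBox ρ ρ.delta (C.word b)

/-- Families of matrix coefficients which are maps `C → D` of homological degree `p` and of
internal degree zero. -/
structure Map (C D : PreComplex ρ) (p : ℤ) where
  f : ∀ a b, EHom ρ (C.word a) (D.word b)
  f_eq_zero : ∀ a b, D.deg b ≠ C.deg a + p → f a b = 0
  f_degree : ∀ a b, (f a b).HasDegree (D.shift b - C.shift a)

/-- Identity matrix. -/
noncomputable def one (C : PreComplex ρ) (a b : C.ι) : EHom ρ (C.word a) (C.word b) :=
  open Classical in if h : a = b then EHom.cast ρ (congrArg C.word h) else 0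

/-- The map commutes with the differentials. -/
def Map.IsChainMap {C D : PreComplex ρ} (φ : Map C D 0) : Prop :=
  ∀ a b, ∑ c, φ.f a c ⊚ D.d c b = ∑ c, C.d a c ⊚ φ.f c b

/-- `C` and `D` are isomorphic, by degree-zero maps commuting strictly with the differentials. -/
def IsIsomorphic (C D : PreComplex ρ) : Prop :=
  ∃ (φ : Map C D 0) (ψ : Map D C 0), φ.IsChainMap ∧ ψ.IsChainMap ∧
    (∀ a b, ∑ c, φ.f a c ⊚ ψ.f c b = C.one a b) ∧ (∀ a b, ∑ c, ψ.f a c ⊚ φ.f c b = D.one a b)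

/-- `C` and `D` are homotopy equivalent. -/
def IsHomotopyEquivalent (C D : PreComplex ρ) : Prop :=
  ∃ (φ : Map C D 0) (ψ : Map D C 0) (h : Map C C (-1)) (h' : Map D D (-1)),
    φ.IsChainMap ∧ ψ.IsChainMap ∧
    (∀ a b, C.one a b - ∑ c, φ.f a c ⊚ ψ.f c b =
      ∑ c, C.d a c ⊚ h.f c b + ∑ c, h.f a c ⊚ C.d c b) ∧
    (∀ a b, D.one a b - ∑ c, ψ.f a c ⊚ φ.f c b =
      ∑ c, D.d a c ⊚ h'.f c b + ∑ c, h'.f a c ⊚ D.d c b)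

/-- `C` is perverse and made of multiplicity-free Bott-Samelson objects: every summand in
homological degree `p` has the form `Ω^m B_{i_1} ⋯ B_{i_d} (p)` with pairwise distinct
`i_1, …, i_d`.  Such an object is the indecomposable object `B_w (p)` attached to
`w = ω^m s_{i_1} ⋯ s_{i_d}`, so `C` is a perverse complex in the usual sense, and in particular
it is a minimal complex. -/
def IsMultFreePerverse (C : PreComplex ρ) : Prop :=
  ∀ a, C.shift a = C.deg a ∧ ∃ (m : ℕ) (x : Letter n) (w : List (ZMod n)),
    (x = Letter.up ∨ x = Letter.down) ∧ w.Nodup ∧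
      C.word a = List.replicate m x ++ w.map Letter.col

/-- Tensor product with `Ω⁺` or `Ω⁻` (as a complex in homological degree zero) on the left. -/
def consLetter (x : Letter n) (C : PreComplex ρ) : PreComplex ρ where
  ι := C.ι
  word a := x :: C.word a
  shift := C.shift
  deg := C.deg
  d a b := EHom.cons x (C.d a b)
  d_eq_zero a b h := by
    rw [C.d_eq_zero a b h]
    exact Quotient.sound ((HeckeRel.cons_congr x (HeckeRel.zero_smul (Diag.zero _ _)).symm).trans
      ((HeckeRel.cons_smul x 0 _).trans (HeckeRel.zero_smul _)))
  d_degree a b := (C.d_degree a b).cons x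

/-- The monoidal unit as a complex in degree zero. -/
def unit (ρ : AffineRealization k n H) : PreComplex ρ where
  ι := Unit
  word _ := []
  shift _ := 0
  deg _ := 0
  d _ _ := 0
  d_eq_zero _ _ _ := rfl
  d_degree _ _ := EHom.HasDegree.zero _

open Classical in
/-- The tensor product `F_i ⊗ C` where `F_i` is the Rouquier complex `B_i → R(1)`, with `B_i` in
degree `0`, the differential being the enddot; the usual sign `(-1)^p` is put on `1 ⊗ d`.
`Sum.inl a` is the summand `B_i ⊗ a` and `Sum.inr a` is the summand `R(1) ⊗ a`. -/
noncomputable def tensorF (i : ZMod n) (C : PreComplex ρ) : PreComplex ρ where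
  ι := C.ι ⊕ C.ι
  word := Sum.elim (fun a => Letter.col i :: C.word a) C.word
  shift := Sum.elim C.shift (fun a => C.shift a + 1)
  deg := Sum.elim C.deg (fun a => C.deg a + 1)
  d
    | .inl a, .inl b => EHom.cons (Letter.col i) (C.d a b)
    | .inl a, .inr b =>
        if h : a = b then EHom.enddot ρ i (C.word a) ⊚ EHom.cast ρ (congrArg C.word h) else 0
    | .inr _, .inl _ => 0
    | .inr a, .inr b => -C.d a b
  d_eq_zero := by
    rintro (a | a) (b | b) h
    · exact (C.consLetter (Letter.col i)).d_eq_zero a b h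
    · exact dif_neg fun e => h (by simp [e])
    · rfl
    · have h0 : C.d a b = 0 := C.d_eq_zero a b fun e => h (by simp [e])
      exact neg_eq_zero.mpr h0
  d_degree := by
    rintro (a | a) (b | b)
    · exact (C.d_degree a b).cons _
    · dsimp only
      split_ifs with h
      · subst h
        exact (EHom.HasDegree.enddot i _).comp (EHom.HasDegree.cast rfl) (by simp)
      · exact EHom.HasDegree.zero _
    · exact EHom.HasDegree.zero _
    · simpa using (C.d_degree a b).neg

open Classical in
/-- The tensor product `F_i⁻¹ ⊗ C` where `F_i⁻¹` is the Rouquier complex `R(-1) → B_i`, with `B_i`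
in degree `0`, the differential being the startdot.
`Sum.inl a` is the summand `B_i ⊗ a` and `Sum.inr a` is the summand `R(-1) ⊗ a`. -/
noncomputable def tensorFinv (i : ZMod n) (C : PreComplex ρ) : PreComplex ρ where
  ι := C.ι ⊕ C.ι
  word := Sum.elim (fun a => Letter.col i :: C.word a) C.word
  shift := Sum.elim C.shift (fun a => C.shift a - 1)
  deg := Sum.elim C.deg (fun a => C.deg a - 1)
  d
    | .inl a, .inl b => EHom.cons (Letter.col i) (C.d a b)
    | .inl _, .inr _ => 0
    | .inr a, .inl b =>
        if h : a = b then EHom.cast ρ (congrArg C.word h) ⊚ EHom.startdot ρ i (C.word b) else 0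
    | .inr a, .inr b => -C.d a b
  d_eq_zero := by
    rintro (a | a) (b | b) h
    · exact (C.consLetter (Letter.col i)).d_eq_zero a b h
    · rfl
    · exact dif_neg fun e => h (by simp [e])
    · have h0 : C.d a b = 0 := C.d_eq_zero a b fun e => h (by simp [e])
      exact neg_eq_zero.mpr h0
  d_degree := by
    rintro (a | a) (b | b)
    · exact (C.d_degree a b).cons _
    · exact EHom.HasDegree.zero _
    · dsimp only
      split_ifs with h
      · subst h
        exact (EHom.HasDegree.cast rfl).comp (EHom.HasDegree.startdot i _) (by simp)
      · exact EHom.HasDegree.zero _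
    · simpa using (C.d_degree a b).neg

/-- The data of a convolution of `N_0, …, N_{m-1}`: a differential on `⊕ N_i` whose diagonal parts
`N_i → N_i` are the differentials of the `N_i` and whose parts `N_j → N_i` vanish for `j < i`. -/
structure Convolution {m : ℕ} (N : Fin m → PreComplex ρ) where
  d : ∀ x y : (Σ i, (N i).ι), EHom ρ ((N x.1).word x.2) ((N y.1).word y.2)
  d_eq_zero : ∀ x y, (N y.1).deg y.2 ≠ (N x.1).deg x.2 + 1 → d x y = 0
  d_degree : ∀ x y, (d x y).HasDegree ((N y.1).shift y.2 - (N x.1).shift x.2)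
  d_diag : ∀ i a b, d ⟨i, a⟩ ⟨i, b⟩ = (N i).d a b
  d_lower : ∀ x y, x.1 < y.1 → d x y = 0

/-- The total (pseudo)complex of a convolution. -/
def Convolution.total {m : ℕ} {N : Fin m → PreComplex ρ} (c : Convolution N) : PreComplex ρ where
  ι := Σ i, (N i).ι
  word x := (N x.1).word x.2
  shift x := (N x.1).shift x.2
  deg x := (N x.1).deg x.2
  d := c.d
  d_eq_zero := c.d_eq_zero
  d_degree := c.d_degree

end PreComplex

end

/-! ### The extended affine braid group, translations, Rouquier and Wakimoto complexes -/

/-- The letters of extended braid words. -/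
inductive BraidLetter (n : ℕ) : Type
  | f (i : ZMod n) : BraidLetter n
  | fInv (i : ZMod n) : BraidLetter n
  | omega : BraidLetter n
  | omegaInv : BraidLetter n

section
open FreeGroup

/-- The defining relations of the extended affine braid group; the generator `f_i` is `some i` and
`ω` is `none`. -/
def braidRels (n : ℕ) : Set (FreeGroup (Option (ZMod n))) :=
  {x | (∃ i j : ZMod n, Adjacent i j ∧ x = of (some i) * of (some j) * of (some i) *
      (of (some j) * of (some i) * of (some j))⁻¹) ∨
    (∃ i j : ZMod n, Far i j ∧ x = of (some i) * of (some j) * (of (some j) * of (some i))⁻¹) ∨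
    (∃ i : ZMod n, x = of none * of (some i) * (of none)⁻¹ * (of (some (i + 1)))⁻¹)}

/-- The extended affine (cylindrical) braid group `ℤ ⋉ Br_aff`. -/
abbrev ExtBraid (n : ℕ) : Type := PresentedGroup (braidRels n)

/-- The generators `f_i` and `ω` of the extended affine braid group. -/
def ExtBraid.f {n : ℕ} (i : ZMod n) : ExtBraid n := PresentedGroup.of (some i)

def ExtBraid.omega (n : ℕ) : ExtBraid n := PresentedGroup.of none

/-- The braid represented by a letter, resp. by a word. -/
def BraidLetter.toBraid {n : ℕ} : BraidLetter n → ExtBraid n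
  | .f i => ExtBraid.f i
  | .fInv i => (ExtBraid.f i)⁻¹
  | .omega => ExtBraid.omega n
  | .omegaInv => (ExtBraid.omega n)⁻¹

def braidOf {n : ℕ} (b : List (BraidLetter n)) : ExtBraid n := (b.map BraidLetter.toBraid).prod

/-- The translations `y_1, …, y_n`; here `t : Fin n` stands for the index `i = t + 1`, and
`y_i = f_{i-1}⁻¹ ⋯ f_2⁻¹ f_1⁻¹ ω f_{n-1} ⋯ f_{i+1} f_i`. -/
def yBraid {n : ℕ} (t : Fin n) : ExtBraid n :=
  (((List.range t).map fun s => (ExtBraid.f ((s + 1 : ℕ) : ZMod n))⁻¹).reverse).prod *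
    ExtBraid.omega n *
    (((List.range (n - 1 - t)).map fun s =>
      ExtBraid.f ((t + 1 + s : ℕ) : ZMod n)).reverse).prod

/-- The element `w_λ = y_1^{λ_1} ⋯ y_n^{λ_n}` of the translation lattice. -/
def translation {n : ℕ} (lam : Fin n → ℤ) : ExtBraid n :=
  (List.ofFn fun t => yBraid t ^ lam t).prod

end

section
variable {k : Type u} [CommRing k] {n : ℕ} {H : Type v} [AddCommGroup H] [Module k H]

/-- The extended Rouquier complex of an extended braid word. -/
noncomputable def rouquier (ρ : AffineRealization k n H) : List (BraidLetter n) → PreComplex ρ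
  | [] => PreComplex.unit ρ
  | .f i :: b => (rouquier ρ b).tensorF i
  | .fInv i :: b => (rouquier ρ b).tensorFinv i
  | .omega :: b => (rouquier ρ b).consLetter Letter.up
  | .omegaInv :: b => (rouquier ρ b).consLetter Letter.down

/-- `N` is the minimal complex `W(λ)`, in the case that `W(λ)` is perverse and multiplicity-free:
such a complex (automatically minimal) homotopy equivalent to the Rouquier complex of a braid word
for `w_λ`.  This covers the weights `λ` of the standard representation. -/
def IsWakimotoComplex {ρ : AffineRealization k n H} (lam : Fin n → ℤ) (N : PreComplex ρ) : Prop :=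
  N.IsComplex ∧ N.IsMultFreePerverse ∧
    ∃ b : List (BraidLetter n), braidOf b = translation lam ∧ N.IsHomotopyEquivalent (rouquier ρ b)

/-- The (pseudo)complex `C` is perverse (hence minimal), and is isomorphic to a convolution of the
Wakimoto complexes `W(λ_0), …, W(λ_{m-1})`, the first of them being a subcomplex and the last of
them a quotient. -/
def HasWakimotoFiltration {ρ : AffineRealization k n H} (C : PreComplex ρ) {m : ℕ}
    (lam : Fin m → Fin n → ℤ) : Prop :=
  C.IsMultFreePerverse ∧ ∃ N : Fin m → PreComplex ρ, (∀ t, IsWakimotoComplex (lam t) (N t)) ∧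
    ∃ c : PreComplex.Convolution N, C.IsIsomorphic c.total

end

/-! ### The weight filtration of the standard representation -/

/-- The `λ`-weight space of the standard representation `ℂⁿ` of `𝔤𝔩_n`. -/
def weightSpace {n : ℕ} (lam : Fin n → ℤ) : Submodule ℂ (Fin n → ℂ) where
  carrier := {x | ∀ t : Fin n → ℂ, (Matrix.diagonal t).mulVec x = (∑ i, (lam i : ℂ) * t i) • x}
  add_mem' := by
    intro x y hx hy t
    rw [Matrix.mulVec_add, hx t, hy t, smul_add]
  zero_mem' := by
    intro t
    simp
  smul_mem' := by
    intro c x hx t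
    rw [Matrix.mulVec_smul, hx t, smul_comm]

/-- The weights `λ_0, …, λ_{m-1}` are pairwise distinct, `ℂⁿ` is the direct sum of their weight
spaces, and the sums of the first weight spaces form a filtration of `ℂⁿ` by submodules over the
upper triangular matrices (the subquotients of this filtration are the weight spaces). -/
def IsWeightFiltration {n m : ℕ} (lam : Fin m → Fin n → ℤ) : Prop :=
  Function.Injective lam ∧ DirectSum.IsInternal (fun t => weightSpace (lam t)) ∧
    ∀ t, ∀ A : Matrix (Fin n) (Fin n) ℂ, (∀ i j, j < i → A i j = 0) →
      ∀ x ∈ ⨆ s ≤ t, weightSpace (lam s), A.mulVec x ∈ ⨆ s ≤ t, weightSpace (lam s)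

/-! ### The standard Gaitsgory complex -/

section
variable {n : ℕ}

/-- The reduced expression `s_{x_d} ⋯ s_{x_1}` of the Coxeter element `h_X`, where
`X = {x_1 < ⋯ < x_d}` in the cyclic order `c < c + 1 < ⋯ < c - 1` (used for `c ∉ X`). -/
def cyclicWord (c : ZMod n) (X : Finset (ZMod n)) : List (ZMod n) :=
  ((List.range (n - 1)).map fun t : ℕ => c - 1 - (t : ZMod n)).filter (· ∈ X)

/-- The Bott-Samelson object of an expression. -/
def bsWord (w : List (ZMod n)) : List (Letter n) := w.map Letter.col

/-- The index set of the chain objects: `X ∈ P_p` if `X` is a proper subset of `ℤ/n` with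
`|X| ≤ n - 1 - |p|` and `n - 1 - p - |X|` is even. -/
def ChainSet (n : ℕ) [NeZero n] (p : ℤ) : Finset (Finset (ZMod n)) :=
  Finset.univ.filter fun X => X ≠ Finset.univ ∧ (X.card : ℤ) ≤ n - 1 - |p| ∧
    Even ((n : ℤ) - 1 - p - X.card)

variable {k : Type u} [CommRing k] {H : Type v} [AddCommGroup H] [Module k H]
variable (ρ : AffineRealization k n H)

/-- Moves the first occurrence of `x` in an expression to its front by 4-valent vertices, each with a
sign `-1` (junk value `0` if `x` does not occur, or has to pass a letter not commuting with it). -/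
def pullFront (x : ZMod n) : (w : List (ZMod n)) → EHom ρ (bsWord w) (bsWord (x :: w.erase x))
  | [] => 0
  | y :: w =>
      if h : y = x then EHom.cast ρ (by simp [h])
      else if hf : Far y x then
        EHom.cons (Letter.col y) (pullFront x w) ⊚ (-EHom.four ρ hf (bsWord (w.erase x))) ⊚
          EHom.cast ρ (by simp [bsWord, h])
      else 0

/-- The signed rex move between two expressions related by commutations: a composition of
4-valent vertices, with the sign `-1` for each of them. -/
def signedRex : (w w' : List (ZMod n)) → EHom ρ (bsWord w) (bsWord w')
  | w, [] => if h : w = [] then EHom.cast ρ (by rw [h]) else 0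
  | w, x :: w' => pullFront ρ x w ⊚ EHom.cons (Letter.col x) (signedRex (w.erase x) w')

/-- The startdot that inserts the letter `i` of `w`, with the sign `(-1)^l` where `l` is the number
of strands on its left. -/
def insertDot (i : ZMod n) : (w : List (ZMod n)) → EHom ρ (bsWord (w.erase i)) (bsWord w)
  | [] => 0
  | y :: w =>
      if h : y = i then EHom.cast ρ (by simp [h]) ⊚ EHom.startdot ρ y (bsWord w)
      else EHom.cast ρ (by simp [bsWord, h]) ⊚
        (-EHom.cons (Letter.col y) (insertDot i w))

/-- The enddot that removes the letter `i` of `w`, with the sign `(-1)^l` where `l` is the number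
of strands on its left. -/
def removeDot (i : ZMod n) : (w : List (ZMod n)) → EHom ρ (bsWord w) (bsWord (w.erase i))
  | [] => 0
  | y :: w =>
      if h : y = i then EHom.enddot ρ y (bsWord w) ⊚ EHom.cast ρ (by simp [h])
      else (-EHom.cons (Letter.col y) (removeDot i w)) ⊚
        EHom.cast ρ (by simp [bsWord, h])

variable (al : Finset (ZMod n) → ZMod n)

/-- The preferred expression of `h_X`, for a choice `al X ∉ X` of cyclic orders; `B_X` is
`bsWord (prefWord al X)`. -/
def prefWord (X : Finset (ZMod n)) : List (ZMod n) := cyclicWord (al X) X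

/-- The signed dot `B_X → B_Y(1)` for `Y = X ∪ {i}`, `i ∉ X`. -/
def dotUp (i : ZMod n) (X Y : Finset (ZMod n)) :
    EHom ρ (bsWord (prefWord al X)) (bsWord (prefWord al Y)) :=
  signedRex ρ (prefWord al X) ((prefWord al Y).erase i) ⊚ insertDot ρ i (prefWord al Y)

/-- The signed dot `B_Y → B_X(1)` for `Y = X ∪ {i}`, `i ∉ X`. -/
def dotDown (i : ZMod n) (Y X : Finset (ZMod n)) :
    EHom ρ (bsWord (prefWord al Y)) (bsWord (prefWord al X)) :=
  removeDot ρ i (prefWord al Y) ⊚ signedRex ρ ((prefWord al Y).erase i) (prefWord al X)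

open EHom in
theorem pullFront_degree (x : ZMod n) (w : List (ZMod n)) : (pullFront ρ x w).HasDegree 0 := by
  induction w with
  | nil => exact HasDegree.zero _
  | cons y w ih =>
    unfold pullFront
    split_ifs with h hf
    · exact HasDegree.cast _
    · exact ((ih.cons _).comp (HasDegree.four hf _).neg (zero_add 0)).comp
        (HasDegree.cast _) (zero_add 0)
    · exact HasDegree.zero _

open EHom in
theorem signedRex_degree (w w' : List (ZMod n)) : (signedRex ρ w w').HasDegree 0 := by
  induction w' generalizing w with
  | nil =>
    unfold signedRex
    split_ifs with h
    · exact HasDegree.cast _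
    · exact HasDegree.zero _
  | cons x w' ih =>
    unfold signedRex
    exact (pullFront_degree ρ x w).comp ((ih _).cons _) (zero_add 0)

open EHom in
theorem insertDot_degree (i : ZMod n) (w : List (ZMod n)) : (insertDot ρ i w).HasDegree 1 := by
  induction w with
  | nil => exact HasDegree.zero _
  | cons y w ih =>
    unfold insertDot
    split_ifs with h
    · exact (HasDegree.cast _).comp (HasDegree.startdot _ _) (zero_add 1)
    · exact (HasDegree.cast _).comp (ih.cons _).neg (zero_add 1)

open EHom in
theorem removeDot_degree (i : ZMod n) (w : List (ZMod n)) : (removeDot ρ i w).HasDegree 1 := by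
  induction w with
  | nil => exact HasDegree.zero _
  | cons y w ih =>
    unfold removeDot
    split_ifs with h
    · exact (HasDegree.enddot _ _).comp (HasDegree.cast _) (add_zero 1)
    · exact (ih.cons _).neg.comp (HasDegree.cast _) (add_zero 1)

/-- The twisted standard complex: the summand `(p, X)` with `X ∈ P_p` is `B_X(p)` in homological
degree `p`, and the differential is the sum of all signed dots.  (`P_p` is empty for `|p| ≥ n`.) -/
noncomputable def twistedStandard [NeZero n] : PreComplex ρ where
  ι := Σ p : Finset.Icc (-(n : ℤ)) n, ChainSet n p
  word a := bsWord (prefWord al a.2)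
  shift a := a.1
  deg a := a.1
  d a b :=
    if (b.1 : ℤ) = a.1 + 1 then
      (∑ i, if i ∉ (a.2 : Finset (ZMod n)) ∧ (b.2 : Finset (ZMod n)) = insert i (a.2 : Finset (ZMod n))
        then dotUp ρ al i a.2 b.2 else 0) +
      (∑ j, if j ∈ (a.2 : Finset (ZMod n)) ∧ (b.2 : Finset (ZMod n)) = Finset.erase a.2 j
        then dotDown ρ al j a.2 b.2 else 0)
    else 0
  d_eq_zero a b h := if_neg h
  d_degree a b := by
    split_ifs with h
    · have h1 : (b.1 : ℤ) - a.1 = 1 := by rw [h]; ring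
      rw [h1]
      refine EHom.HasDegree.add (EHom.HasDegree.sum _ _ fun i _ => ?_)
        (EHom.HasDegree.sum _ _ fun i _ => ?_)
      · split_ifs
        · exact (signedRex_degree ρ _ _).comp (insertDot_degree ρ _ _) (zero_add 1)
        · exact EHom.HasDegree.zero _
      · split_ifs
        · exact (removeDot_degree ρ _ _).comp (signedRex_degree ρ _ _) (add_zero 1)
        · exact EHom.HasDegree.zero _
    · exact EHom.HasDegree.zero _

/-- The standard Gaitsgory complex `Ω ⊗ F`, where `F` is the twisted standard complex. -/
noncomputable def standardGaitsgory [NeZero n] : PreComplex ρ := (twistedStandard ρ al).consLetter Letter.up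

end

/-! ### Linear algebra in the extended Hecke category -/

namespace EHom

variable {k : Type u} [CommRing k] {n : ℕ} {H : Type v} [AddCommGroup H] [Module k H]
variable {ρ : AffineRealization k n H} {a b c d : List (Letter n)}

/-! There are two independent arguments: one computes `d²`, the other sorts the summands `(p, X)` of
`F` into `n` cubes.

Square of the differential. A path of two signed dots in `F` changes the membership of two strands.
If the strands `i ≠ j` differ, the two orders give the same endpoints with opposite signs
(`Dot.anticomm`), because each dot carries a sign for every strand on its left. This survives the
passage to chosen expressions since signed rex moves with the same source and target agree
(`Rex.unique`: every rex move has a normal form, by the relations for commuting colours), so that a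
signed dot up to rex moves is determined by its endpoints (`Mov.unique`). Hence `Mov.anticomm`.

If the same strand is changed twice, the path is a barbell `α_i` for `i ∉ X` and a broken strand for
`i ∈ X`. In the words used here `i + 1` stands left of `i`, so on its way to the right the box `α_i`
meets only one strand that it does not commute with, namely `i - 1`. Polynomial forcing there yields
`α_i` further right, a box `α_{i-1}` just after the strand `i - 1`, and minus the broken strand `i -
1`. The box `α_{i-1}` can in turn be pushed to the right. Over all of `ℤ/n` these formulas
telescope, the broken strands cancel, and what remains is `∑ α_i = δ` at the right
(`sum_pushed_add_brokenAt`).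

Filtration. Moving `ω` to the front, `y_{t+1}` is `ω` times a word in which each index except `t`
occurs once: inverse letters for `i < t`, positive ones for `i > t`. Its Rouquier complex is
therefore already perverse. It is a cube (`IsCube`) on the subsets `X` that omit `t`. An absent
strand contributes `-1` to the homological degree if it is below `t` and `+1` if it is above. For
fixed `X`, as `t` runs through the absent strands in the order `0 < ⋯ < n - 1`, the degree falls
from `n - 1 - |X|` to `-(n - 1 - |X|)` in steps of two, and these are exactly the `p` with `X ∈ P_p`
(`mem_chainSet_wakimotoDegree`, `exists_wakimotoDegree_eq`). So pairs `(p, X)` correspond to pairs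
`(t, X)` with `t ∉ X`.

Under this bijection the dots of `F` that keep `t` are those of the cube (`wakimotoDegree_toggle`,
`IsCube.d_eq`), up to signs which rescale the summands. Changing one strand moves the degree at a
given `t` by at most one, while increasing `t` lowers it by at least two; so no dot raises `t`
(`le_of_wakimotoDegree_toggle`). This is the triangularity of the convolution. The statements on
weights are linear algebra of coordinate lines. -/

theorem comp_assoc (f : EHom ρ a b) (g : EHom ρ b c) (h : EHom ρ c d) :
    f ⊚ g ⊚ h = f ⊚ (g ⊚ h) := by
  obtain ⟨f⟩ := f; obtain ⟨g⟩ := g; obtain ⟨h⟩ := h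
  exact Quotient.sound (HeckeRel.assoc f g h)

@[simp] theorem id_comp (f : EHom ρ a b) : id ρ a ⊚ f = f := by
  obtain ⟨f⟩ := f
  exact Quotient.sound (HeckeRel.id_comp f)

@[simp] theorem comp_id (f : EHom ρ a b) : f ⊚ id ρ b = f := by
  obtain ⟨f⟩ := f
  exact Quotient.sound (HeckeRel.comp_id f)

theorem comp_add (f : EHom ρ a b) (g h : EHom ρ b c) : f ⊚ (g + h) = f ⊚ g + f ⊚ h := by
  obtain ⟨f⟩ := f; obtain ⟨g⟩ := g; obtain ⟨h⟩ := h
  exact Quotient.sound (HeckeRel.comp_add f g h)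

theorem add_comp (f g : EHom ρ a b) (h : EHom ρ b c) : (f + g) ⊚ h = f ⊚ h + g ⊚ h := by
  obtain ⟨f⟩ := f; obtain ⟨g⟩ := g; obtain ⟨h⟩ := h
  exact Quotient.sound (HeckeRel.add_comp f g h)

@[simp] theorem comp_smul (t : k) (f : EHom ρ a b) (g : EHom ρ b c) : f ⊚ (t • g) = t • (f ⊚ g) := by
  obtain ⟨f⟩ := f; obtain ⟨g⟩ := g
  exact Quotient.sound (HeckeRel.comp_smul t f g)

@[simp] theorem smul_comp (t : k) (f : EHom ρ a b) (g : EHom ρ b c) : (t • f) ⊚ g = t • (f ⊚ g) := by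
  obtain ⟨f⟩ := f; obtain ⟨g⟩ := g
  exact Quotient.sound (HeckeRel.smul_comp t f g)

@[simp] theorem comp_zero (f : EHom ρ a b) : f ⊚ (0 : EHom ρ b c) = 0 := by
  rw [← zero_smul k (0 : EHom ρ b c), comp_smul, zero_smul]

@[simp] theorem zero_comp (f : EHom ρ b c) : (0 : EHom ρ a b) ⊚ f = 0 := by
  rw [← zero_smul k (0 : EHom ρ a b), smul_comp, zero_smul]

@[simp] theorem comp_neg (f : EHom ρ a b) (g : EHom ρ b c) : f ⊚ (-g) = -(f ⊚ g) := comp_smul _ f g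

@[simp] theorem neg_comp (f : EHom ρ a b) (g : EHom ρ b c) : (-f) ⊚ g = -(f ⊚ g) := smul_comp _ f g

theorem comp_sub (f : EHom ρ a b) (g h : EHom ρ b c) : f ⊚ (g - h) = f ⊚ g - f ⊚ h := by
  rw [sub_eq_add_neg, comp_add, comp_neg, sub_eq_add_neg]

theorem sub_comp (f g : EHom ρ a b) (h : EHom ρ b c) : (f - g) ⊚ h = f ⊚ h - g ⊚ h := by
  rw [sub_eq_add_neg, add_comp, neg_comp, sub_eq_add_neg]

variable (x : Letter n)

@[simp] theorem cons_id (a : List (Letter n)) : cons x (id ρ a) = id ρ (x :: a) :=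
  Quotient.sound (HeckeRel.cons_id x a)

theorem cons_comp (f : EHom ρ a b) (g : EHom ρ b c) : cons x (f ⊚ g) = cons x f ⊚ cons x g := by
  obtain ⟨f⟩ := f; obtain ⟨g⟩ := g
  exact Quotient.sound (HeckeRel.cons_comp x f g)

theorem cons_add (f g : EHom ρ a b) : cons x (f + g) = cons x f + cons x g := by
  obtain ⟨f⟩ := f; obtain ⟨g⟩ := g
  exact Quotient.sound (HeckeRel.cons_add x f g)

@[simp] theorem cons_smul (t : k) (f : EHom ρ a b) : cons x (t • f) = t • cons x f := by
  obtain ⟨f⟩ := f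
  exact Quotient.sound (HeckeRel.cons_smul x t f)

@[simp] theorem cons_zero : cons x (0 : EHom ρ a b) = 0 := by
  rw [← zero_smul k (0 : EHom ρ a b), cons_smul, zero_smul]

@[simp] theorem cons_neg (f : EHom ρ a b) : cons x (-f) = -cons x f := cons_smul x _ f

theorem cons_sub (f g : EHom ρ a b) : cons x (f - g) = cons x f - cons x g := by
  rw [sub_eq_add_neg, cons_add, cons_neg, sub_eq_add_neg]

theorem cons_sum {ι : Type*} (s : Finset ι) (f : ι → EHom ρ a b) :
    cons x (∑ i ∈ s, f i) = ∑ i ∈ s, cons x (f i) :=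
  map_sum (⟨⟨fun g => cons x g, cons_zero x⟩, cons_add x⟩ :
    EHom ρ a b →+ EHom ρ (x :: a) (x :: b)) f s

@[simp] theorem cast_rfl (h : a = a) : cast ρ h = id ρ a := rfl

/-! ### Naturality and local relations -/

theorem startdot_comp_cons (i : ZMod n) (f : EHom ρ a b) :
    startdot ρ i a ⊚ cons (Letter.col i) f = f ⊚ startdot ρ i b := by
  obtain ⟨f⟩ := f
  exact Quotient.sound (HeckeRel.interchange (.startdot i) f)

theorem enddot_comp (i : ZMod n) (f : EHom ρ a b) :
    enddot ρ i a ⊚ f = cons (Letter.col i) f ⊚ enddot ρ i b := by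
  obtain ⟨f⟩ := f
  exact Quotient.sound (HeckeRel.interchange (.enddot i) f)

theorem four_comp_cons {i j : ZMod n} (h : Far i j) (f : EHom ρ a b) :
    four ρ h a ⊚ cons (Letter.col j) (cons (Letter.col i) f) =
      cons (Letter.col i) (cons (Letter.col j) f) ⊚ four ρ h b := by
  obtain ⟨f⟩ := f
  exact Quotient.sound (HeckeRel.interchange (.four i j h) f)

/-- The box labelled by `x` placed at the left of a word. -/
def box (ρ : AffineRealization k n H) (x : H) (r : List (Letter n)) : EHom ρ r r :=
  mk ρ (Diag.box k x r)

theorem box_comp (y : H) (f : EHom ρ a b) : box ρ y a ⊚ f = f ⊚ box ρ y b := by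
  obtain ⟨f⟩ := f
  exact Quotient.sound (HeckeRel.interchange (.box y) f)

theorem box_add (y z : H) : box ρ (y + z) a = box ρ y a + box ρ z a :=
  Quotient.sound (HeckeRel.box_add y z a)

theorem barbell (i : ZMod n) : startdot ρ i a ⊚ enddot ρ i a = box ρ (ρ.root i) a :=
  Quotient.sound (HeckeRel.barbell i a)

theorem forcing (i : ZMod n) (y : H) :
    box ρ y (Letter.col i :: a) = cons (Letter.col i) (box ρ (ρ.refl i y) a) +
      ρ.coroot i y • (enddot ρ i a ⊚ startdot ρ i a) :=
  Quotient.sound (HeckeRel.forcing i y a)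

theorem four_four {i j : ZMod n} (h : Far i j) (h' : Far j i) :
    four ρ h a ⊚ four ρ h' a = id ρ (Letter.col i :: Letter.col j :: a) :=
  Quotient.sound (HeckeRel.four_four h h' a)

theorem startdot_four {i j : ZMod n} (h : Far i j) :
    startdot ρ i (Letter.col j :: a) ⊚ four ρ h a = cons (Letter.col j) (startdot ρ i a) :=
  Quotient.sound (HeckeRel.four_startdot h a)

theorem four_enddot {i j : ZMod n} (h : Far i j) :
    four ρ h a ⊚ cons (Letter.col j) (enddot ρ i a) = enddot ρ i (Letter.col j :: a) :=
  Quotient.sound (HeckeRel.four_enddot h a)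

theorem cons_startdot_four {i j : ZMod n} (h : Far i j) (h' : Far j i) :
    cons (Letter.col j) (startdot ρ i a) ⊚ four ρ h' a = startdot ρ i (Letter.col j :: a) := by
  rw [← startdot_four h, comp_assoc, four_four, comp_id]

theorem four_enddot_left {i j : ZMod n} (h : Far i j) (h' : Far j i) :
    four ρ h' a ⊚ enddot ρ i (Letter.col j :: a) = cons (Letter.col j) (enddot ρ i a) := by
  rw [← four_enddot h, ← comp_assoc, four_four, id_comp]

theorem four_braid {i j l : ZMod n} (hij : Far i j) (hil : Far i l) (hjl : Far j l) :
    four ρ hij (Letter.col l :: a) ⊚ cons (Letter.col j) (four ρ hil a) ⊚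
        four ρ hjl (Letter.col i :: a) =
      cons (Letter.col i) (four ρ hjl a) ⊚ four ρ hil (Letter.col j :: a) ⊚
        cons (Letter.col l) (four ρ hij a) :=
  Quotient.sound (HeckeRel.zam_AAA hij hil hjl a)

/-- The box labelled by `x` placed at the right of a word, as an additive function of `x`. -/
theorem rightBox_add (y z : H) (w : List (Letter n)) :
    rightBox ρ (y + z) w = rightBox ρ y w + rightBox ρ z w := by
  induction w with
  | nil => exact box_add y z
  | cons x w ih => simp only [rightBox, ih, cons_add]

def rightBoxHom (ρ : AffineRealization k n H) (w : List (Letter n)) : H →+ EHom ρ w w :=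
  AddMonoidHom.mk' (fun y => rightBox ρ y w) fun y z => rightBox_add y z w

theorem rightBox_zero (w : List (Letter n)) : rightBox ρ 0 w = 0 := (rightBoxHom ρ w).map_zero

theorem rightBox_sum {ι : Type*} (s : Finset ι) (f : ι → H) (w : List (Letter n)) :
    rightBox ρ (∑ i ∈ s, f i) w = ∑ i ∈ s, rightBox ρ (f i) w := map_sum (rightBoxHom ρ w) f s

end EHom

theorem Far.symm {n : ℕ} {i j : ZMod n} (h : Far i j) : Far j i := ⟨h.1.symm, h.2.2, h.2.1⟩

/-! ### Signed rex moves and their coherence -/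

section
open EHom Letter

variable {k : Type u} [CommRing k] {n : ℕ} {H : Type v} [AddCommGroup H] [Module k H]
variable (ρ : AffineRealization k n H)

/-- A single signed 4-valent vertex inside a word. -/
inductive Swap : ∀ {a b : List (Letter n)}, EHom ρ a b → Prop
  | head {i j : ZMod n} (h : Far i j) (r : List (Letter n)) : Swap (-four ρ h r)
  | cons (y : ZMod n) {a b : List (Letter n)} {s : EHom ρ a b} :
      Swap s → Swap (EHom.cons (col y) s)

/-- The signed rex moves: compositions of signed 4-valent vertices. -/
inductive Rex : ∀ {a b : List (Letter n)}, EHom ρ a b → Prop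
  | refl (a : List (Letter n)) : Rex (EHom.id ρ a)
  | head {a b c : List (Letter n)} {s : EHom ρ a b} {f : EHom ρ b c} :
      Swap ρ s → Rex f → Rex (s ⊚ f)

/-- `PullsFront x p`: the rex move `p` brings a strand `x` to the front. -/
inductive PullsFront (x : ZMod n) : ∀ {a b : List (Letter n)}, EHom ρ a (col x :: b) → Prop
  | refl (a : List (Letter n)) : PullsFront x (EHom.id ρ (col x :: a))
  | step {y : ZMod n} (h : Far y x) {a b : List (Letter n)} {p : EHom ρ a (col x :: b)} :
      PullsFront x p → PullsFront x (EHom.cons (col y) p ⊚ (-four ρ h b))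

/-- The normal form of a signed rex move: the strands are brought to their places one by one, from
left to right. -/
inductive NormalRex : ∀ {a b : List (Letter n)}, EHom ρ a b → Prop
  | nil : NormalRex (EHom.id ρ [])
  | step {x : ZMod n} {a b c : List (Letter n)} {p : EHom ρ a (col x :: b)} {f : EHom ρ b c} :
      PullsFront ρ x p → NormalRex f → NormalRex (p ⊚ EHom.cons (col x) f)

end
-- Inverses and normal forms of signed rex moves
section
open EHom Letter

variable {k : Type u} [CommRing k] {n : ℕ} {H : Type v} [AddCommGroup H] [Module k H]
variable {ρ : AffineRealization k n H} {a b c : List (Letter n)}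

theorem Swap.symm {s : EHom ρ a b} (hs : Swap ρ s) :
    ∃ t : EHom ρ b a, Swap ρ t ∧ s ⊚ t = EHom.id ρ a ∧ t ⊚ s = EHom.id ρ b := by
  induction hs with
  | head h r => exact ⟨_, Swap.head h.symm r, by simp [four_four], by simp [four_four]⟩
  | cons y _ ih =>
    obtain ⟨t, ht, h1, h2⟩ := ih
    exact ⟨_, ht.cons y, by rw [← cons_comp, h1, cons_id], by rw [← cons_comp, h2, cons_id]⟩

theorem Rex.trans {f : EHom ρ a b} {g : EHom ρ b c} (hf : Rex ρ f) (hg : Rex ρ g) :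
    Rex ρ (f ⊚ g) := by
  induction hf with
  | refl => simpa using hg
  | head hs _ ih => rw [comp_assoc]; exact .head hs (ih hg)

theorem Swap.rex {s : EHom ρ a b} (hs : Swap ρ s) : Rex ρ s := by
  simpa using Rex.head hs (.refl b)

theorem Rex.cons (y : ZMod n) {f : EHom ρ a b} (hf : Rex ρ f) : Rex ρ (EHom.cons (col y) f) := by
  induction hf with
  | refl => simpa using Rex.refl _
  | head hs _ ih => rw [cons_comp]; exact .head (hs.cons y) ih

theorem Rex.symm {f : EHom ρ a b} (hf : Rex ρ f) :
    ∃ g : EHom ρ b a, Rex ρ g ∧ f ⊚ g = EHom.id ρ a ∧ g ⊚ f = EHom.id ρ b := by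
  induction hf with
  | refl a => exact ⟨_, .refl a, by simp, by simp⟩
  | @head a b c s f hs hf ih =>
    obtain ⟨g, hg, h1, h2⟩ := ih
    obtain ⟨t, ht, h3, h4⟩ := hs.symm
    refine ⟨g ⊚ t, hg.trans ht.rex, ?_, ?_⟩
    · rw [comp_assoc, ← comp_assoc f, h1, id_comp, h3]
    · rw [comp_assoc, ← comp_assoc t, h4, id_comp, h2]

theorem Swap.hasDegree {s : EHom ρ a b} (hs : Swap ρ s) : s.HasDegree 0 := by
  induction hs with
  | head h r => exact (HasDegree.four h r).neg
  | cons y _ ih => exact ih.cons _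

theorem Rex.hasDegree {s : EHom ρ a b} (hs : Rex ρ s) : s.HasDegree 0 := by
  induction hs with
  | refl a => exact HasDegree.cast rfl
  | head hs _ ih => exact hs.hasDegree.comp ih (zero_add 0)

theorem Swap.perm {s : EHom ρ a b} (hs : Swap ρ s) : a.Perm b := by
  induction hs with
  | head h r => exact List.Perm.swap ..
  | cons y _ ih => exact ih.cons _

theorem Rex.perm {s : EHom ρ a b} (hs : Rex ρ s) : a.Perm b := by
  induction hs with
  | refl a => exact .refl a
  | head hs _ ih => exact hs.perm.trans ih

theorem PullsFront.rex {x : ZMod n} {p : EHom ρ a (col x :: b)} (hp : PullsFront ρ x p) :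
    Rex ρ p := by
  induction hp with
  | refl => exact .refl _
  | step h _ ih => exact (ih.cons _).trans (Swap.head h _).rex

/-- A strand passed by `x` has a colour far from `x`, in particular different from it; so the strand
that is moved is the first `x` of the word and its route is forced. The remaining word is part of
the conclusion, hence the sigma type. -/
theorem PullsFront.unique {x : ZMod n} {b' : List (Letter n)} {p : EHom ρ a (col x :: b)}
    {p' : EHom ρ a (col x :: b')} (hp : PullsFront ρ x p) (hp' : PullsFront ρ x p') :
    (⟨b, p⟩ : Σ b, EHom ρ a (col x :: b)) = ⟨b', p'⟩ := by
  induction hp generalizing b' with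
  | refl a =>
    cases hp' with
    | refl => rfl
    | step h _ => exact absurd rfl h.1
  | step h _ ih =>
    cases hp' with
    | refl => exact absurd rfl h.1
    | step h' hp' => cases ih hp'; rfl

theorem NormalRex.unique {f g : EHom ρ a b} (hf : NormalRex ρ f) (hg : NormalRex ρ g) :
    f = g := by
  induction hf with
  | nil => cases hg; rfl
  | step hp _ ih =>
    cases hg with
    | step hp' hf' => cases hp.unique hp'; rw [ih hf']

theorem normalRex_id (l : List (ZMod n)) : NormalRex ρ (EHom.id ρ (bsWord l)) := by
  induction l with
  | nil => exact .nil
  | cons x l ih =>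
    have h := NormalRex.step (.refl (x := x) (bsWord l)) ih
    rw [cons_id, id_comp] at h
    exact h

/-- A 4-valent vertex below a strand pulled to the front disappears or moves above it. -/
theorem Swap.pullsFront {x : ZMod n} {s : EHom ρ a b} {p : EHom ρ b (col x :: c)}
    (hs : Swap ρ s) (hp : PullsFront ρ x p) :
    PullsFront ρ x (s ⊚ p) ∨ ∃ (d : List (Letter n)) (q : EHom ρ a (col x :: d)) (t : EHom ρ d c),
      PullsFront ρ x q ∧ Swap ρ t ∧ s ⊚ p = q ⊚ EHom.cons (col x) t := by
  induction hs generalizing c with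
  | @head i j h r =>
    cases hp with
    | refl => 
      left
      have := PullsFront.step (ρ := ρ) h (.refl r)
      simpa using this
    | step h1 hp =>
      cases hp with
      | refl =>
        -- The strand pulled to the front is `i`, and the vertex undoes its last crossing.
        left
        simpa [four_four] using PullsFront.refl (ρ := ρ) (x := x) (col j :: r)
      | @step _ h2 _ d p hp =>
        right
        refine ⟨_, _, _, .step h2 (.step h1 hp), .head h d, ?_⟩
        -- The strand `x` crosses both strands of the vertex, so the relation for three commuting
        -- colours carries the vertex past `x`. Both sides have three vertices, hence equal signs.
        have e := four_braid (ρ := ρ) (a := d) h h2 h1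
        simp only [comp_neg, neg_comp, neg_neg, cons_neg, cons_comp]
        rw [← comp_assoc, ← comp_assoc, four_comp_cons, comp_assoc, comp_assoc, ← comp_assoc (four ρ h _), e]
        simp only [comp_assoc]
  | @cons y a b s hs ih =>
    cases hp with
    | refl => exact .inr ⟨_, _, _, .refl _, hs, by simp⟩
    | @step _ h _ d p hp =>
      rw [← comp_assoc, ← cons_comp]
      rcases ih hp with h1 | ⟨d', q, t, hq, ht, e⟩
      · exact .inl (.step h h1)
      · refine .inr ⟨_, _, _, .step h hq, ht.cons y, ?_⟩
        rw [e, cons_comp]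
        simp only [comp_assoc, comp_neg, neg_comp, four_comp_cons]

/-- A vertex placed below a normal form is either absorbed by the first pull or passes to the rest
of the normal form, which is shorter. Since this never fails, normal forms are closed under adding
vertices. -/
theorem NormalRex.swap_comp {f : EHom ρ b c} (hf : NormalRex ρ f) {s : EHom ρ a b}
    (hs : Swap ρ s) : NormalRex ρ (s ⊚ f) := by
  induction hf generalizing a with
  | nil => cases hs
  | step hp hf ih =>
    rw [← comp_assoc]
    rcases hs.pullsFront hp with h | ⟨d, q, t, hq, ht, e⟩
    · exact .step h hf
    · rw [e, comp_assoc, ← cons_comp]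
      exact .step hq (ih ht)

theorem exists_bsWord_of_perm {l : List (ZMod n)} (h : (bsWord l).Perm b) :
    ∃ l', b = bsWord l' := by
  have hb : b ∈ Set.range (List.map (col (n := n))) := by
    rw [Set.range_list_map]
    intro x hx
    obtain ⟨i, -, rfl⟩ := List.mem_map.1 (h.mem_iff.2 hx)
    exact ⟨i, rfl⟩
  obtain ⟨l', rfl⟩ := hb
  exact ⟨l', rfl⟩

/-- Normal forms are built from the empty word by coloured strands only, so words with black strands
have to be excluded. -/
theorem Rex.normalRex {f : EHom ρ a b} (hf : Rex ρ f) (ha : ∃ l, a = bsWord l) :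
    NormalRex ρ f := by
  induction hf with
  | refl => obtain ⟨l, rfl⟩ := ha; exact normalRex_id l
  | @head a b _ s _ hs _ ih =>
    exact (ih (ha.elim fun l hl => exists_bsWord_of_perm (hl ▸ hs.perm))).swap_comp hs

/-- Coherence of signed rex moves. -/
theorem Rex.unique {l : List (ZMod n)} {f g : EHom ρ (bsWord l) b} (hf : Rex ρ f)
    (hg : Rex ρ g) : f = g :=
  (hf.normalRex ⟨l, rfl⟩).unique (hg.normalRex ⟨l, rfl⟩)

end

/-! ### Signed dots -/

section
open EHom Letter

variable {k : Type u} [CommRing k] {n : ℕ} {H : Type v} [AddCommGroup H] [Module k H]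
variable (ρ : AffineRealization k n H)

/-- `Dot true i f`: `f` is the startdot on a new strand `i`; `Dot false i f`: `f` is the enddot on a
strand `i`; in both cases with a sign `-1` for each strand on the left. -/
inductive Dot : Bool → ZMod n → ∀ {a b : List (Letter n)}, EHom ρ a b → Prop
  | start (i : ZMod n) (r : List (Letter n)) : Dot true i (startdot ρ i r)
  | finish (i : ZMod n) (r : List (Letter n)) : Dot false i (enddot ρ i r)
  | step (y : ZMod n) {β : Bool} {i : ZMod n} {a b : List (Letter n)} {f : EHom ρ a b} :
      Dot β i f → Dot β i (-EHom.cons (col y) f)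

/-- A signed dot combined with signed rex moves at its smaller end. -/
def Mov (β : Bool) (i : ZMod n) {a b : List (Letter n)} (f : EHom ρ a b) : Prop :=
  match β with
  | true => ∃ (v : List (Letter n)) (g : EHom ρ a v) (h : EHom ρ v b),
      Rex ρ g ∧ Dot ρ true i h ∧ f = g ⊚ h
  | false => ∃ (v : List (Letter n)) (h : EHom ρ a v) (g : EHom ρ v b),
      Dot ρ false i h ∧ Rex ρ g ∧ f = h ⊚ g

end
-- Uniqueness and anticommutation of signed dots
section
open EHom Letter

variable {k : Type u} [CommRing k] {n : ℕ} {H : Type v} [AddCommGroup H] [Module k H]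
variable {ρ : AffineRealization k n H} {a b c : List (Letter n)} {i j : ZMod n}

theorem Dot.mov {β : Bool} {f : EHom ρ a b} (hf : Dot ρ β i f) : Mov ρ β i f := by
  cases β
  · exact ⟨_, _, _, hf, .refl _, by simp⟩
  · exact ⟨_, _, _, .refl _, hf, by simp⟩

theorem Dot.perm {β : Bool} {f : EHom ρ a b} (hf : Dot ρ β i f) :
    if β then b.Perm (col i :: a) else a.Perm (col i :: b) := by
  induction hf with
  | start => exact .refl _
  | finish => exact .refl _
  | @step y β i a b f _ ih =>
    cases β
    · exact (ih.cons _).trans (.swap ..)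
    · exact (ih.cons _).trans (.swap ..)

theorem Dot.sublist {β : Bool} {f : EHom ρ a b} (hf : Dot ρ β i f) :
    if β then a.Sublist b else b.Sublist a := by
  induction hf with
  | start => exact List.sublist_cons_self ..
  | finish => exact List.sublist_cons_self ..
  | @step y β i a b f _ ih =>
    cases β
    · exact List.Sublist.cons_cons _ ih
    · exact List.Sublist.cons_cons _ ih

theorem Mov.perm {β : Bool} {f : EHom ρ a b} (hf : Mov ρ β i f) :
    if β then b.Perm (col i :: a) else a.Perm (col i :: b) := by
  cases β
  · obtain ⟨v, h, g, hh, hg, -⟩ := hf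
    exact hh.perm.trans (hg.perm.cons _)
  · obtain ⟨v, h, g, hh, hg, -⟩ := hf
    exact hg.perm.trans (hh.perm.symm.cons _)

/-- The larger word fixes the dot only if the strand `i` occurs in it once; this is what the absence
of `i` from the smaller words provides. -/
theorem Dot.unique_start {a' : List (Letter n)} {f : EHom ρ a b} {f' : EHom ρ a' b}
    (hf : Dot ρ true i f) (hf' : Dot ρ true i f') (ha : col i ∉ a) (ha' : col i ∉ a') :
    (⟨a, f⟩ : Σ a, EHom ρ a b) = ⟨a', f'⟩ := by
  generalize hβ : true = β at hf
  induction hf generalizing a' with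
  | start =>
    cases hf' with
    | start => rfl
    | step => simp at ha'
  | finish => simp at hβ
  | step y _ ih =>
    cases hf' with
    | start => simp at ha
    | step _ hf' =>
      cases ih hf' (by simp_all) (by simp_all) hβ
      rfl

theorem Dot.unique_finish {b' : List (Letter n)} {f : EHom ρ a b} {f' : EHom ρ a b'}
    (hf : Dot ρ false i f) (hf' : Dot ρ false i f') (hb : col i ∉ b) (hb' : col i ∉ b') :
    (⟨b, f⟩ : Σ b, EHom ρ a b) = ⟨b', f'⟩ := by
  generalize hβ : false = β at hf
  induction hf generalizing b' with
  | finish =>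
    cases hf' with
    | finish => rfl
    | step => simp at hb'
  | start => simp at hβ
  | step y _ ih =>
    cases hf' with
    | finish => simp at hb
    | step _ hf' =>
      cases ih hf' (by simp_all) (by simp_all) hβ
      rfl

/-- A signed 4-valent vertex above a startdot can be pulled below it. -/
theorem Dot.start_swap {f : EHom ρ a b} {s : EHom ρ b c} (hf : Dot ρ true i f) (hs : Swap ρ s) :
    ∃ (d : List (Letter n)) (g : EHom ρ a d) (h : EHom ρ d c),
      Rex ρ g ∧ Dot ρ true i h ∧ f ⊚ s = g ⊚ h := by
  induction hs generalizing a with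
  | @head x y h r =>
    cases hf with
    | start =>
      refine ⟨_, _, _, .refl _, .step y (.start i r), ?_⟩
      rw [← startdot_four h, comp_neg, id_comp]
    | step _ hf =>
      cases hf with
      | start =>
        refine ⟨_, _, _, .refl _, .start i _, ?_⟩
        rw [comp_neg, neg_comp, neg_neg, cons_startdot_four h.symm, id_comp]
      | @step _ _ _ a _ f hf =>
        refine ⟨_, _, _, (Swap.head h a).rex, .step _ (.step _ hf), ?_⟩
        simp only [comp_neg, neg_comp, neg_neg, cons_neg, four_comp_cons]
  | @cons y _ _ s hs ih =>
    cases hf with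
    | start => exact ⟨_, _, _, hs.rex, .start i _, startdot_comp_cons i s⟩
    | step _ hf =>
      obtain ⟨d, g, h, hg, hh, e⟩ := ih hf
      refine ⟨_, _, _, hg.cons y, .step y hh, ?_⟩
      rw [neg_comp, ← cons_comp, e, cons_comp, comp_neg]

theorem Dot.start_rex {f : EHom ρ a b} {s : EHom ρ b c} (hf : Dot ρ true i f) (hs : Rex ρ s) :
    Mov ρ true i (f ⊚ s) := by
  induction hs generalizing a with
  | refl => simpa using hf.mov
  | @head b d c s t hs _ ih =>
    obtain ⟨d, g, h, hg, hh, e⟩ := hf.start_swap hs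
    obtain ⟨d', g', h', hg', hh', e'⟩ := ih hh
    exact ⟨_, _, _, hg.trans hg', hh', by rw [← comp_assoc, e, comp_assoc, e', comp_assoc]⟩

/-- A signed 4-valent vertex below an enddot can be pulled above it. -/
theorem Dot.swap_finish {s : EHom ρ a b} {f : EHom ρ b c} (hs : Swap ρ s) (hf : Dot ρ false i f) :
    ∃ (d : List (Letter n)) (h : EHom ρ a d) (g : EHom ρ d c),
      Dot ρ false i h ∧ Rex ρ g ∧ s ⊚ f = h ⊚ g := by
  induction hs generalizing c with
  | @head x y h r =>
    cases hf with
    | finish =>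
      refine ⟨_, _, _, .step x (.finish i r), .refl _, ?_⟩
      rw [← four_enddot_left h.symm h, neg_comp, comp_id]
    | step _ hf =>
      cases hf with
      | finish =>
        refine ⟨_, _, _, .finish i _, .refl _, ?_⟩
        rw [comp_neg, neg_comp, neg_neg, four_enddot h, comp_id]
      | @step _ _ _ _ c f hf =>
        refine ⟨_, _, _, .step _ (.step _ hf), (Swap.head h c).rex, ?_⟩
        simp only [comp_neg, neg_comp, neg_neg, cons_neg, four_comp_cons]
  | @cons y _ _ s hs ih =>
    cases hf with
    | finish => exact ⟨_, _, _, .finish i _, hs.rex, (enddot_comp i s).symm⟩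
    | step _ hf =>
      obtain ⟨d, g, h, hg, hh, e⟩ := ih hf
      refine ⟨_, _, _, .step y hg, hh.cons y, ?_⟩
      rw [comp_neg, ← cons_comp, e, cons_comp, neg_comp]

theorem Dot.rex_finish {s : EHom ρ a b} {f : EHom ρ b c} (hs : Rex ρ s) (hf : Dot ρ false i f) :
    Mov ρ false i (s ⊚ f) := by
  induction hs with
  | refl => simpa using hf.mov
  | @head a b _ s t hs _ ih =>
    obtain ⟨d, h, g, hh, hg, e⟩ := ih hf
    obtain ⟨d', h', g', hh', hg', e'⟩ := hh.swap_finish hs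
    exact ⟨_, _, _, hh', hg'.trans hg, by rw [comp_assoc, e, ← comp_assoc, e', comp_assoc]⟩

/-- With `Mov.comp_rex` this makes `Mov` independent of the chosen expressions. Rex moves at the
smaller end are allowed by definition; those at the larger end are slid through the dot. -/
theorem Mov.rex_comp {β : Bool} {s : EHom ρ a b} {f : EHom ρ b c} (hs : Rex ρ s)
    (hf : Mov ρ β i f) : Mov ρ β i (s ⊚ f) := by
  cases β
  · obtain ⟨v, h, g, hh, hg, rfl⟩ := hf
    obtain ⟨d, h', g', hh', hg', e⟩ := hh.rex_finish hs
    exact ⟨_, _, _, hh', hg'.trans hg, by rw [← comp_assoc, e, comp_assoc]⟩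
  · obtain ⟨v, g, h, hg, hh, rfl⟩ := hf
    exact ⟨_, _, _, hs.trans hg, hh, by rw [comp_assoc]⟩

theorem Mov.comp_rex {β : Bool} {f : EHom ρ a b} {s : EHom ρ b c} (hf : Mov ρ β i f)
    (hs : Rex ρ s) : Mov ρ β i (f ⊚ s) := by
  cases β
  · obtain ⟨v, h, g, hh, hg, rfl⟩ := hf
    exact ⟨_, _, _, hh, hg.trans hs, by rw [comp_assoc]⟩
  · obtain ⟨v, g, h, hg, hh, rfl⟩ := hf
    obtain ⟨d, h', g', hh', hg', e⟩ := hh.start_rex hs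
    exact ⟨_, _, _, hg.trans hh', hg', by rw [comp_assoc, e, comp_assoc]⟩

/-- Signed dots, combined with signed rex moves, are determined by their source and target. -/
theorem Mov.unique {β : Bool} {l m : List (ZMod n)} (hl : l.Nodup) (hm : m.Nodup)
    {f f' : EHom ρ (bsWord l) (bsWord m)} (hf : Mov ρ β i f) (hf' : Mov ρ β i f') : f = f' := by
  have hinj : Function.Injective (col (n := n)) := fun _ _ h => by cases h; rfl
  have hl' : (bsWord l).Nodup := hl.map hinj
  have hm' : (bsWord m).Nodup := hm.map hinj
  cases β
  · obtain ⟨v, h, g, hh, hg, rfl⟩ := hf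
    obtain ⟨v', h', g', hh', hg', rfl⟩ := hf'
    have h1 := List.nodup_cons.1 (hh.perm.nodup_iff.1 hl')
    have h2 := List.nodup_cons.1 (hh'.perm.nodup_iff.1 hl')
    cases hh.unique_finish hh' h1.1 h2.1
    obtain ⟨m', rfl⟩ := exists_bsWord_of_perm hg.perm.symm
    rw [hg.unique hg']
  · obtain ⟨v, g, h, hg, hh, rfl⟩ := hf
    obtain ⟨v', g', h', hg', hh', rfl⟩ := hf'
    have h1 := List.nodup_cons.1 (hh.perm.nodup_iff.1 hm')
    have h2 := List.nodup_cons.1 (hh'.perm.nodup_iff.1 hm')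
    cases hh.unique_start hh' h1.1 h2.1
    rw [hg.unique hg']

/-- Signed dots on two different strands anticommute. -/
theorem Dot.anticomm {β γ : Bool} (hij : i ≠ j) {f : EHom ρ a b} {g : EHom ρ b c}
    (hf : Dot ρ β i f) (hg : Dot ρ γ j g) :
    ∃ (d : List (Letter n)) (g' : EHom ρ a d) (f' : EHom ρ d c),
      Dot ρ γ j g' ∧ Dot ρ β i f' ∧ f ⊚ g = -(g' ⊚ f') := by
  induction hf generalizing c with
  | start i r =>
    cases hg with
    | start =>
      refine ⟨_, _, _, .start j r, .step j (.start i r), ?_⟩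
      rw [comp_neg, neg_neg, startdot_comp_cons]
    | finish => exact absurd rfl hij
    | step _ hg =>
      refine ⟨_, _, _, hg, .start i _, ?_⟩
      rw [comp_neg, startdot_comp_cons]
  | finish i r =>
    refine ⟨_, _, _, .step i hg, .finish i _, ?_⟩
    rw [neg_comp, neg_neg, enddot_comp]
  | @step y β i a b f hf ih =>
    cases hg with
    | start =>
      refine ⟨_, _, _, .start j _, .step j (.step y hf), ?_⟩
      rw [comp_neg, neg_neg, startdot_comp_cons]
    | finish =>
      refine ⟨_, _, _, .finish _ _, hf, ?_⟩
      rw [enddot_comp, neg_comp]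
    | step _ hg =>
      obtain ⟨d, g', f', hg', hf', e⟩ := ih hij hg
      refine ⟨_, _, _, .step y hg', .step y hf', ?_⟩
      simp only [neg_comp, comp_neg, neg_neg, ← cons_comp, e, cons_neg]

end

/-! ### Words of Coxeter elements -/

section
open EHom Letter

/-- A word without repetitions in which `i + 1` occurs before `i` whenever both occur. -/
def IsDescending {n : ℕ} (l : List (ZMod n)) : Prop := l.Pairwise fun a b => a ≠ b ∧ b ≠ a + 1

variable {k : Type u} [CommRing k] {n : ℕ} {H : Type v} [AddCommGroup H] [Module k H]
variable {ρ : AffineRealization k n H} {i j : ZMod n}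

theorem IsDescending.nodup {l : List (ZMod n)} (hl : IsDescending l) : l.Nodup :=
  List.Pairwise.imp (fun h => h.1) hl

theorem IsDescending.sublist {l m : List (ZMod n)} (hl : IsDescending l) (h : m.Sublist l) :
    IsDescending m := List.Pairwise.sublist h hl

theorem IsDescending.erase {l : List (ZMod n)} (hl : IsDescending l) (i : ZMod n) :
    IsDescending (l.erase i) := hl.sublist List.erase_sublist

theorem isDescending_cyclicWord {c : ZMod n} (hn : 2 ≤ n) (X : Finset (ZMod n)) :
    IsDescending (cyclicWord c X) := by
  refine List.Pairwise.sublist List.filter_sublist (List.pairwise_map.2 ?_)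
  refine List.Pairwise.imp_of_mem ?_ List.pairwise_lt_range
  intro a b ha hb hab
  rw [List.mem_range] at ha hb
  have key : ∀ m : ℕ, 0 < m → m < n → (m : ZMod n) ≠ 0 := fun m h0 h1 h =>
    absurd (Nat.le_of_dvd h0 ((ZMod.natCast_eq_zero_iff m n).1 h)) (by omega)
  constructor
  · intro h
    -- The letters are `c - 1 - a` and `c - 1 - b` with `a < b < n - 1`, so both `b - a` and `b - a
    -- + 1` lie strictly between `0` and `n` and are nonzero modulo `n`.
    refine key (b - a) (by omega) (by omega) ?_
    rw [Nat.cast_sub hab.le]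
    linear_combination h
  · intro h
    refine key (b - a + 1) (by omega) (by omega) ?_
    rw [Nat.cast_add, Nat.cast_sub hab.le]
    push_cast
    linear_combination -h

theorem mem_cyclicWord [NeZero n] {c : ZMod n} {X : Finset (ZMod n)} (hc : c ∉ X) {x : ZMod n} :
    x ∈ cyclicWord c X ↔ x ∈ X := by
  simp only [cyclicWord, List.mem_filter, List.mem_map, List.mem_range, decide_eq_true_eq,
    and_iff_right_iff_imp]
  intro hx
  have hne : c - x ≠ 0 := fun h => hc (by rwa [sub_eq_zero.1 h])
  have h0 : (c - x).val ≠ 0 := fun h => hne ((ZMod.val_eq_zero _).1 h)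
  have h1 := ZMod.val_lt (c - x)
  -- The letter `x` is `c - 1 - s` for `s = (c - x) - 1`, a natural number because `x ≠ c`.
  refine ⟨(c - x).val - 1, by omega, ?_⟩
  rw [Nat.cast_sub (by omega), ZMod.natCast_zmod_val]
  push_cast
  ring

theorem PullsFront.comp_cast {x : ZMod n} {a b c : List (Letter n)} {p : EHom ρ a (col x :: b)}
    (hp : PullsFront ρ x p) (h : b = c) :
    PullsFront ρ x (p ⊚ EHom.cast ρ (congrArg (List.cons (col x)) h)) := by
  subst h
  simpa using hp

/-- This rules out the junk value. A letter `y` left of `x` satisfies `x ≠ y + 1` because the word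
is descending, and `y ≠ x + 1` by hypothesis, so the two are far apart. The hypothesis holds when
`x` is the first letter of another descending word with the same letters. -/
theorem pullsFront_pullFront {x : ZMod n} {l : List (ZMod n)} (hl : IsDescending l)
    (h : ∀ y ∈ l, y ≠ x → y ≠ x + 1) (hx : x ∈ l) : PullsFront ρ x (pullFront ρ x l) := by
  induction l with
  | nil => simp at hx
  | cons y l ih =>
    have hl' := List.pairwise_cons.1 hl
    unfold pullFront
    split_ifs with h1 hf
    · subst h1
      have := (PullsFront.refl (ρ := ρ) (x := y) (bsWord l)).comp_cast
        (show bsWord l = bsWord ((y :: l).erase y) by simp)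
      rw [id_comp] at this
      exact this
    · have hx' : x ∈ l := by simpa [Ne.symm h1] using hx
      exact (PullsFront.step hf (ih hl'.2 (fun z hz => h z (by simp [hz])) hx')).comp_cast
        (show bsWord (y :: l.erase x) = bsWord ((y :: l).erase x) by simp [h1])
    · have hx' : x ∈ l := by simpa [Ne.symm h1] using hx
      exact absurd ⟨h1, (hl'.1 x hx').2, h y (by simp) h1⟩ hf

/-- Two descending words with the same letters are connected by signed rex moves. -/
theorem rex_signedRex {l m : List (ZMod n)} (hl : IsDescending l) (hm : IsDescending m)
    (h : l.Perm m) : Rex ρ (signedRex ρ l m) := by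
  induction m generalizing l with
  | nil =>
    cases h.eq_nil
    unfold signedRex
    rw [dif_pos rfl]
    exact .refl _
  | cons x m ih =>
    have hm' := List.pairwise_cons.1 hm
    have hp : PullsFront ρ x (pullFront ρ x l) := by
      refine pullsFront_pullFront hl (fun y hy hyx => ?_) (h.mem_iff.2 (by simp))
      exact (hm'.1 y ((List.mem_cons.1 (h.mem_iff.1 hy)).resolve_left hyx)).2
    unfold signedRex
    refine hp.rex.trans ((ih (hl.erase x) hm'.2 ?_).cons x)
    simpa using h.erase x

theorem bsWord_perm_iff {l m : List (ZMod n)} : (bsWord l).Perm (bsWord m) ↔ l.Perm m :=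
  List.map_perm_map_iff fun _ _ h => by cases h; rfl

theorem exists_rex {l m : List (ZMod n)} (hl : IsDescending l) (hm : IsDescending m)
    (h : (bsWord l).Perm (bsWord m)) : ∃ f : EHom ρ (bsWord l) (bsWord m), Rex ρ f :=
  ⟨_, rex_signedRex hl hm (bsWord_perm_iff.1 h)⟩

theorem Dot.comp_cast {β : Bool} {a b c : List (Letter n)} {f : EHom ρ a b} (hf : Dot ρ β i f)
    (h : b = c) : Dot ρ β i (f ⊚ EHom.cast ρ h) := by
  subst h
  simpa using hf

theorem Dot.cast_comp {β : Bool} {a b c : List (Letter n)} {f : EHom ρ b c} (hf : Dot ρ β i f)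
    (h : a = b) : Dot ρ β i (EHom.cast ρ h ⊚ f) := by
  subst h
  simpa using hf

theorem dot_insertDot {l : List (ZMod n)} (hi : i ∈ l) : Dot ρ true i (insertDot ρ i l) := by
  induction l with
  | nil => simp at hi
  | cons y l ih =>
    unfold insertDot
    split_ifs with h
    · subst h
      exact (Dot.start y (bsWord l)).cast_comp _
    · exact (Dot.step y (ih (by simpa [Ne.symm h] using hi))).cast_comp
        (show bsWord ((y :: l).erase i) = bsWord (y :: l.erase i) by simp [h])

theorem dot_removeDot {l : List (ZMod n)} (hi : i ∈ l) : Dot ρ false i (removeDot ρ i l) := by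
  induction l with
  | nil => simp at hi
  | cons y l ih =>
    unfold removeDot
    split_ifs with h
    · subst h
      exact (Dot.finish y (bsWord l)).comp_cast _
    · exact (Dot.step y (ih (by simpa [Ne.symm h] using hi))).comp_cast
        (show bsWord (y :: l.erase i) = bsWord ((y :: l).erase i) by simp [h])

/-- If the intermediate words are descending, then signed dots combined with signed rex moves
anticommute, too. -/
theorem Mov.anticomm_of_exists {β γ : Bool} {l l' m : List (ZMod n)} {d : List (Letter n)}
    (hl' : IsDescending l') (hl : l.Nodup) (hm : m.Nodup)
    {f : EHom ρ (bsWord l) d} {g : EHom ρ d (bsWord m)} {f' : EHom ρ (bsWord l) (bsWord l')}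
    {g' : EHom ρ (bsWord l') (bsWord m)} {e : List (ZMod n)} (he : IsDescending e)
    (hd : d.Sublist (bsWord e))
    (hf : Mov ρ β i f) (hg : Mov ρ γ j g) (hf' : Mov ρ β i f') (hg' : Mov ρ γ j g') :
    f ⊚ g = f' ⊚ g' := by
  obtain ⟨d, hde, (rfl : _ = bsWord d)⟩ := List.sublist_map_iff.1 hd
  have hperm : (bsWord d).Perm (bsWord l') := by
    have h1 := hf.perm
    have h2 := hf'.perm
    cases β
    · exact (List.perm_cons _).1 (h1.symm.trans h2)
    · exact h1.trans h2.symm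
  obtain ⟨θ, hθ⟩ := exists_rex (ρ := ρ) (he.sublist hde) hl' hperm
  obtain ⟨θ', hθ', h1, h2⟩ := hθ.symm
  -- A rex move and its inverse are inserted in the middle; by uniqueness each factor then equals
  -- the given dot through `l'`.
  rw [← (hf.comp_rex hθ).unique hl hl'.nodup hf', ← (hg.rex_comp hθ').unique hl'.nodup hm hg',
    comp_assoc, ← comp_assoc θ, h1, id_comp]

/-- Rex moves are moved to the outside until two plain dots are adjacent, which anticommute. The new
intermediate word must be joined to `l₂` by rex moves, so it must be descending. This holds as it is
a subword of a descending word: of `l` for two enddots, of `m` for two startdots, of `l₁` for a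
startdot followed by an enddot. The fourth case, where `l₁` is the smallest word, is the third read
backwards. -/
theorem Mov.anticomm {β γ : Bool} (hij : i ≠ j) {l l₁ l₂ m : List (ZMod n)}
    (hl : IsDescending l) (hl₁ : IsDescending l₁) (hl₂ : IsDescending l₂) (hm : IsDescending m)
    {f : EHom ρ (bsWord l) (bsWord l₁)} {g : EHom ρ (bsWord l₁) (bsWord m)}
    {g' : EHom ρ (bsWord l) (bsWord l₂)} {f' : EHom ρ (bsWord l₂) (bsWord m)}
    (hf : Mov ρ β i f) (hg : Mov ρ γ j g) (hg' : Mov ρ γ j g') (hf' : Mov ρ β i f') :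
    f ⊚ g = -(g' ⊚ f') := by
  have mixed : ∀ {i j : ZMod n} (_ : i ≠ j) {l₁ l₂ : List (ZMod n)}
      (_ : IsDescending l₁) (_ : IsDescending l₂)
      {f : EHom ρ (bsWord l) (bsWord l₁)} {g : EHom ρ (bsWord l₁) (bsWord m)}
      {g' : EHom ρ (bsWord l) (bsWord l₂)} {f' : EHom ρ (bsWord l₂) (bsWord m)}
      (_ : Mov ρ true i f) (_ : Mov ρ false j g) (_ : Mov ρ false j g') (_ : Mov ρ true i f'),
      f ⊚ g = -(g' ⊚ f') := by
    intro i j hij l₁ l₂ hl₁ hl₂ f g g' f' hf hg hg' hf'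
    obtain ⟨v, r, p, hr, hp, rfl⟩ := hf
    obtain ⟨w, q, s, hq, hs, rfl⟩ := hg
    obtain ⟨d, q', p', hq', hp', e⟩ := hp.anticomm hij hq
    have hd : d.Sublist (bsWord l₁) := hq'.sublist.trans hp.sublist
    rw [← Mov.anticomm_of_exists hl₂ hl.nodup hm.nodup hl₁ hd (hq'.mov.rex_comp hr)
      (hp'.mov.comp_rex hs) hg' hf', comp_assoc, ← comp_assoc p, e]
    simp only [comp_assoc, comp_neg, neg_comp]
  cases β <;> cases γ
  · obtain ⟨v, p, r, hp, hr, rfl⟩ := hf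
    obtain ⟨w, q, s, hq, hs, e⟩ := hg.rex_comp hr
    obtain ⟨d, q', p', hq', hp', e'⟩ := hp.anticomm hij hq
    rw [← Mov.anticomm_of_exists hl₂ hl.nodup hm.nodup hl hq'.sublist hq'.mov
      (hp'.mov.comp_rex hs) hg' hf', comp_assoc, e, ← comp_assoc, e']
    simp only [comp_assoc, neg_comp]
  · rw [mixed hij.symm hl₂ hl₁ hg' hf' hf hg, neg_neg]
  · exact mixed hij hl₁ hl₂ hf hg hg' hf'
  · obtain ⟨w, s, q, hs, hq, rfl⟩ := hg
    obtain ⟨v, r, p, hr, hp, e⟩ := hf.comp_rex hs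
    obtain ⟨d, q', p', hq', hp', e'⟩ := hp.anticomm hij hq
    rw [← Mov.anticomm_of_exists hl₂ hl.nodup hm.nodup hm hp'.sublist
      (hq'.mov.rex_comp hr) hp'.mov hg' hf', ← comp_assoc, e, comp_assoc, e']
    simp only [comp_assoc, comp_neg]

end

/-! ### Polynomials pushed through a word -/

section
open EHom Letter

variable {k : Type u} [CommRing k] {n : ℕ} {H : Type v} [AddCommGroup H] [Module k H]

theorem Far.ne_two {i j : ZMod n} (h : Far i j) : n ≠ 2 := by
  rintro rfl
  revert i j
  decide

theorem AffineRealization.coroot_root_of_far (ρ : AffineRealization k n H) {i j : ZMod n}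
    (h : Far i j) : ρ.coroot i (ρ.root j) = 0 := by
  rw [ρ.cartan, affineCartan, if_neg h.1, if_neg h.ne_two, if_neg (by simp [h.2.1, h.2.2]),
    Int.cast_zero]

/-- The hypotheses exclude `n = 2`, where the entry is `-2`. When the lemma is applied in a
descending word, they hold because `i + 1` and `i + 2` are both different from the present strand
`i`. -/
theorem AffineRealization.coroot_root_succ (ρ : AffineRealization k n H) {i : ZMod n}
    (h : i + 1 ≠ i) (h' : i + 1 + 1 ≠ i) : ρ.coroot i (ρ.root (i + 1)) = -1 := by
  have h2 : n ≠ 2 := by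
    rintro rfl
    revert i
    decide
  rw [ρ.cartan, affineCartan, if_neg h.symm, if_neg h2, if_pos (.inl rfl)]
  simp

variable (ρ : AffineRealization k n H)

/-- The strand `j` of a word is broken: an enddot followed by a startdot. -/
def brokenAt (j : ZMod n) : (w : List (Letter n)) → EHom ρ w w
  | [] => 0
  | col y :: w => if y = j then enddot ρ y w ⊚ startdot ρ y w else EHom.cons (col y) (brokenAt j w)
  | up :: w => EHom.cons up (brokenAt j w)
  | down :: w => EHom.cons down (brokenAt j w)

/-- The box `α_j` placed immediately to the right of the strand `j` of a word. -/
def boxAfter (j : ZMod n) : (w : List (Letter n)) → EHom ρ w w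
  | [] => 0
  | col y :: w => EHom.cons (col y) (if y = j then EHom.box ρ (ρ.root j) w else boxAfter j w)
  | up :: w => EHom.cons up (boxAfter j w)
  | down :: w => EHom.cons down (boxAfter j w)

/-- The box `α_i` pushed through a strand `i - 1`, if there is one, and then to the right. -/
def pushed (i : ZMod n) (l : List (ZMod n)) : EHom ρ (bsWord l) (bsWord l) :=
  rightBox ρ (ρ.root i) (bsWord l) +
    if i - 1 ∈ l then boxAfter ρ (i - 1) (bsWord l) - brokenAt ρ (i - 1) (bsWord l) else 0

variable {ρ} {a b c : List (Letter n)} {i j : ZMod n}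

theorem EHom.box_of_far (h : Far j i) :
    EHom.box ρ (ρ.root i) (col j :: a) = EHom.cons (col j) (EHom.box ρ (ρ.root i) a) := by
  rw [forcing, ρ.coroot_root_of_far h, zero_smul, add_zero, AffineRealization.refl,
    ρ.coroot_root_of_far h, zero_smul, sub_zero]

/-- Polynomial forcing with `s_i(α_{i+1}) = α_{i+1} + α_i` and pairing `-1`. -/
theorem EHom.box_succ (h : i + 1 ≠ i) (h' : i + 1 + 1 ≠ i) :
    EHom.box ρ (ρ.root (i + 1)) (col i :: a) = EHom.cons (col i) (EHom.box ρ (ρ.root (i + 1)) a) +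
      EHom.cons (col i) (EHom.box ρ (ρ.root i) a) - enddot ρ i a ⊚ startdot ρ i a := by
  rw [forcing, AffineRealization.refl, ρ.coroot_root_succ h h', neg_one_smul, neg_one_smul,
    sub_neg_eq_add, EHom.box_add, cons_add, sub_eq_add_neg]

theorem Swap.brokenAt_comp {s : EHom ρ a b} (hs : Swap ρ s) (j : ZMod n) :
    brokenAt ρ j a ⊚ s = s ⊚ brokenAt ρ j b := by
  induction hs with
  | @head x y h r =>
    have hxy := h.1
    simp only [brokenAt, comp_neg, neg_comp]
    split_ifs with h1 h2 h2
    · exact absurd (h1.trans h2.symm) hxy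
    · rw [comp_assoc, startdot_four h, cons_comp, ← comp_assoc, four_enddot h]
    · rw [cons_comp, comp_assoc, cons_startdot_four h.symm h, ← comp_assoc,
        four_enddot_left h.symm h]
    · rw [four_comp_cons]
  | cons y _ ih =>
    simp only [brokenAt]
    split_ifs
    · rw [comp_assoc, startdot_comp_cons, ← comp_assoc, enddot_comp, comp_assoc]
    · rw [← cons_comp, ih, cons_comp]

theorem Swap.boxAfter_comp {s : EHom ρ a b} (hs : Swap ρ s) (j : ZMod n) :
    boxAfter ρ j a ⊚ s = s ⊚ boxAfter ρ j b := by
  induction hs with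
  | @head x y h r =>
    simp only [boxAfter, comp_neg, neg_comp]
    split_ifs with h1 h2 h2
    · exact absurd (h1.trans h2.symm) h.1
    · subst h1
      rw [box_of_far h.symm, four_comp_cons]
    · subst h2
      rw [box_of_far h, four_comp_cons]
    · rw [four_comp_cons]
  | cons y _ ih =>
    simp only [boxAfter]
    split_ifs
    · rw [← cons_comp, box_comp, cons_comp]
    · rw [← cons_comp, ih, cons_comp]

theorem Swap.rightBox_comp {s : EHom ρ a b} (hs : Swap ρ s) (x : H) :
    rightBox ρ x a ⊚ s = s ⊚ rightBox ρ x b := by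
  induction hs with
  | head h r => simp only [rightBox, comp_neg, neg_comp, four_comp_cons]
  | cons y _ ih => simp only [rightBox, ← cons_comp, ih]

theorem Rex.comp_of_swap (F : ∀ a : List (Letter n), EHom ρ a a)
    (hF : ∀ {a b : List (Letter n)} {s : EHom ρ a b}, Swap ρ s → F a ⊚ s = s ⊚ F b)
    {s : EHom ρ a b} (hs : Rex ρ s) : F a ⊚ s = s ⊚ F b := by
  induction hs with
  | refl => simp
  | head hs _ ih => rw [← comp_assoc, hF hs, comp_assoc, ih, comp_assoc]

/-- All three ingredients are natural for 4-valent vertices: broken strands and boxes of far colours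
pass through them. So `pushed` does not depend on the expression of the Coxeter element. -/
theorem Rex.pushed_comp {l m : List (ZMod n)} {s : EHom ρ (bsWord l) (bsWord m)} (hs : Rex ρ s)
    (i : ZMod n) : pushed ρ i l ⊚ s = s ⊚ pushed ρ i m := by
  have h1 := Rex.comp_of_swap (rightBox ρ (ρ.root i)) (fun h => h.rightBox_comp _) hs
  have h2 := Rex.comp_of_swap (brokenAt ρ (i - 1)) (fun h => h.brokenAt_comp _) hs
  have h3 := Rex.comp_of_swap (boxAfter ρ (i - 1)) (fun h => h.boxAfter_comp _) hs
  have h4 : i - 1 ∈ l ↔ i - 1 ∈ m := (bsWord_perm_iff.1 hs.perm).mem_iff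
  simp only [pushed, add_comp, comp_add, h1, h4]
  split_ifs <;> simp [sub_comp, comp_sub, h2, h3]

theorem brokenAt_bsWord_cons {y : ZMod n} (l : List (ZMod n)) (h : y ≠ j) :
    brokenAt ρ j (bsWord (y :: l)) = EHom.cons (col y) (brokenAt ρ j (bsWord l)) := if_neg h

theorem boxAfter_bsWord_cons {y : ZMod n} (l : List (ZMod n)) (h : y ≠ j) :
    boxAfter ρ j (bsWord (y :: l)) = EHom.cons (col y) (boxAfter ρ j (bsWord l)) :=
  congrArg (EHom.cons (col y)) (if_neg h)

theorem pushed_cons {y : ZMod n} {l : List (ZMod n)} (h : i - 1 ≠ y) :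
    pushed ρ i (y :: l) = EHom.cons (col y) (pushed ρ i l) := by
  unfold pushed
  by_cases h' : i - 1 ∈ l
  · rw [if_pos h', if_pos (List.mem_cons_of_mem _ h'), brokenAt_bsWord_cons l h.symm,
      boxAfter_bsWord_cons l h.symm, cons_add, cons_sub]
    rfl
  · rw [if_neg h', if_neg (by simp [h, h']), add_zero, add_zero]
    rfl

/-- The box walks to the right. Strands other than `i - 1` are far from `i` and let it pass; at `i -
1` forcing produces exactly the correction term. -/
theorem box_eq_pushed {l : List (ZMod n)} (hl : IsDescending l) (hi : i ∉ l) (hi' : i + 1 ∉ l) :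
    EHom.box ρ (ρ.root i) (bsWord l) = pushed ρ i l := by
  induction l with
  | nil =>
    rw [pushed, if_neg (by simp), add_zero]
    rfl
  | cons y l ih =>
    have hl' := List.pairwise_cons.1 hl
    simp only [List.mem_cons, not_or] at hi hi'
    have ih := ih hl'.2 hi.2 hi'.2
    by_cases h : i - 1 = y
    · obtain rfl : i = y + 1 := by rw [← h]; ring
      have hy : y + 1 - 1 = y := by ring
      have hy' : y ∉ l := fun hy => (hl'.1 y hy).1 rfl
      have h2 := box_succ (ρ := ρ) (a := bsWord l) hi.1 hi'.1
      rw [pushed, hy, if_neg hy', add_zero] at ih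
      have hb : brokenAt ρ y (bsWord (y :: l)) = enddot ρ y (bsWord l) ⊚ startdot ρ y (bsWord l) :=
        if_pos rfl
      have ha : boxAfter ρ y (bsWord (y :: l)) =
          EHom.cons (col y) (EHom.box ρ (ρ.root y) (bsWord l)) :=
        congrArg (EHom.cons (col y)) (if_pos rfl)
      rw [pushed, hy, if_pos List.mem_cons_self, hb, ha]
      refine h2.trans ?_
      rw [ih, add_sub_assoc]
      rfl
    · have hf : Far y i := ⟨Ne.symm hi.1, fun h' => h (by rw [h']; ring), fun h' => hi'.1 h'.symm⟩
      rw [pushed_cons h, ← ih]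
      exact box_of_far hf

/-- The link of the telescope: to the right of the strand `i` there is neither `i` nor `i + 1`, so
the box left behind by forcing `α_{i+1}` can be pushed on by the same rule. The strand `i - 1`
cannot stand left of `i`, so the correction terms of the full word are those of its tail. -/
theorem boxAfter_eq_pushed {l : List (ZMod n)} (hl : IsDescending l) (h0 : i + 1 ≠ i) (hi : i ∈ l) :
    boxAfter ρ i (bsWord l) = pushed ρ i l := by
  have h0' : i - 1 ≠ i := fun h => h0 (by nth_rewrite 1 [← h]; ring)
  induction l with
  | nil => simp at hi
  | cons y l ih =>
    have hl' := List.pairwise_cons.1 hl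
    change boxAfter ρ i (col y :: bsWord l) = _
    rw [boxAfter]
    split_ifs with h
    · subst h
      rw [pushed_cons h0', box_eq_pushed hl'.2 (fun h => (hl'.1 _ h).1 rfl)
        (fun h => (hl'.1 _ h).2 rfl)]
    · have hi' : i ∈ l := by simpa [Ne.symm h] using hi
      have h1 : i - 1 ≠ y := fun e => (hl'.1 _ hi').2 (by rw [← e]; ring)
      rw [pushed_cons h1, ih hl'.2 hi']

/-- The shape of the source is a consequence and enters the type of `f`; the sigma type records both
at once. -/
theorem Dot.start_cons_inv {y : ZMod n} (h : y ≠ i) {f : EHom ρ a (col y :: b)}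
    (hf : Dot ρ true i f) : ∃ (a' : List (Letter n)) (f' : EHom ρ a' b), Dot ρ true i f' ∧
      (⟨a, f⟩ : Σ a, EHom ρ a (col y :: b)) = ⟨col y :: a', -EHom.cons (col y) f'⟩ := by
  cases hf with
  | start => exact absurd rfl h
  | step _ hf => exact ⟨_, _, hf, rfl⟩

theorem Dot.finish_cons_inv {y : ZMod n} (h : y ≠ i) {f : EHom ρ (col y :: a) b}
    (hf : Dot ρ false i f) : ∃ (b' : List (Letter n)) (f' : EHom ρ a b'), Dot ρ false i f' ∧
      (⟨b, f⟩ : Σ b, EHom ρ (col y :: a) b) = ⟨col y :: b', -EHom.cons (col y) f'⟩ := by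
  cases hf with
  | finish => exact absurd rfl h
  | step _ hf => exact ⟨_, _, hf, rfl⟩

theorem EHom.neg_cons_comp_neg_cons (x : Letter n) (f : EHom ρ a b) (g : EHom ρ b c) :
    (-EHom.cons x f) ⊚ (-EHom.cons x g) = EHom.cons x (f ⊚ g) := by
  rw [neg_comp, comp_neg, neg_neg, cons_comp]

theorem Dot.exists_reverse {β : Bool} {f : EHom ρ a b} (hf : Dot ρ β i f) :
    ∃ g : EHom ρ b a, Dot ρ (!β) i g := by
  induction hf with
  | start => exact ⟨_, .finish _ _⟩
  | finish => exact ⟨_, .start _ _⟩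
  | step y _ ih => exact ih.elim fun g hg => ⟨_, .step y hg⟩

theorem col_mem_bsWord {l : List (ZMod n)} : col i ∈ bsWord l ↔ i ∈ l := by
  simp [bsWord]

theorem bsWord_injective : Function.Injective (bsWord (n := n)) :=
  List.map_injective_iff.2 fun _ _ h => by cases h; rfl

/-- A startdot on a strand `i` followed by the enddot on it. -/
theorem Dot.start_finish {l m : List (ZMod n)} (hm : IsDescending m)
    {f : EHom ρ (bsWord l) (bsWord m)} {g : EHom ρ (bsWord m) (bsWord l)}
    (hf : Dot ρ true i f) (hg : Dot ρ false i g) (hi : i ∉ l) : f ⊚ g = pushed ρ i l := by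
  induction m generalizing l with
  | nil =>
    have := hf.perm.length_eq
    simp [bsWord] at this
  | cons y m ih =>
    have hm' := List.pairwise_cons.1 hm
    by_cases hy : y = i
    · subst hy
      have hy : col y ∉ bsWord m := fun h => (hm'.1 y (col_mem_bsWord.1 h)).1 rfl
      have hi' : col y ∉ bsWord l := fun h => hi (col_mem_bsWord.1 h)
      have e := hf.unique_start (Dot.start y (bsWord m)) hi' hy
      have e' := hg.unique_finish (Dot.finish y (bsWord m)) hi' hy
      obtain rfl : l = m := bsWord_injective (congrArg Sigma.fst e)
      cases e
      cases e'
      exact (barbell y).trans (box_eq_pushed hm'.2 hi fun h => (hm'.1 _ h).2 rfl)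
    · obtain ⟨a, f', hf', e⟩ := Dot.start_cons_inv (b := bsWord m) hy hf
      obtain ⟨b, g', hg', e'⟩ := Dot.finish_cons_inv (a := bsWord m) hy hg
      cases l with
      | nil => cases congrArg Sigma.fst e
      | cons z l =>
        change (⟨col z :: bsWord l, f⟩ : Σ a, EHom ρ a _) = _ at e
        change (⟨col z :: bsWord l, g⟩ : Σ a, EHom ρ _ a) = _ at e'
        cases e
        cases e'
        have hmem : i ∈ m := by
          rw [← col_mem_bsWord, hf'.perm.mem_iff]
          simp
        rw [pushed_cons fun h => (hm'.1 i hmem).2 (by rw [← h]; ring),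
          ← ih hm'.2 hf' hg' fun h => hi (List.mem_cons_of_mem _ h)]
        exact neg_cons_comp_neg_cons _ f' g'

/-- An enddot on a strand `i` followed by the startdot on it. -/
theorem Dot.finish_start {l m : List (ZMod n)} (hm : m.Nodup)
    {f : EHom ρ (bsWord m) (bsWord l)} {g : EHom ρ (bsWord l) (bsWord m)}
    (hf : Dot ρ false i f) (hg : Dot ρ true i g) (hi : i ∉ l) :
    f ⊚ g = brokenAt ρ i (bsWord m) := by
  induction m generalizing l with
  | nil =>
    have := hf.perm.length_eq
    simp [bsWord] at this
  | cons y m ih =>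
    have hm' := List.nodup_cons.1 hm
    by_cases hy : y = i
    · subst hy
      have hy : col y ∉ bsWord m := fun h => hm'.1 (col_mem_bsWord.1 h)
      have hi' : col y ∉ bsWord l := fun h => hi (col_mem_bsWord.1 h)
      have e := hf.unique_finish (Dot.finish y (bsWord m)) hi' hy
      have e' := hg.unique_start (Dot.start y (bsWord m)) hi' hy
      obtain rfl : l = m := bsWord_injective (congrArg Sigma.fst e)
      cases e
      cases e'
      exact (if_pos rfl).symm
    · obtain ⟨a, f', hf', e⟩ := Dot.finish_cons_inv (a := bsWord m) hy hf
      obtain ⟨b, g', hg', e'⟩ := Dot.start_cons_inv (b := bsWord m) hy hg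
      cases l with
      | nil => cases congrArg Sigma.fst e
      | cons z l =>
        change (⟨col z :: bsWord l, f⟩ : Σ a, EHom ρ _ a) = _ at e
        change (⟨col z :: bsWord l, g⟩ : Σ a, EHom ρ a _) = _ at e'
        cases e
        cases e'
        rw [brokenAt_bsWord_cons m hy,
          ← ih hm'.2 hf' hg' fun h => hi (List.mem_cons_of_mem _ h)]
        exact neg_cons_comp_neg_cons _ f' g'

theorem Mov.start_finish {l m : List (ZMod n)} (hl : IsDescending l) (hm : IsDescending m)
    {f : EHom ρ (bsWord l) (bsWord m)} {g : EHom ρ (bsWord m) (bsWord l)}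
    (hf : Mov ρ true i f) (hg : Mov ρ false i g) : f ⊚ g = pushed ρ i l := by
  have hi : i ∉ l := by
    have h := bsWord_perm_iff (m := i :: l).1 hf.perm
    exact (List.nodup_cons.1 (h.nodup_iff.1 hm.nodup)).1
  obtain ⟨v, r, p, hr, hp, rfl⟩ := hf
  obtain ⟨v, rfl⟩ := exists_bsWord_of_perm hr.perm
  obtain ⟨r', hr', h1, h2⟩ := hr.symm
  have hv : i ∉ v := fun h => hi ((bsWord_perm_iff.1 hr.perm).mem_iff.2 h)
  -- By uniqueness, `g` may be replaced by the plain dot reverse to `p` followed by the inverse rex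
  -- move, which turns the composite into a conjugate of a barbell.
  obtain ⟨p', hp'⟩ := hp.exists_reverse
  rw [← (hp'.mov.comp_rex hr').unique hm.nodup hl.nodup hg, comp_assoc, ← comp_assoc p,
    hp.start_finish hm hp' hv, ← comp_assoc, ← hr.pushed_comp, comp_assoc, h1, comp_id]

theorem Mov.finish_start {l m : List (ZMod n)} (hl : IsDescending l) (hm : IsDescending m)
    {f : EHom ρ (bsWord l) (bsWord m)} {g : EHom ρ (bsWord m) (bsWord l)}
    (hf : Mov ρ false i f) (hg : Mov ρ true i g) : f ⊚ g = brokenAt ρ i (bsWord l) := by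
  have hi : i ∉ m := by
    have h := bsWord_perm_iff (m := i :: m).1 hf.perm
    exact (List.nodup_cons.1 (h.nodup_iff.1 hl.nodup)).1
  obtain ⟨v, p, r, hp, hr, rfl⟩ := hf
  obtain ⟨v, rfl⟩ := exists_bsWord_of_perm hr.perm.symm
  obtain ⟨r', hr', h1, h2⟩ := hr.symm
  have hv : i ∉ v := fun h => hi ((bsWord_perm_iff.1 hr.perm).mem_iff.1 h)
  obtain ⟨p', hp'⟩ := hp.exists_reverse
  rw [← (hp'.mov.rex_comp hr').unique hm.nodup hl.nodup hg, comp_assoc, ← comp_assoc r,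
    h1, id_comp, hp.finish_start hl.nodup hp' hv]

/-- The boxes at all absent strands and the broken strands sum up to `δ` at the right. -/
theorem sum_pushed_add_brokenAt [NeZero n] (hn : 2 ≤ n) {l : List (ZMod n)} (hl : IsDescending l) :
    ∑ i, (if i ∈ l then brokenAt ρ i (bsWord l) else pushed ρ i l) =
      rightBox ρ ρ.delta (bsWord l) := by
  have : Fact (1 < n) := ⟨hn⟩
  have h0 : ∀ i : ZMod n, i + 1 ≠ i := fun i h => one_ne_zero (add_eq_left.1 h)
  -- The correction term of `pushed i` belongs to the strand `i - 1`; after the shift `i ↦ i - 1` of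
  -- the summation index it is `pushed i - brokenAt i` for each present strand `i`. The
  -- contributions of present strands `pushed i` then cancel on both sides.
  have h1 : ∑ i, pushed ρ i l = rightBox ρ ρ.delta (bsWord l) +
      ∑ i, if i ∈ l then pushed ρ i l - brokenAt ρ i (bsWord l) else 0 := by
    rw [AffineRealization.delta, rightBox_sum,
      ← Equiv.sum_comp (Equiv.subRight (1 : ZMod n)) fun i => if i ∈ l then _ else _,
      ← Finset.sum_add_distrib]
    refine Finset.sum_congr rfl fun i _ => ?_
    rw [pushed]
    simp only [Equiv.subRight_apply]
    split_ifs with h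
    · rw [boxAfter_eq_pushed hl (h0 _) h]
    · rfl
  rw [← add_right_cancel_iff (a := ∑ i, if i ∈ l then pushed ρ i l - brokenAt ρ i (bsWord l) else 0),
    ← h1, ← Finset.sum_add_distrib]
  refine Finset.sum_congr rfl fun i _ => ?_
  split_ifs <;> simp

end

/-! ### The standard Gaitsgory complex is a pseudocomplex -/

section
open EHom

variable {k : Type u} [CommRing k] {n : ℕ} {H : Type v} [AddCommGroup H] [Module k H]
variable {ρ : AffineRealization k n H}

theorem PreComplex.consLetter_dSq (x : Letter n) (C : PreComplex ρ) (a b : C.ι) :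
    (C.consLetter x).dSq a b = EHom.cons x (C.dSq a b) := by
  unfold PreComplex.dSq
  rw [cons_sum]
  exact Finset.sum_congr rfl fun c _ => (cons_comp x (C.d a c) (C.d c b)).symm

theorem PreComplex.IsComplex.consLetter {C : PreComplex ρ} (hC : C.IsComplex)
    (x : Letter n) : (C.consLetter x).IsComplex := by
  intro a b
  exact (consLetter_dSq x C a b).trans ((congrArg (EHom.cons x) (hC a b)).trans (cons_zero x))

end

/-! ### Toggling one strand, the sets `P_p`, and the computation of `d²` -/

section
open EHom Letter

variable {n : ℕ}

/-- The set `X` with the membership of `i` changed. -/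
def toggle (i : ZMod n) (X : Finset (ZMod n)) : Finset (ZMod n) :=
  if i ∈ X then X.erase i else insert i X

theorem mem_toggle {i x : ZMod n} {X : Finset (ZMod n)} :
    x ∈ toggle i X ↔ (x = i ∧ x ∉ X) ∨ (x ≠ i ∧ x ∈ X) := by
  unfold toggle
  split_ifs with h <;> by_cases hx : x = i <;> simp_all

theorem toggle_toggle (i : ZMod n) (X : Finset (ZMod n)) : toggle i (toggle i X) = X := by
  ext x
  simp only [mem_toggle]
  tauto

theorem toggle_comm (i j : ZMod n) (X : Finset (ZMod n)) :
    toggle i (toggle j X) = toggle j (toggle i X) := by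
  ext x
  simp only [mem_toggle]
  by_cases h : x = i <;> by_cases h' : x = j <;> simp_all

theorem toggle_injective {i j : ZMod n} {X : Finset (ZMod n)} (h : toggle i X = toggle j X) :
    i = j := by
  by_contra hij
  have := Finset.ext_iff.1 h i
  simp only [mem_toggle] at this
  tauto

theorem card_toggle (i : ZMod n) (X : Finset (ZMod n)) :
    (i ∈ X ∧ (toggle i X).card + 1 = X.card) ∨ (i ∉ X ∧ (toggle i X).card = X.card + 1) := by
  unfold toggle
  split_ifs with h
  · exact .inl ⟨h, Finset.card_erase_add_one h⟩
  · exact .inr ⟨h, Finset.card_insert_of_notMem h⟩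

theorem isDescending_prefWord (al : Finset (ZMod n) → ZMod n) (hn : 2 ≤ n) (X : Finset (ZMod n)) :
    IsDescending (prefWord al X) := isDescending_cyclicWord hn X

variable [NeZero n] {X Y Z : Finset (ZMod n)} {p : ℤ}

theorem ne_univ_of_card_lt (h : X.card < n) : X ≠ Finset.univ := by
  rintro rfl
  simp [ZMod.card] at h

theorem mem_chainSet : X ∈ ChainSet n p ↔ (X.card : ℤ) ≤ n - 1 - |p| ∧
    Even ((n : ℤ) - 1 - p - X.card) := by
  simp only [ChainSet, Finset.mem_filter, Finset.mem_univ, true_and, and_iff_right_iff_imp]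
  intro h
  have := abs_nonneg p
  exact ne_univ_of_card_lt (by omega)

theorem ne_univ_of_mem_chainSet (h : X ∈ ChainSet n p) : X ≠ Finset.univ :=
  (Finset.mem_filter.1 h).2.1

theorem mem_Icc_of_mem_chainSet (h : X ∈ ChainSet n p) : p ∈ Finset.Icc (-(n : ℤ)) n := by
  have h1 := (mem_chainSet.1 h).1
  rw [Finset.mem_Icc, ← abs_le]
  omega

/-- No intermediate step of a path from `P_p` to `P_{p+2}` is lost. The parity changes correctly;
the bound on the cardinality in degree `p + 1` exceeds by one the bound in degree `p` if `p < 0`,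
and the bound in degree `p + 2` if `p ≥ -1`. In particular the intermediate sets are proper, so that
signed dots to them make sense. -/
theorem toggle_mem_chainSet {i j : ZMod n} (hX : X ∈ ChainSet n p)
    (hZ : toggle j (toggle i X) ∈ ChainSet n (p + 2)) : toggle i X ∈ ChainSet n (p + 1) := by
  rw [mem_chainSet] at hX hZ ⊢
  rw [Int.even_iff] at hX hZ ⊢
  have h1 := card_toggle i X
  have h2 := card_toggle j (toggle i X)
  rcases abs_cases p with h | h <;> rcases abs_cases (p + 1) with h' | h' <;>
    rcases abs_cases (p + 2) with h'' | h'' <;> rw [h.1] at hX <;> rw [h'.1] <;>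
    rw [h''.1] at hZ <;> omega

theorem toggle_ne_univ (hX : X ∈ ChainSet n p) (hX' : X ∈ ChainSet n (p + 2)) (i : ZMod n) :
    toggle i X ≠ Finset.univ :=
  ne_univ_of_mem_chainSet (toggle_mem_chainSet (j := i) hX (by rwa [toggle_toggle]))

variable {k : Type u} [CommRing k] {H : Type v} [AddCommGroup H] [Module k H]
variable (ρ : AffineRealization k n H) (al : Finset (ZMod n) → ZMod n)

/-- The sum of all signed dots `B_X → B_Y(1)`. -/
def signedDots (X Y : Finset (ZMod n)) :
    EHom ρ (bsWord (prefWord al X)) (bsWord (prefWord al Y)) :=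
  (∑ i, if i ∉ X ∧ Y = insert i X then dotUp ρ al i X Y else 0) +
    (∑ j, if j ∈ X ∧ Y = Finset.erase X j then dotDown ρ al j X Y else 0)

/-- The signed dot that changes the membership of `i`. -/
def signedDot (i : ZMod n) (X Y : Finset (ZMod n)) :
    EHom ρ (bsWord (prefWord al X)) (bsWord (prefWord al Y)) :=
  if i ∈ X then dotDown ρ al i X Y else dotUp ρ al i X Y

variable {ρ al}

theorem signedDots_eq_sum (X Y : Finset (ZMod n)) :
    signedDots ρ al X Y = ∑ i, if Y = toggle i X then signedDot ρ al i X Y else 0 := by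
  rw [signedDots, ← Finset.sum_add_distrib]
  refine Finset.sum_congr rfl fun i _ => ?_
  unfold toggle signedDot
  by_cases h : i ∈ X <;> simp [h]

theorem signedDots_toggle {i : ZMod n} (h : Y = toggle i X) :
    signedDots ρ al X Y = signedDot ρ al i X Y := by
  rw [signedDots_eq_sum, Finset.sum_eq_single i, if_pos h]
  · intro j _ hj
    exact if_neg fun h' => hj (toggle_injective (h'.symm.trans h))
  · simp

theorem signedDots_eq_zero (h : ∀ i, Y ≠ toggle i X) : signedDots ρ al X Y = 0 := by
  rw [signedDots_eq_sum]
  exact Finset.sum_eq_zero fun i _ => if_neg (h i)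

theorem mem_prefWord (hal : ∀ X, X ≠ Finset.univ → al X ∉ X)
    (hX : X ≠ Finset.univ) {x : ZMod n} : x ∈ prefWord al X ↔ x ∈ X :=
  mem_cyclicWord (hal X hX)

/-- From here on the choice `al` matters only through the fact that `prefWord` is a descending word
with letter set `X`; this needs `X` and `Y` to be proper subsets. -/
theorem signedDot_mov (hn : 2 ≤ n) (hal : ∀ X, X ≠ Finset.univ → al X ∉ X)
    (hX : X ≠ Finset.univ) (hY : Y ≠ Finset.univ) {i : ZMod n}
    (h : Y = toggle i X) : Mov ρ (decide (i ∉ X)) i (signedDot ρ al i X Y) := by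
  have hdX := isDescending_prefWord al hn X
  have hdY := isDescending_prefWord al hn Y
  unfold signedDot
  unfold toggle at h
  by_cases hi : i ∈ X
  · rw [if_pos hi] at h ⊢
    have hp : ((prefWord al X).erase i).Perm (prefWord al Y) := by
      rw [List.perm_ext_iff_of_nodup (hdX.erase i).nodup hdY.nodup]
      intro x
      rw [hdX.nodup.mem_erase_iff, mem_prefWord hal hX, mem_prefWord hal hY, h,
        Finset.mem_erase]
    have := (dot_removeDot (ρ := ρ) ((mem_prefWord hal hX).2 hi)).mov.comp_rex
      (rex_signedRex (hdX.erase i) hdY hp)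
    rw [show decide (i ∉ X) = false by simp [hi]]
    exact this
  · rw [if_neg hi] at h ⊢
    have hp : (prefWord al X).Perm ((prefWord al Y).erase i) := by
      rw [List.perm_ext_iff_of_nodup hdX.nodup (hdY.erase i).nodup]
      intro x
      rw [hdY.nodup.mem_erase_iff, mem_prefWord hal hX, mem_prefWord hal hY, h,
        Finset.mem_insert]
      constructor
      · exact fun hx => ⟨fun e => hi (e ▸ hx), .inr hx⟩
      · exact fun hx => hx.2.resolve_left hx.1
    have := (dot_insertDot (ρ := ρ) ((mem_prefWord hal hY).2 (h ▸ Finset.mem_insert_self i X))).mov.rex_comp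
      (rex_signedRex hdX (hdY.erase i) hp)
    rw [show decide (i ∉ X) = true by simp [hi]]
    exact this

/-- The path from `X` to itself through the set with changed membership of `i`. -/
theorem signedDot_comp_self (hn : 2 ≤ n) (hal : ∀ X, X ≠ Finset.univ → al X ∉ X)
    (hX : X ≠ Finset.univ) {i : ZMod n} (h : toggle i X ≠ Finset.univ) :
    signedDot ρ al i X (toggle i X) ⊚ signedDot ρ al i (toggle i X) X =
      if i ∈ prefWord al X then brokenAt ρ i (bsWord (prefWord al X))
      else pushed ρ i (prefWord al X) := by
  have h1 := signedDot_mov (ρ := ρ) hn hal hX h rfl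
  have h2 := signedDot_mov (ρ := ρ) hn hal h hX (toggle_toggle i X).symm
  have h3 : i ∈ toggle i X ↔ i ∉ X := by simp [mem_toggle]
  simp only [mem_prefWord hal hX]
  split_ifs with hi
  · simp only [h3, hi, not_true_eq_false, not_false_eq_true, decide_true, decide_false] at h1 h2
    exact h1.finish_start (isDescending_prefWord al hn _) (isDescending_prefWord al hn _) h2
  · simp only [h3, hi, not_true_eq_false, not_false_eq_true, decide_true, decide_false] at h1 h2
    exact h1.start_finish (isDescending_prefWord al hn _) (isDescending_prefWord al hn _) h2

theorem signedDot_anticomm (hn : 2 ≤ n) (hal : ∀ X, X ≠ Finset.univ → al X ∉ X)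
    {i j : ZMod n} (hij : i ≠ j) (hX : X ≠ Finset.univ)
    (hi : toggle i X ≠ Finset.univ) (hj : toggle j X ≠ Finset.univ) (hZ : Z ≠ Finset.univ)
    (h : Z = toggle j (toggle i X)) :
    signedDot ρ al i X (toggle i X) ⊚ signedDot ρ al j (toggle i X) Z =
      -(signedDot ρ al j X (toggle j X) ⊚ signedDot ρ al i (toggle j X) Z) := by
  have h1 := signedDot_mov (ρ := ρ) hn hal hX hi rfl
  have h2 := signedDot_mov (ρ := ρ) hn hal hi hZ h
  have h3 := signedDot_mov (ρ := ρ) hn hal hX hj rfl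
  have h4 := signedDot_mov (ρ := ρ) hn hal hj hZ (h.trans (toggle_comm j i X))
  have e1 : i ∈ toggle j X ↔ i ∈ X := by simp [mem_toggle, hij]
  have e2 : j ∈ toggle i X ↔ j ∈ X := by simp [mem_toggle, hij.symm]
  simp only [e1] at h4
  simp only [e2] at h2
  exact h1.anticomm hij (isDescending_prefWord al hn _) (isDescending_prefWord al hn _)
    (isDescending_prefWord al hn _) (isDescending_prefWord al hn _) h2 h3 h4

/-- For `X ≠ Z` a path is an order of the two strands to be changed, and the two orders cancel. For
`X = Z` every strand is changed and changed back, and the telescoping sum gives `δ`. -/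
theorem sum_signedDots (hn : 2 ≤ n) (hal : ∀ X, X ≠ Finset.univ → al X ∉ X)
    (hX : X ∈ ChainSet n p) (hZ : Z ∈ ChainSet n (p + 2)) :
    ∑ i, signedDots ρ al X (toggle i X) ⊚ signedDots ρ al (toggle i X) Z =
      if h : X = Z then rightBox ρ ρ.delta _ ⊚ EHom.cast ρ (by rw [h]) else 0 := by
  split_ifs with h
  · subst h
    rw [cast_rfl, comp_id, ← sum_pushed_add_brokenAt hn (isDescending_prefWord al hn X)]
    refine Finset.sum_congr rfl fun i _ => ?_
    rw [signedDots_toggle rfl, signedDots_toggle (toggle_toggle i X).symm]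
    exact signedDot_comp_self hn hal (ne_univ_of_mem_chainSet hX) (toggle_ne_univ hX hZ i)
  · by_cases h' : ∃ i j, Z = toggle j (toggle i X)
    · obtain ⟨i, j, hij⟩ := h'
      have hne : i ≠ j := by
        rintro rfl
        exact h (by rw [hij, toggle_toggle])
      have hji : Z = toggle i (toggle j X) := hij.trans (toggle_comm j i X)
      rw [← Finset.sum_subset (Finset.subset_univ {i, j}), Finset.sum_pair hne,
        signedDots_toggle rfl, signedDots_toggle hij, signedDots_toggle rfl, signedDots_toggle hji,
        signedDot_anticomm hn hal hne (ne_univ_of_mem_chainSet hX)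
          (ne_univ_of_mem_chainSet (toggle_mem_chainSet hX (hij ▸ hZ)))
          (ne_univ_of_mem_chainSet (toggle_mem_chainSet hX (hji ▸ hZ)))
          (ne_univ_of_mem_chainSet hZ) hij, neg_add_cancel]
      intro x _ hx
      simp only [Finset.mem_insert, Finset.mem_singleton, not_or] at hx
      -- After changing a third strand `x`, one more change cannot lead to `Z`: it would have to
      -- restore `x` and return to `X`.
      rw [signedDots_eq_zero (X := toggle x X), comp_zero]
      intro y hy
      by_cases hxy : x = y
      · subst hxy
        exact h (by rw [hy, toggle_toggle])
      · have := Finset.ext_iff.1 (hy.symm.trans hij) x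
        simp only [mem_toggle] at this
        tauto
    · push Not at h'
      refine Finset.sum_eq_zero fun i _ => ?_
      rw [signedDots_eq_zero (X := toggle i X) (h' i), comp_zero]

theorem twistedStandard_dSq (hn : 2 ≤ n) (hal : ∀ X, X ≠ Finset.univ → al X ∉ X)
    (a b : (twistedStandard ρ al).ι) :
    (twistedStandard ρ al).dSq a b =
      if h : (b.1 : ℤ) = a.1 + 2 ∧ (a.2 : Finset (ZMod n)) = b.2 then
        EHom.rightBox ρ ρ.delta _ ⊚ EHom.cast ρ (by simp only [twistedStandard, h.2]) else 0 := by
  obtain ⟨⟨p, hp⟩, ⟨X, hX⟩⟩ := a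
  obtain ⟨⟨q, hq⟩, ⟨Z, hZ⟩⟩ := b
  change ∑ c : Σ p : Finset.Icc (-(n : ℤ)) n, ChainSet n p,
    (if (c.1 : ℤ) = p + 1 then signedDots ρ al X c.2 else 0) ⊚
      (if q = c.1 + 1 then signedDots ρ al c.2 Z else 0) = _
  by_cases h : q = p + 2
  · subst h
    refine Eq.trans ?_ ((sum_signedDots (ρ := ρ) hn hal hX hZ).trans ?_)
    -- A nonzero term has `Z` one change away from `toggle i X`, so its middle set lies in
    -- `P_{p+1}`; the sum over summands of the complex is thus the sum over all strands.
    · have hmem : ∀ i, signedDots ρ al X (toggle i X) ⊚ signedDots ρ al (toggle i X) Z ≠ 0 →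
          toggle i X ∈ ChainSet n (p + 1) := by
        intro i hi
        by_contra hc
        refine hi ?_
        rw [signedDots_eq_zero (X := toggle i X), comp_zero]
        exact fun j hj => hc (toggle_mem_chainSet hX (hj ▸ hZ))
      symm
      refine Finset.sum_bij_ne_zero (fun i _ hi => ⟨⟨p + 1, mem_Icc_of_mem_chainSet (hmem i hi)⟩,
        ⟨toggle i X, hmem i hi⟩⟩) (fun _ _ _ => Finset.mem_univ _) ?_ ?_ ?_
      · intro i _ _ j _ _ h
        simp only [Sigma.mk.injEq, heq_eq_eq, Subtype.mk.injEq, true_and] at h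
        exact toggle_injective h
      · rintro ⟨⟨r, hr⟩, ⟨Y, hY⟩⟩ _ hc
        dsimp only at hY hc
        by_cases hr' : r = p + 1
        · subst hr'
          rw [if_pos rfl, if_pos (by ring)] at hc
          have : ∃ i, Y = toggle i X := by
            by_contra h
            push Not at h
            rw [signedDots_eq_zero h, zero_comp] at hc
            exact hc rfl
          obtain ⟨i, rfl⟩ := this
          exact ⟨i, Finset.mem_univ _, hc, rfl⟩
        · rw [if_neg hr', zero_comp] at hc
          exact absurd rfl hc
      · intro i _ hi
        dsimp only
        rw [if_pos rfl, if_pos (by ring)]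
    · by_cases h : X = Z
      · rw [dif_pos h, dif_pos ⟨rfl, h⟩]
        rfl
      · rw [dif_neg h, dif_neg (fun h' => h h'.2)]
        rfl
  · rw [dif_neg fun h' => h h'.1]
    refine Finset.sum_eq_zero fun c _ => ?_
    by_cases h1 : (c.1 : ℤ) = p + 1
    · rw [if_neg (show ¬ q = c.1 + 1 by omega), comp_zero]
    · rw [if_neg h1, zero_comp]

theorem PreComplex.IsPseudocomplex.consLetter {C : PreComplex ρ} (hC : C.IsPseudocomplex)
    (x : Letter n) : (C.consLetter x).IsPseudocomplex := by
  intro a b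
  obtain ⟨μ, hμ, e⟩ := hC a b
  exact ⟨EHom.cons x μ, hμ.cons x,
    (consLetter_dSq x C a b).trans ((congrArg (EHom.cons x) e).trans (cons_comp x _ _))⟩

theorem PreComplex.IsPseudocomplex.isComplex {C : PreComplex ρ} (hC : C.IsPseudocomplex)
    (h : ρ.delta = 0) : C.IsComplex := by
  intro a b
  obtain ⟨μ, -, e⟩ := hC a b
  rw [e, h, rightBox_zero, comp_zero]

theorem twistedStandard_isPseudocomplex (hn : 2 ≤ n)
    (hal : ∀ X, X ≠ Finset.univ → al X ∉ X) : (twistedStandard ρ al).IsPseudocomplex := by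
  intro a b
  rw [twistedStandard_dSq hn hal]
  split_ifs with h
  · obtain ⟨⟨p, hp⟩, ⟨X, hX⟩⟩ := a
    obtain ⟨⟨q, hq⟩, ⟨Z, hZ⟩⟩ := b
    obtain ⟨h1, h2⟩ := h
    dsimp only at h1 h2
    subst h1 h2
    refine ⟨EHom.id ρ _, ?_, (comp_id _).trans (id_comp _).symm⟩
    have : (p + 2 - p - 2 : ℤ) = 0 := by ring
    exact this ▸ HasDegree.cast rfl
  · exact ⟨0, HasDegree.zero _, by rw [zero_comp]⟩

theorem standardGaitsgory_isPseudocomplex (hn : 2 ≤ n)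
    (hal : ∀ X, X ≠ Finset.univ → al X ∉ X) : (standardGaitsgory ρ al).IsPseudocomplex :=
  (twistedStandard_isPseudocomplex hn hal).consLetter up

theorem standardGaitsgory_isMultFreePerverse (hn : 2 ≤ n) :
    (standardGaitsgory ρ al).IsMultFreePerverse := fun a =>
  ⟨rfl, 1, up, prefWord al a.2, .inl rfl, (isDescending_prefWord al hn _).nodup, rfl⟩

end

/-! ### Rouquier complexes of words without repetitions -/

section
open EHom Letter

variable {k : Type u} [CommRing k] {n : ℕ} {H : Type v} [AddCommGroup H] [Module k H]
variable {ρ : AffineRealization k n H}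

namespace PreComplex

theorem IsComplex.cons_sum_eq_zero {C : PreComplex ρ} (hC : C.IsComplex) (x : Letter n)
    (a b : C.ι) : ∑ c, EHom.cons x (C.d a c) ⊚ EHom.cons x (C.d c b) = 0 :=
  hC.consLetter x a b

theorem IsComplex.neg_sum_eq_zero {C : PreComplex ρ} (hC : C.IsComplex) (a b : C.ι) :
    ∑ c, (-C.d a c) ⊚ (-C.d c b) = 0 := by
  simp only [neg_comp, comp_neg, neg_neg]
  exact hC a b

/-- The only block that does not vanish for trivial reasons runs from `B_i ⊗ C` to `C`; there
naturality of the enddot meets the sign on the second copy of `C`. -/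
theorem IsComplex.tensorF {C : PreComplex ρ} (hC : C.IsComplex) (i : ZMod n) :
    (C.tensorF i).IsComplex := by
  classical
  have h2 : ∀ a b, (∑ c, EHom.cons (col i) (C.d a c) ⊚ (if h : c = b then
      enddot ρ i (C.word c) ⊚ EHom.cast ρ (congrArg C.word h) else 0)) +
      ∑ c, (if h : a = c then enddot ρ i (C.word a) ⊚ EHom.cast ρ (congrArg C.word h) else 0) ⊚
        (-C.d c b) = 0 := by
    intro a b
    rw [Finset.sum_eq_single b (fun c _ h => by rw [dif_neg h, comp_zero]) (by simp),
      Finset.sum_eq_single a (fun c _ h => by rw [dif_neg h.symm, zero_comp]) (by simp),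
      dif_pos rfl, dif_pos rfl, cast_rfl, cast_rfl, comp_id, comp_id, comp_neg, enddot_comp,
      add_neg_cancel]
  rintro (a | a) (b | b) <;> refine (Fintype.sum_sum_type _).trans ?_
  · exact (congrArg₂ _ (hC.cons_sum_eq_zero (col i) a b)
      (Finset.sum_eq_zero fun c _ => comp_zero _)).trans (add_zero _)
  · exact h2 a b
  · exact (congrArg₂ _ (Finset.sum_eq_zero fun c _ => zero_comp _)
      (Finset.sum_eq_zero fun c _ => comp_zero _)).trans (add_zero _)
  · exact (congrArg₂ _ (Finset.sum_eq_zero fun c _ => zero_comp _)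
      (hC.neg_sum_eq_zero a b)).trans (add_zero _)

theorem IsComplex.tensorFinv {C : PreComplex ρ} (hC : C.IsComplex) (i : ZMod n) :
    (C.tensorFinv i).IsComplex := by
  classical
  have h2 : ∀ a b, (∑ c, (if h : a = c then
      EHom.cast ρ (congrArg C.word h) ⊚ startdot ρ i (C.word c) else 0) ⊚
        EHom.cons (col i) (C.d c b)) +
      ∑ c, (-C.d a c) ⊚ (if h : c = b then
        EHom.cast ρ (congrArg C.word h) ⊚ startdot ρ i (C.word b) else 0) = 0 := by
    intro a b
    rw [Finset.sum_eq_single a (fun c _ h => by rw [dif_neg h.symm, zero_comp]) (by simp),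
      Finset.sum_eq_single b (fun c _ h => by rw [dif_neg h, comp_zero]) (by simp),
      dif_pos rfl, dif_pos rfl, cast_rfl, cast_rfl, id_comp, id_comp, neg_comp,
      startdot_comp_cons, add_neg_cancel]
  rintro (a | a) (b | b) <;> refine (Fintype.sum_sum_type _).trans ?_
  · exact (congrArg₂ _ (hC.cons_sum_eq_zero (col i) a b)
      (Finset.sum_eq_zero fun c _ => zero_comp _)).trans (add_zero _)
  · exact (congrArg₂ _ (Finset.sum_eq_zero fun c _ => comp_zero _)
      (Finset.sum_eq_zero fun c _ => zero_comp _)).trans (add_zero _)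
  · exact h2 a b
  · exact (congrArg₂ _ (Finset.sum_eq_zero fun c _ => comp_zero _)
      (hC.neg_sum_eq_zero a b)).trans (add_zero _)

theorem isComplex_rouquier (b : List (BraidLetter n)) : (rouquier ρ b).IsComplex := by
  induction b with
  | nil => 
    intro _ _
    exact Finset.sum_eq_zero fun _ _ => comp_zero _
  | cons x b ih =>
    cases x with
    | f i => exact ih.tensorF i
    | fInv i => exact ih.tensorFinv i
    | omega => exact ih.consLetter up
    | omegaInv => exact ih.consLetter down

/-- The signs which turn the Koszul signs of Rouquier complexes into the signs of signed dots. -/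
theorem dot_smul_cons {β : Bool} {i j : ZMod n} {a b : List (Letter n)} {f : EHom ρ a b}
    {x y : kˣ} {p q : ℤ} (h : q ≠ p + 1 → f = 0) (hf : Dot ρ β i ((x * y⁻¹) • f)) :
    Dot ρ β i ((((-1) ^ p * x) * ((-1) ^ q * y)⁻¹) • EHom.cons (col j) f) := by
  have : ((((-1) ^ p * x) * ((-1) ^ q * y)⁻¹) • EHom.cons (col j) f) =
      -EHom.cons (col j) ((x * y⁻¹) • f) := by
    by_cases hq : q = p + 1
    · subst hq
      -- The factor `(-1)^p` changes sign along a differential, which supplies the sign required for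
      -- the new strand on the left. Outside consecutive degrees the map is zero.
      have e : ((-1 : kˣ) ^ p * x) * ((-1) ^ (p + 1) * y)⁻¹ = - (x * y⁻¹) := by
        rw [mul_inv_eq_iff_eq_mul, zpow_add, zpow_one]
        simp only [mul_neg, neg_mul, neg_neg, mul_one]
        rw [mul_comm (_ * _) (_ * y), mul_assoc, mul_comm x, mul_inv_cancel_left]
      rw [e]
      simp [Units.smul_def]
    · simp [h hq]
  rw [this]
  exact hf.step j

/-- In the copy without the new strand no sign is wanted: the change of `(-1)^p` cancels the Koszul
sign. -/
theorem dot_smul_neg {β : Bool} {i : ZMod n} {a b : List (Letter n)} {f : EHom ρ a b}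
    {x y : kˣ} {p q : ℤ} (h : q ≠ p + 1 → f = 0) (hf : Dot ρ β i ((x * y⁻¹) • f)) :
    Dot ρ β i ((((-1) ^ p * x) * ((-1) ^ q * y)⁻¹) • -f) := by
  have : ((((-1) ^ p * x) * ((-1) ^ q * y)⁻¹) • -f) = (x * y⁻¹) • f := by
    by_cases hq : q = p + 1
    · subst hq
      have e : ((-1 : kˣ) ^ p * x) * ((-1) ^ (p + 1) * y)⁻¹ = - (x * y⁻¹) := by
        rw [mul_inv_eq_iff_eq_mul, zpow_add, zpow_one]
        simp only [mul_neg, neg_mul, neg_neg, mul_one]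
        rw [mul_comm (_ * _) (_ * y), mul_assoc, mul_comm x, mul_inv_cancel_left]
      rw [e]
      simp [Units.smul_def]
    · simp [h hq]
  rwa [this]

/-- A letter `f_i` (for `β = false`) or `f_i⁻¹` (for `β = true`). -/
def _root_.braidLetter : ZMod n × Bool → BraidLetter n
  | (i, true) => .fInv i
  | (i, false) => .f i

/-- The homological degree in the Rouquier complex of a word of the summand made of the strands in
`X`. -/
def _root_.strandDegree (L : List (ZMod n × Bool)) (X : Finset (ZMod n)) : ℤ :=
  (L.map fun x => if x.1 ∈ X then 0 else if x.2 then -1 else 1).sum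

/-- A description of the Rouquier complex of a word `L` without repetitions: its summands
correspond to the subsets of the set of letters, and up to the signs `η` its differential is the sum
of the signed enddots on the letters `f_i` and of the signed startdots on the letters `f_i⁻¹`. -/
structure IsCube (C : PreComplex ρ) (L : List (ZMod n × Bool)) (e : C.ι → Finset (ZMod n))
    (η : C.ι → kˣ) : Prop where
  injective : Function.Injective e
  exists_iff : ∀ X, (∃ a, e a = X) ↔ ∀ x ∈ X, x ∈ L.map Prod.fst
  word_eq : ∀ a, C.word a = bsWord ((L.map Prod.fst).filter (· ∈ e a))
  shift_eq : ∀ a, C.shift a = C.deg a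
  deg_eq : ∀ a, C.deg a = strandDegree L (e a)
  dot : ∀ a b i, (i, decide (i ∉ e a)) ∈ L → e b = toggle i (e a) →
    Dot ρ (decide (i ∉ e a)) i ((η a * (η b)⁻¹) • C.d a b)
  d_eq_zero : ∀ a b, (∀ i, (i, decide (i ∉ e a)) ∈ L → e b ≠ toggle i (e a)) → C.d a b = 0

theorem isCube_unit : IsCube (PreComplex.unit ρ) [] (fun _ => ∅) (fun _ => 1) where
  injective _ _ _ := rfl
  exists_iff X := by
    simp only [List.map_nil, List.not_mem_nil, imp_false, ← Finset.eq_empty_iff_forall_notMem]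
    exact ⟨fun ⟨_, h⟩ => h.symm, fun h => ⟨(), h.symm⟩⟩
  word_eq _ := rfl
  shift_eq _ := rfl
  deg_eq _ := rfl
  dot _ _ _ h := by simp at h
  d_eq_zero _ _ _ := rfl

/-- The tensor product with the Rouquier complex of a letter. -/
noncomputable def tensorLetter (j : ZMod n) (β : Bool) (C : PreComplex ρ) : PreComplex ρ :=
  match β with
  | true => C.tensorFinv j
  | false => C.tensorF j

end PreComplex
end

/-! ### Tensoring a cube with one more letter -/

section
open EHom Letter

variable {k : Type u} [CommRing k] {n : ℕ} {H : Type v} [AddCommGroup H] [Module k H]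
variable {ρ : AffineRealization k n H}

theorem toggle_eq_of_insert_eq {i j : ZMod n} {X Y : Finset (ZMod n)} (hX : j ∉ X) (hY : j ∉ Y)
    (h : insert j Y = toggle i (insert j X)) : i ≠ j ∧ Y = toggle i X := by
  have hij : i ≠ j := by
    rintro rfl
    have := Finset.ext_iff.1 h i
    simp [mem_toggle] at this
  refine ⟨hij, Finset.ext fun x => ?_⟩
  have h' := Finset.ext_iff.1 h x
  simp only [Finset.mem_insert, mem_toggle] at h' ⊢
  by_cases hx : x = j
  · subst hx
    simp [hX, hY, hij.symm]
  · simpa [hx] using h'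

theorem insert_toggle {i j : ZMod n} {X : Finset (ZMod n)} (hij : i ≠ j) :
    insert j (toggle i X) = toggle i (insert j X) := by
  ext x
  simp only [Finset.mem_insert, mem_toggle]
  by_cases hx : x = j
  · simp [hx, hij.symm]
  · simp [hx]

theorem eq_of_toggle_insert_eq {i j : ZMod n} {X Y : Finset (ZMod n)} (hX : j ∉ X) (hY : j ∉ Y)
    (h : Y = toggle i (insert j X)) : i = j ∧ Y = X := by
  have hij : i = j := by
    have := Finset.ext_iff.1 h j
    simp [mem_toggle, hY] at this
    exact this.symm
  subst hij
  refine ⟨rfl, ?_⟩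
  rw [h, toggle, if_pos (Finset.mem_insert_self _ _), Finset.erase_insert hX]

theorem eq_of_insert_eq_toggle {i j : ZMod n} {X Y : Finset (ZMod n)} (hX : j ∉ X) (hY : j ∉ Y)
    (h : insert j Y = toggle i X) : i = j ∧ Y = X := by
  obtain ⟨h1, h2⟩ := eq_of_toggle_insert_eq (i := i) hY hX (by rw [h, toggle_toggle])
  exact ⟨h1, h2.symm⟩

theorem toggle_insert_self {j : ZMod n} {X : Finset (ZMod n)} (hX : j ∉ X) :
    toggle j (insert j X) = X := by
  rw [toggle, if_pos (Finset.mem_insert_self _ _), Finset.erase_insert hX]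

theorem toggle_of_notMem {j : ZMod n} {X : Finset (ZMod n)} (hX : j ∉ X) :
    toggle j X = insert j X := if_neg hX

theorem Dot.of_eq {β : Bool} {i : ZMod n} {a b : List (Letter n)} {f g : EHom ρ a b}
    (hg : Dot ρ β i g) (h : f = g) : Dot ρ β i f := h ▸ hg

theorem strandDegree_insert {j : ZMod n} {L : List (ZMod n × Bool)} (X : Finset (ZMod n))
    (hj : j ∉ L.map Prod.fst) : strandDegree L (insert j X) = strandDegree L X := by
  unfold strandDegree
  congr 1
  refine List.map_congr_left fun x hx => ?_
  have : x.1 ≠ j := fun h => hj (h ▸ List.mem_map_of_mem hx)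
  simp [this]

theorem filter_insert_of_notMem {j : ZMod n} {l : List (ZMod n)} (X : Finset (ZMod n))
    (hj : j ∉ l) : l.filter (· ∈ insert j X) = l.filter (· ∈ X) := by
  refine List.filter_congr fun x hx => ?_
  have : x ≠ j := fun h => hj (h ▸ hx)
  simp [this]

namespace PreComplex

theorem IsCube.tensorLetter {C : PreComplex ρ} {L : List (ZMod n × Bool)}
    {e : C.ι → Finset (ZMod n)} {η : C.ι → kˣ} (hC : IsCube C L e η) {j : ZMod n} (β : Bool)
    (hj : j ∉ L.map Prod.fst) :
    ∃ e' η', IsCube (C.tensorLetter j β) ((j, β) :: L) e' η' := by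
  classical
  have hje : ∀ a, j ∉ e a := fun a h => hj ((hC.exists_iff (e a)).1 ⟨a, rfl⟩ j h)
  have hinj : Function.Injective (Sum.elim (fun a => insert j (e a)) e) := by
    rintro (a | a) (b | b) h
    · refine congrArg _ (hC.injective ?_)
      have := congrArg (Finset.erase · j) h
      simpa [hje] using this
    · exact absurd (show j ∈ e b from (show insert j (e a) = e b from h) ▸ Finset.mem_insert_self j (e a)) (hje b)
    · exact absurd (show j ∈ e a from (show e a = insert j (e b) from h) ▸ Finset.mem_insert_self j (e b)) (hje a)
    · exact congrArg _ (hC.injective h)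
  have hex : ∀ X, (∃ a, Sum.elim (fun a => insert j (e a)) e a = X) ↔
      ∀ x ∈ X, x ∈ ((j, β) :: L).map Prod.fst := by
    intro X
    constructor
    · rintro ⟨a | a, rfl⟩ x hx
      · rcases Finset.mem_insert.1 hx with rfl | hx
        · simp
        · exact List.mem_cons_of_mem _ ((hC.exists_iff _).1 ⟨a, rfl⟩ x hx)
      · exact List.mem_cons_of_mem _ ((hC.exists_iff _).1 ⟨a, rfl⟩ x hx)
    · intro h
      obtain ⟨a, ha⟩ := (hC.exists_iff (X.erase j)).2 fun x hx =>
        (List.mem_cons.1 (h x (Finset.mem_of_mem_erase hx))).resolve_left (Finset.ne_of_mem_erase hx)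
      by_cases hX : j ∈ X
      · exact ⟨.inl a, by simp [ha, Finset.insert_erase hX]⟩
      · exact ⟨.inr a, by simp [ha, Finset.erase_eq_of_notMem hX]⟩
  have hmem : ∀ {i : ZMod n} {γ : Bool}, i ≠ j → (i, γ) ∈ (j, β) :: L → (i, γ) ∈ L := by
    intro i γ hij h
    simpa [hij] using h
  have hmemj : ∀ {γ : Bool}, (j, γ) ∈ (j, β) :: L → γ = β := by
    intro γ h
    rcases List.mem_cons.1 h with h | h
    · exact congrArg Prod.snd h
    · exact absurd (List.mem_map_of_mem (f := Prod.fst) h) hj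
  have hdec : ∀ {i : ZMod n} (a : C.ι), i ≠ j →
      decide (i ∉ insert j (e a)) = decide (i ∉ e a) := by
    intro i a hij
    simp [hij]
  have hd0 : ∀ a b, C.deg b ≠ C.deg a + 1 → C.d a b = 0 := C.d_eq_zero
  have hll : ∀ a b i, (i, decide (i ∉ insert j (e a))) ∈ (j, β) :: L →
      insert j (e b) = toggle i (insert j (e a)) → Dot ρ (decide (i ∉ insert j (e a))) i
        -- The new signs use the old degree on both copies of `C`. They agree on the two copies of
        -- one summand, so the dot on `j` joining these keeps coefficient one, as it must, having no
        -- strand on its left.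
        ((((-1) ^ C.deg a * η a) * ((-1) ^ C.deg b * η b)⁻¹) • EHom.cons (col j) (C.d a b)) := by
    intro a b i h1 h2
    obtain ⟨hij, h3⟩ := toggle_eq_of_insert_eq (hje a) (hje b) h2
    rw [hdec a hij] at h1 ⊢
    exact dot_smul_cons (hd0 a b) (hC.dot a b i (hmem hij h1) h3)
  have hrr : ∀ a b i, (i, decide (i ∉ e a)) ∈ (j, β) :: L →
      e b = toggle i (e a) → Dot ρ (decide (i ∉ e a)) i
        ((((-1) ^ C.deg a * η a) * ((-1) ^ C.deg b * η b)⁻¹) • -C.d a b) := by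
    intro a b i h1 h2
    have hij : i ≠ j := by
      rintro rfl
      have := hje b
      rw [h2, toggle_of_notMem (hje a)] at this
      exact this (Finset.mem_insert_self _ _)
    exact dot_smul_neg (hd0 a b) (hC.dot a b i (hmem hij h1) h2)
  have hll0 : ∀ a b, (∀ i, (i, decide (i ∉ insert j (e a))) ∈ (j, β) :: L →
      insert j (e b) ≠ toggle i (insert j (e a))) → C.d a b = 0 := by
    refine fun a b h => hC.d_eq_zero a b fun i hi h' => ?_
    have hij : i ≠ j := by
      rintro rfl
      exact hj (List.mem_map_of_mem (f := Prod.fst) hi)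
    exact h i (by rw [hdec a hij]; exact List.mem_cons_of_mem _ hi) (by rw [h', insert_toggle hij])
  have hrr0 : ∀ a b, (∀ i, (i, decide (i ∉ e a)) ∈ (j, β) :: L →
      e b ≠ toggle i (e a)) → C.d a b = 0 := fun a b h =>
    hC.d_eq_zero a b fun i hi h' => h i (List.mem_cons_of_mem _ hi) h'
  have hwl : ∀ a, col j :: C.word a =
      bsWord ((((j, β) :: L).map Prod.fst).filter (· ∈ insert j (e a))) := by
    intro a
    rw [List.map_cons, List.filter_cons_of_pos (by simp), filter_insert_of_notMem _ hj, hC.word_eq]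
    rfl
  have hwr : ∀ a, C.word a = bsWord ((((j, β) :: L).map Prod.fst).filter (· ∈ e a)) := by
    intro a
    rw [List.map_cons, List.filter_cons_of_neg (by simp [hje]), hC.word_eq]
  have hdl : ∀ a, C.deg a = strandDegree ((j, β) :: L) (insert j (e a)) := by
    intro a
    rw [hC.deg_eq, ← strandDegree_insert (e a) hj]
    simp [strandDegree]
  have hdr : ∀ a, strandDegree ((j, β) :: L) (e a) = C.deg a + if β then -1 else 1 := by
    intro a
    rw [hC.deg_eq]
    simp [strandDegree, hje, add_comm]
  cases β
  · refine ⟨Sum.elim (fun a => insert j (e a)) e,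
      Sum.elim (fun a => (-1) ^ C.deg a * η a) (fun a => (-1) ^ C.deg a * η a), hinj, hex, ?_, ?_,
      ?_, ?_, ?_⟩
    · rintro (a | a)
      exacts [hwl a, hwr a]
    · rintro (a | a)
      exacts [hC.shift_eq a, congrArg (· + 1) (hC.shift_eq a)]
    · rintro (a | a)
      exacts [hdl a, (hdr a).symm]
    · rintro (a | a) (b | b) i h1 h2
      · exact hll a b i h1 h2
      · obtain ⟨rfl, h3⟩ := eq_of_toggle_insert_eq (hje a) (hje b) h2
        obtain rfl := hC.injective h3
        have h4 := (Dot.finish i (C.word b)).comp_cast (ρ := ρ) (rfl : C.word b = C.word b)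
        simp only [Sum.elim_inl, Sum.elim_inr, Finset.mem_insert_self, not_true_eq_false,
          decide_false, mul_inv_cancel, one_smul]
        exact h4.of_eq (dif_pos rfl)
      · obtain ⟨rfl, h3⟩ := eq_of_insert_eq_toggle (hje a) (hje b) h2
        simpa [hje] using hmemj h1
      · exact hrr a b i h1 h2
    · rintro (a | a) (b | b) h
      · exact (congrArg (EHom.cons (col j)) (hll0 a b h)).trans (cons_zero _)
      · refine dif_neg ?_
        rintro rfl
        exact h j (by simp) (toggle_insert_self (hje a)).symm
      · rfl
      · exact neg_eq_zero.2 (hrr0 a b h)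
  · refine ⟨Sum.elim (fun a => insert j (e a)) e,
      Sum.elim (fun a => (-1) ^ C.deg a * η a) (fun a => (-1) ^ C.deg a * η a), hinj, hex, ?_, ?_,
      ?_, ?_, ?_⟩
    · rintro (a | a)
      exacts [hwl a, hwr a]
    · rintro (a | a)
      exacts [hC.shift_eq a, congrArg (· - 1) (hC.shift_eq a)]
    · rintro (a | a)
      exacts [hdl a, (hdr a).symm]
    · rintro (a | a) (b | b) i h1 h2
      · exact hll a b i h1 h2
      · obtain ⟨rfl, h3⟩ := eq_of_toggle_insert_eq (hje a) (hje b) h2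
        simpa using hmemj h1
      · obtain ⟨rfl, h3⟩ := eq_of_insert_eq_toggle (hje a) (hje b) h2
        obtain rfl := hC.injective h3
        have h4 := (Dot.start i (C.word b)).cast_comp (ρ := ρ) (rfl : C.word b = C.word b)
        simp only [Sum.elim_inl, Sum.elim_inr, hje, not_false_eq_true,
          decide_true, mul_inv_cancel, one_smul]
        exact h4.of_eq (dif_pos rfl)
      · exact hrr a b i h1 h2
    · rintro (a | a) (b | b) h
      · exact (congrArg (EHom.cons (col j)) (hll0 a b h)).trans (cons_zero _)
      · rfl
      · refine dif_neg ?_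
        rintro rfl
        exact h j (by simp [hje]) (toggle_of_notMem (hje a)).symm
      · exact neg_eq_zero.2 (hrr0 a b h)

theorem exists_isCube_rouquier {L : List (ZMod n × Bool)} (hL : (L.map Prod.fst).Nodup) :
    ∃ e η, IsCube (rouquier ρ (L.map braidLetter)) L e η := by
  induction L with
  | nil => exact ⟨_, _, isCube_unit⟩
  | cons x L ih =>
    obtain ⟨j, β⟩ := x
    have hL' := List.nodup_cons.1 hL
    obtain ⟨e, η, h⟩ := ih hL'.2
    cases β
    · exact h.tensorLetter false hL'.1
    · exact h.tensorLetter true hL'.1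

end PreComplex
end

/-! ### The summands of the Gaitsgory complex and of the Wakimoto complexes -/

section

variable {n : ℕ}

/-- The letters `f_{t-1}⁻¹, …, f_0⁻¹, f_{n-1}, …, f_{t+1}`. -/
def wakimotoLetters (t : Fin n) : List (ZMod n × Bool) :=
  (List.range (n - 1)).map fun s : ℕ => ((t : ℕ) - 1 - (s : ZMod n), decide (s < (t : ℕ)))

theorem map_fst_wakimotoLetters (t : Fin n) : (wakimotoLetters t).map Prod.fst =
    (List.range (n - 1)).map fun s : ℕ => ((t : ℕ) : ZMod n) - 1 - (s : ZMod n) := by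
  simp [wakimotoLetters, Function.comp_def]

theorem val_fin (t : Fin n) : ((t : ℕ) : ZMod n).val = t := ZMod.val_natCast_of_lt t.2

variable [NeZero n]

/-- The number of absent strands `s < c`, in the order `0 < 1 < ⋯ < n - 1`. -/
def absentBelow (c : ZMod n) (X : Finset (ZMod n)) : ℕ :=
  (Finset.univ.filter fun s : ZMod n => s ∉ X ∧ s.val < c.val).card

/-- The homological degree of the summand with strands in `X` in the Wakimoto complex at `c`. -/
def wakimotoDegree (c : ZMod n) (X : Finset (ZMod n)) : ℤ := n - 1 - X.card - 2 * absentBelow c X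

variable {c c' i : ZMod n} {X : Finset (ZMod n)} {p : ℤ}

/-- The strict inequality comes from `c` itself, which is absent but not counted. -/
theorem absentBelow_lt (hc : c ∉ X) : absentBelow c X + X.card < n := by
  have h : insert c (Finset.univ.filter fun s : ZMod n => s ∉ X ∧ s.val < c.val) ⊆ Xᶜ := by
    intro s hs
    rcases Finset.mem_insert.1 hs with rfl | hs
    · simpa using hc
    · simpa using (Finset.mem_filter.1 hs).2.1
  have h' := Finset.card_le_card h
  rw [Finset.card_insert_of_notMem (by simp), Finset.card_compl, ZMod.card] at h'
  have h2 : absentBelow c X + 1 ≤ n - X.card := h'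
  omega

theorem absentBelow_lt_absentBelow (hc : c ∉ X) (h : c.val < c'.val) :
    absentBelow c X < absentBelow c' X := by
  refine Finset.card_lt_card (Finset.ssubset_iff_subset_ne.2 ⟨fun s hs => ?_, fun h' => ?_⟩)
  · simp only [Finset.mem_filter, Finset.mem_univ, true_and] at hs ⊢
    exact ⟨hs.1, hs.2.trans h⟩
  · have := Finset.ext_iff.1 h' c
    simp [hc, h] at this

theorem absentBelow_injective (hc : c ∉ X) (hc' : c' ∉ X)
    (h : absentBelow c X = absentBelow c' X) : c = c' := by
  refine ZMod.val_injective n (le_antisymm ?_ ?_)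
  · by_contra! h'
    exact (absentBelow_lt_absentBelow hc' h').ne' h
  · by_contra! h'
    exact (absentBelow_lt_absentBelow hc h').ne h

theorem absentBelow_insert (hi : i ∉ X) :
    absentBelow c (insert i X) + (if i.val < c.val then 1 else 0) = absentBelow c X := by
  have : (Finset.univ.filter fun s : ZMod n => s ∉ insert i X ∧ s.val < c.val) =
      (Finset.univ.filter fun s : ZMod n => s ∉ X ∧ s.val < c.val).erase i := by
    ext s
    simp only [Finset.mem_filter, Finset.mem_univ, true_and, Finset.mem_insert, Finset.mem_erase]
    tauto
  unfold absentBelow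
  rw [this]
  split_ifs with h
  · exact Finset.card_erase_add_one (by simp [hi, h])
  · rw [Finset.erase_eq_of_notMem (by simp [h]), add_zero]

theorem absentBelow_toggle : absentBelow c (toggle i X) +
    (if i ∉ X ∧ i.val < c.val then 1 else 0) =
      absentBelow c X + (if i ∈ X ∧ i.val < c.val then 1 else 0) := by
  by_cases hi : i ∈ X
  · have h := absentBelow_insert (c := c) (i := i) (X := X.erase i) (by simp)
    rw [Finset.insert_erase hi] at h
    simp [toggle, hi, ← h]
  · have h := absentBelow_insert (c := c) hi
    simp [toggle, hi, h]

/-- Which dots occur in the cube at `c`: adding a strand raises the degree exactly for strands below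
`c`, removing one exactly for the others. These are the startdots of inverse letters and the enddots
of positive letters. -/
theorem wakimotoDegree_toggle :
    wakimotoDegree c (toggle i X) = wakimotoDegree c X + 1 ↔ (i ∉ X ↔ i.val < c.val) := by
  have h1 := absentBelow_toggle (c := c) (i := i) (X := X)
  have h2 := card_toggle i X
  unfold wakimotoDegree
  by_cases hi : i ∈ X <;> by_cases h : i.val < c.val <;> simp [hi, h] at h1 h2 ⊢ <;> omega

/-- If `c < c'`, then `c` is an additional absent strand below `c'`, so at `X` the degree for `c'`
is at least two less than for `c`. One change of strand raises it by at most one and cannot make up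
for this. -/
theorem le_of_wakimotoDegree_toggle (hc : c ∉ X)
    (h : wakimotoDegree c' (toggle i X) = wakimotoDegree c X + 1) : c'.val ≤ c.val := by
  by_contra! hlt
  have h1 := absentBelow_toggle (c := c') (i := i) (X := X)
  have h2 := card_toggle i X
  have h3 := absentBelow_lt_absentBelow hc hlt
  unfold wakimotoDegree at h
  by_cases hi : i ∈ X <;> by_cases h' : i.val < c'.val <;> simp [hi, h'] at h1 h2 <;> omega

theorem mem_chainSet_wakimotoDegree (hc : c ∉ X) : X ∈ ChainSet n (wakimotoDegree c X) := by
  have h := absentBelow_lt hc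
  rw [mem_chainSet, Int.even_iff]
  unfold wakimotoDegree
  rcases abs_cases ((n : ℤ) - 1 - X.card - 2 * absentBelow c X) with h' | h' <;> rw [h'.1] <;> omega

/-- Counting the absent strands below `c` is an injection of the `n - |X|` absent strands into `{0,
…, n - |X| - 1}`, hence a bijection, and the degree is an affine function of this number. -/
theorem exists_wakimotoDegree_eq (hX : X ∈ ChainSet n p) : ∃ c ∉ X, wakimotoDegree c X = p := by
  rw [mem_chainSet, Int.even_iff] at hX
  have hcard : (Xᶜ).card = n - X.card := by rw [Finset.card_compl, ZMod.card]
  have hinj : Set.InjOn (fun c => absentBelow c X) (Xᶜ : Finset (ZMod n)) := fun c hc c' hc' h =>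
    absentBelow_injective (by simpa using hc) (by simpa using hc') h
  have hmaps : ∀ c ∈ Xᶜ, absentBelow c X ∈ Finset.range (n - X.card) := by
    intro c hc
    have := absentBelow_lt (Finset.mem_compl.1 hc)
    rw [Finset.mem_range]
    omega
  have hsurj := Finset.surjOn_of_injOn_of_card_le _ hmaps hinj (by simp [hcard])
  -- The rank that solves `wakimotoDegree c X = p`; the parity condition makes the division exact,
  -- and the bound on `|X|` puts it in range.
  obtain ⟨c, hc, h⟩ := hsurj (a := (((n : ℤ) - 1 - p - X.card) / 2).toNat) (by
    rw [Finset.mem_coe, Finset.mem_range]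
    rcases abs_cases p with h' | h' <;> rw [h'.1] at hX <;> omega)
  refine ⟨c, by simpa using hc, ?_⟩
  dsimp only at h
  unfold wakimotoDegree
  rw [h]
  rcases abs_cases p with h' | h' <;> rw [h'.1] at hX <;> omega

theorem mem_wakimotoLetters {t : Fin n} {β : Bool} :
    (i, β) ∈ wakimotoLetters t ↔ i ≠ ((t : ℕ) : ZMod n) ∧ β = decide (i.val < t) := by
  have ht := t.2
  simp only [wakimotoLetters, List.mem_map, List.mem_range, Prod.mk.injEq]
  -- The representative in `[0, n)`: the letters descend from `t - 1` to `0` for `s < t`, then wrap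
  -- around and descend from `n - 1` to `t + 1`.
  have key : ∀ s : ℕ, s < n - 1 → ((t : ℕ) - 1 - (s : ZMod n) : ZMod n) =
      ((if s < t then t - 1 - s else n + t - 1 - s : ℕ) : ZMod n) := by
    intro s hs
    split_ifs with h
    · rw [Nat.cast_sub (by omega), Nat.cast_sub (by omega), Nat.cast_one]
    · rw [Nat.cast_sub (by omega), Nat.cast_sub (by omega), Nat.cast_add, ZMod.natCast_self,
        zero_add, Nat.cast_one]
  constructor
  · rintro ⟨s, hs, rfl, rfl⟩
    rw [key s hs]
    have hval : ((if s < t then t - 1 - s else n + t - 1 - s : ℕ) : ZMod n).val =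
        if s < t then t - 1 - s else n + t - 1 - s :=
      ZMod.val_natCast_of_lt (by split_ifs <;> omega)
    constructor
    · intro h
      have := congrArg ZMod.val h
      rw [hval, val_fin] at this
      split_ifs at this <;> omega
    · rw [hval]
      congr 1
      split_ifs with h <;> simp [h] <;> omega
  · rintro ⟨hne, rfl⟩
    have hi := ZMod.val_lt i
    have hne' : i.val ≠ t := fun h => hne (by rw [← h, ZMod.natCast_zmod_val])
    refine ⟨if i.val < t then t - 1 - i.val else n + t - 1 - i.val, by split_ifs <;> omega, ?_, ?_⟩
    · rw [key _ (by split_ifs <;> omega)]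
      refine Eq.trans (congrArg Nat.cast ?_) (ZMod.natCast_zmod_val i)
      split_ifs <;> omega
    · congr 1
      split_ifs with h <;> simp [h] <;> omega

theorem mem_map_fst_wakimotoLetters {t : Fin n} :
    i ∈ (wakimotoLetters t).map Prod.fst ↔ i ≠ ((t : ℕ) : ZMod n) := by
  simp [mem_wakimotoLetters]

theorem isDescending_wakimotoLetters (hn : 2 ≤ n) (t : Fin n) :
    IsDescending ((wakimotoLetters t).map Prod.fst) := by
  have h := isDescending_cyclicWord (c := ((t : ℕ) : ZMod n)) hn Finset.univ
  simpa [cyclicWord, map_fst_wakimotoLetters] using h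

/-- An absent strand counts `1`, corrected by `-2` if it is below `t`. Summing over all strands
would also count the absent strand `t`, which is no letter; this is the `1` added to both sides. -/
theorem strandDegree_wakimotoLetters (hn : 2 ≤ n) {t : Fin n} (ht : ((t : ℕ) : ZMod n) ∉ X) :
    strandDegree (wakimotoLetters t) X = wakimotoDegree ((t : ℕ) : ZMod n) X := by
  have h1 : strandDegree (wakimotoLetters t) X =
      (((wakimotoLetters t).map Prod.fst).map fun i : ZMod n =>
        (if i ∈ X then 0 else 1) - 2 * (if i ∉ X ∧ i.val < t then 1 else 0 : ℤ)).sum := by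
    rw [strandDegree, List.map_map]
    congr 1
    refine List.map_congr_left fun x hx => ?_
    have := (mem_wakimotoLetters.1 hx).2
    by_cases h : x.1 ∈ X <;> by_cases h' : x.1.val < t <;> simp [h, h', this]
  have h2 : ((wakimotoLetters t).map Prod.fst).toFinset = Finset.univ.erase ((t : ℕ) : ZMod n) := by
    ext i
    simp only [List.mem_toFinset, mem_map_fst_wakimotoLetters, Finset.mem_erase, Finset.mem_univ,
      and_true]
  rw [h1, ← List.sum_toFinset _ (isDescending_wakimotoLetters hn t).nodup, h2,
    ← add_right_cancel_iff (a := 1)]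
  have h3 := Finset.sum_erase_add Finset.univ (fun i : ZMod n =>
    (if i ∈ X then 0 else 1) - 2 * (if i ∉ X ∧ i.val < t then 1 else 0 : ℤ))
    (Finset.mem_univ ((t : ℕ) : ZMod n))
  simp only [if_neg ht, val_fin, lt_irrefl, and_false, if_false, mul_zero, sub_zero] at h3
  rw [h3, Finset.sum_sub_distrib, ← Finset.mul_sum]
  have h4 : (∑ i : ZMod n, if i ∈ X then (0 : ℤ) else 1) = n - X.card := by
    have : ∀ i : ZMod n, (if i ∈ X then (0 : ℤ) else 1) = 1 - if i ∈ X then 1 else 0 := by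
      intro i
      split_ifs <;> rfl
    simp only [this, Finset.sum_sub_distrib]
    simp [ZMod.card]
  have h5 : (∑ i : ZMod n, if i ∉ X ∧ i.val < t then (1 : ℤ) else 0) =
      absentBelow ((t : ℕ) : ZMod n) X := by
    rw [Finset.sum_boole, absentBelow, val_fin]
  rw [h4, h5, wakimotoDegree]
  ring

end

/-! ### Translations as braid words -/

section
variable {n : ℕ}

theorem ExtBraid.omega_mul_f (i : ZMod n) :
    ExtBraid.omega n * ExtBraid.f i = ExtBraid.f (i + 1) * ExtBraid.omega n := by
  have h : (PresentedGroup.mk (braidRels n)) (FreeGroup.of none * FreeGroup.of (some i) *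
      (FreeGroup.of none)⁻¹ * (FreeGroup.of (some (i + 1)))⁻¹) = 1 :=
    PresentedGroup.one_of_mem (.inr (.inr ⟨i, rfl⟩))
  simp only [map_mul, map_inv] at h
  rw [mul_inv_eq_one, mul_inv_eq_iff_eq_mul] at h
  exact h

/-- Used to bring `ω` to the front of `y_{t+1}`, lowering the indices of the inverse letters by one;
after this all letters have distinct indices. -/
theorem ExtBraid.omega_mul_prod (l : List (ZMod n)) :
    ExtBraid.omega n * (l.map fun i => (ExtBraid.f i)⁻¹).prod =
      (l.map fun i => (ExtBraid.f (i + 1))⁻¹).prod * ExtBraid.omega n := by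
  induction l with
  | nil => simp
  | cons i l ih =>
    have h : ExtBraid.omega n * (ExtBraid.f i)⁻¹ =
        (ExtBraid.f (i + 1))⁻¹ * ExtBraid.omega n := by
      rw [mul_inv_eq_iff_eq_mul, mul_assoc, ExtBraid.omega_mul_f, inv_mul_cancel_left]
    rw [List.map_cons, List.prod_cons, ← mul_assoc, h, mul_assoc, ih, List.map_cons,
      List.prod_cons, mul_assoc]

theorem reverse_map_range {α : Type*} (m : ℕ) (g : ℕ → α) :
    ((List.range m).map g).reverse = (List.range m).map fun s => g (m - 1 - s) := by
  apply List.ext_getElem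
  · simp
  · intro i h1 h2
    simp

theorem prod_map_pow_single {G : Type*} [Group G] {m : ℕ} (g : Fin m → G) (t : Fin m)
    {l : List (Fin m)} (hl : l.Nodup) :
    (l.map fun s => g s ^ (Pi.single t (1 : ℤ) : Fin m → ℤ) s).prod = if t ∈ l then g t else 1 := by
  induction l with
  | nil => simp
  | cons s l ih =>
    have hl' := List.nodup_cons.1 hl
    rw [List.map_cons, List.prod_cons, ih hl'.2]
    by_cases h : s = t
    · subst h
      simp [hl'.1]
    · simp [h, Ne.symm h]

theorem translation_single (t : Fin n) : translation (Pi.single t (1 : ℤ)) = yBraid t := by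
  rw [translation, List.ofFn_eq_map, prod_map_pow_single _ t (List.nodup_finRange n)]
  simp

/-- The braid word `ω f_{t-1}⁻¹ ⋯ f_0⁻¹ f_{n-1} ⋯ f_{t+1}` for `y_{t+1}`. -/
def wakimotoWord (t : Fin n) : List (BraidLetter n) :=
  BraidLetter.omega :: (wakimotoLetters t).map braidLetter

theorem braidOf_wakimotoWord (t : Fin n) : braidOf (wakimotoWord t) = yBraid t := by
  have ht := t.2
  -- The list of letters is cut at the wrap-around: the first `t` are inverse generators, the other
  -- `n - 1 - t` positive ones.
  have hr : List.range (n - 1) =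
      List.range t ++ (List.range (n - 1 - t)).map fun s => (t : ℕ) + s := by
    rw [← List.range_add]
    congr 1
    omega
  have h1 : (List.range t).map ((BraidLetter.toBraid ∘ braidLetter) ∘ fun s : ℕ =>
      (((t : ℕ) - 1 - (s : ZMod n) : ZMod n), decide (s < (t : ℕ)))) =
      (((List.range t).map fun s : ℕ => ((t : ℕ) - 1 - (s : ZMod n) : ZMod n))).map
        fun i => (ExtBraid.f i)⁻¹ := by
    rw [List.map_map]
    refine List.map_congr_left fun s hs => ?_
    simp [List.mem_range.1 hs, braidLetter, BraidLetter.toBraid]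
  have h2 : (List.range (n - 1 - t)).map (((BraidLetter.toBraid ∘ braidLetter) ∘ fun s : ℕ =>
      (((t : ℕ) - 1 - (s : ZMod n) : ZMod n), decide (s < (t : ℕ)))) ∘ fun s => (t : ℕ) + s) =
      ((List.range (n - 1 - t)).map fun s => ExtBraid.f ((t + 1 + s : ℕ) : ZMod n)).reverse := by
    rw [reverse_map_range]
    refine List.map_congr_left fun s hs => ?_
    have hs := List.mem_range.1 hs
    simp only [Function.comp_apply, braidLetter, BraidLetter.toBraid, show ¬ (t : ℕ) + s < t by omega,
      decide_false]
    congr 1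
    have e : (t : ℕ) + 1 + (n - 1 - t - 1 - s) = n - 1 - s := by omega
    rw [e, Nat.cast_sub (by omega), Nat.cast_sub (by omega), ZMod.natCast_self]
    push_cast
    ring
  rw [braidOf, wakimotoWord, List.map_cons, List.prod_cons, List.map_map, wakimotoLetters,
    List.map_map, hr, List.map_append, List.map_map, List.prod_append, h1, h2, ← mul_assoc]
  rw [show BraidLetter.toBraid BraidLetter.omega = ExtBraid.omega n from rfl,
    ExtBraid.omega_mul_prod, yBraid, reverse_map_range (t : ℕ), List.map_map]
  congr 3
  refine List.map_congr_left fun s hs => ?_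
  have hs := List.mem_range.1 hs
  simp only [Function.comp_apply]
  congr 2
  rw [show (t : ℕ) - 1 - s + 1 = t - s by omega, Nat.cast_sub (by omega)]
  ring

end

/-! ### The weight filtration -/

section
variable {n : ℕ}

theorem weightSpace_single (t : Fin n) :
    weightSpace (Pi.single t (1 : ℤ)) = Submodule.span ℂ {(Pi.single t (1 : ℂ) : Fin n → ℂ)} := by
  ext x
  rw [Submodule.mem_span_singleton]
  constructor
  · intro h
    refine ⟨x t, funext fun i => ?_⟩
    -- Testing against the diagonal matrix unit at `t` already kills all other coordinates.
    have h' := congrFun (h (Pi.single t 1)) i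
    rw [Matrix.mulVec_diagonal] at h'
    by_cases hi : i = t
    · subst hi
      simp
    · simp [hi, Pi.single_apply] at h' ⊢
      exact h'
  · rintro ⟨c, rfl⟩ s
    funext i
    rw [Matrix.mulVec_diagonal]
    by_cases hi : i = t
    · subst hi
      simp [Pi.single_apply]
    · simp [hi]

theorem mem_iSup_weightSpace (t : Fin n) (x : Fin n → ℂ) :
    x ∈ ⨆ s ≤ t, weightSpace (Pi.single s (1 : ℤ)) ↔ ∀ i, t < i → x i = 0 := by
  constructor
  · intro hx
    have hle : ⨆ s ≤ t, weightSpace (Pi.single s (1 : ℤ)) ≤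
        ⨅ i, ⨅ _ : t < i, LinearMap.ker (LinearMap.proj i : (Fin n → ℂ) →ₗ[ℂ] ℂ) := by
      refine iSup₂_le fun s hs => le_iInf₂ fun i hi => ?_
      rw [weightSpace_single, Submodule.span_singleton_le_iff_mem]
      simp [(hs.trans_lt hi).ne']
    have h := hle hx
    simpa [Submodule.mem_iInf] using h
  · intro h
    rw [← Finset.univ_sum_single x]
    refine Submodule.sum_mem _ fun i _ => ?_
    by_cases hi : t < i
    · simp [h i hi]
    · refine Submodule.mem_iSup_of_mem i (Submodule.mem_iSup_of_mem (not_lt.1 hi) ?_)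
      rw [weightSpace_single, Submodule.mem_span_singleton]
      exact ⟨x i, by simp [← Pi.single_smul]⟩

theorem isWeightFiltration_single :
    IsWeightFiltration (fun t : Fin n => (Pi.single t (1 : ℤ) : Fin n → ℤ)) := by
  refine ⟨fun s t h => ?_, ?_, fun t A hA x hx => ?_⟩
  · by_contra hst
    have := congrFun h s
    simp [hst] at this
  · rw [DirectSum.isInternal_submodule_iff_iSupIndep_and_iSup_eq_top]
    have e : (fun t : Fin n => weightSpace (Pi.single t (1 : ℤ))) =
        fun t => Submodule.span ℂ {Pi.basisFun ℂ (Fin n) t} := by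
      funext t
      rw [weightSpace_single, Pi.basisFun_apply]
    rw [e]
    refine ⟨(Pi.basisFun ℂ (Fin n)).linearIndependent.iSupIndep_span_singleton, ?_⟩
    rw [← Submodule.span_range_eq_iSup]
    exact (Pi.basisFun ℂ (Fin n)).span_eq
  · rw [mem_iSup_weightSpace] at hx ⊢
    intro i hi
    change ∑ j, A i j * x j = 0
    refine Finset.sum_eq_zero fun j _ => ?_
    -- For `i > t`, an entry below the diagonal vanishes by `hA`; otherwise `j ≥ i > t` and the
    -- coordinate `x j` vanishes.
    by_cases hij : j < i
    · simp [hA i j hij]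
    · simp [hx j (hi.trans_le (not_lt.1 hij))]

theorem finrank_weightSpace_single (t : Fin n) :
    Module.finrank ℂ (weightSpace (Pi.single t (1 : ℤ) : Fin n → ℤ)) = 1 := by
  rw [weightSpace_single, finrank_span_singleton]
  simp

end

/-! ### The Wakimoto filtration -/

section
open EHom Letter

variable {k : Type u} [CommRing k] {n : ℕ} {H : Type v} [AddCommGroup H] [Module k H]
variable {ρ : AffineRealization k n H}

theorem EHom.cons_units_smul_comp {x : Letter n} {a b : List (Letter n)} {f : EHom ρ a b}
    {g : EHom ρ b a} (h : f ⊚ g = EHom.id ρ a) {u v : kˣ} (huv : u * v = 1) :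
    EHom.cons x (u • f) ⊚ EHom.cons x (v • g) = EHom.id ρ (x :: a) := by
  rw [← cons_comp, Units.smul_def, Units.smul_def, smul_comp, comp_smul, h, ← Units.smul_def,
    ← Units.smul_def, smul_smul, huv, one_smul, cons_id]

namespace PreComplex

open Classical in
/-- Complexes with isomorphic summands and corresponding differentials are isomorphic. -/
theorem isIsomorphic_of_equiv {C D : PreComplex ρ} (E : D.ι ≃ C.ι)
    (θ : ∀ x, EHom ρ (C.word (E x)) (D.word x)) (θ' : ∀ x, EHom ρ (D.word x) (C.word (E x)))
    (h1 : ∀ x, θ x ⊚ θ' x = EHom.id ρ _) (h2 : ∀ x, θ' x ⊚ θ x = EHom.id ρ _)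
    (hθ : ∀ x, (θ x).HasDegree 0) (hθ' : ∀ x, (θ' x).HasDegree 0)
    (hdeg : ∀ x, C.deg (E x) = D.deg x) (hshift : ∀ x, C.shift (E x) = D.shift x)
    (hd : ∀ x y, D.d x y = θ' x ⊚ C.d (E x) (E y) ⊚ θ y) : C.IsIsomorphic D := by
  let φ : Map C D 0 :=
    { f := fun c x => if h : c = E x then EHom.cast ρ (congrArg C.word h) ⊚ θ x else 0
      f_eq_zero := by
        intro c x h
        refine dif_neg ?_
        rintro rfl
        exact h (by rw [hdeg, add_zero])
      f_degree := by
        intro c x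
        split_ifs with h
        · subst h
          rw [hshift, sub_self]
          exact (HasDegree.cast rfl).comp (hθ x) (zero_add 0)
        · exact HasDegree.zero _ }
  let ψ : Map D C 0 :=
    { f := fun x c => if h : E x = c then θ' x ⊚ EHom.cast ρ (congrArg C.word h) else 0
      f_eq_zero := by
        intro x c h
        refine dif_neg ?_
        rintro rfl
        exact h (by rw [hdeg, add_zero])
      f_degree := by
        intro x c
        split_ifs with h
        · subst h
          rw [hshift, sub_self]
          exact (hθ' x).comp (HasDegree.cast rfl) (zero_add 0)
        · exact HasDegree.zero _ }
  have hφ' : ∀ x, φ.f (E x) x = θ x := fun x => by simp [φ]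
  have hψ' : ∀ x, ψ.f x (E x) = θ' x := fun x => by simp [ψ]
  have hφ0 : ∀ c x, c ≠ E x → φ.f c x = 0 := fun c x h => dif_neg h
  have hψ0 : ∀ x c, E x ≠ c → ψ.f x c = 0 := fun x c h => dif_neg h
  have s1 : ∀ (x : D.ι) {b} (g : ∀ y, EHom ρ (D.word y) b),
      ∑ y, φ.f (E x) y ⊚ g y = θ x ⊚ g x := by
    intro x b g
    rw [Finset.sum_eq_single x, hφ']
    · intro y _ hy
      rw [hφ0 _ _ fun h => hy (E.injective h).symm, zero_comp]
    · simp
  have s2 : ∀ (x : D.ι) {a} (g : ∀ c, EHom ρ a (C.word c)),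
      ∑ c, g c ⊚ φ.f c x = g (E x) ⊚ θ x := by
    intro x a g
    rw [Finset.sum_eq_single (E x), hφ']
    · intro c _ hc
      rw [hφ0 _ _ hc, comp_zero]
    · simp
  have s3 : ∀ (x : D.ι) {b} (g : ∀ c, EHom ρ (C.word c) b),
      ∑ c, ψ.f x c ⊚ g c = θ' x ⊚ g (E x) := by
    intro x b g
    rw [Finset.sum_eq_single (E x), hψ']
    · intro c _ hc
      rw [hψ0 _ _ hc.symm, zero_comp]
    · simp
  have s4 : ∀ (x : D.ι) {a} (g : ∀ y, EHom ρ a (D.word y)),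
      ∑ y, g y ⊚ ψ.f y (E x) = g x ⊚ θ' x := by
    intro x a g
    rw [Finset.sum_eq_single x, hψ']
    · intro y _ hy
      rw [hψ0 _ _ fun h => hy (E.injective h), comp_zero]
    · simp
  refine ⟨φ, ψ, ?_, ?_, ?_, ?_⟩
  · intro c y
    obtain ⟨x, rfl⟩ := E.surjective c
    rw [s1, s2, hd, ← comp_assoc, ← comp_assoc, h1, id_comp]
  · intro x c
    obtain ⟨y, rfl⟩ := E.surjective c
    rw [s3, s4, hd, comp_assoc, h1, comp_id]
  · intro c c'
    obtain ⟨x, rfl⟩ := E.surjective c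
    obtain ⟨y, rfl⟩ := E.surjective c'
    rw [s1]
    by_cases h : x = y
    · subst h
      rw [hψ', h1, one, dif_pos rfl, cast_rfl]
    · rw [hψ0 _ _ fun h' => h (E.injective h'), comp_zero, one, dif_neg fun h' => h (E.injective h')]
  · intro x y
    rw [s3]
    by_cases h : x = y
    · subst h
      rw [hφ', h2, one, dif_pos rfl, cast_rfl]
    · rw [hφ0 _ _ fun h' => h (E.injective h'), comp_zero, one, dif_neg h]

theorem isHomotopyEquivalent_refl (C : PreComplex ρ) : C.IsHomotopyEquivalent C := by
  classical
  let φ : Map C C 0 :=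
    { f := C.one
      f_eq_zero := fun a b h => dif_neg fun e => h (by rw [e, add_zero])
      f_degree := fun a b => by
        unfold one
        split_ifs with h
        · subst h
          rw [sub_self]
          exact HasDegree.cast rfl
        · exact HasDegree.zero _ }
  let h0 : Map C C (-1) := ⟨fun _ _ => 0, fun _ _ _ => rfl, fun _ _ => HasDegree.zero _⟩
  have h1 : ∀ (a : C.ι) {b} (g : ∀ c, EHom ρ (C.word c) b), ∑ c, C.one a c ⊚ g c = g a := by
    intro a b g
    rw [Finset.sum_eq_single a, one, dif_pos rfl, cast_rfl, id_comp]
    · intro c _ hc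
      rw [one, dif_neg hc.symm, zero_comp]
    · simp
  have h2 : ∀ (b : C.ι) {a} (g : ∀ c, EHom ρ a (C.word c)), ∑ c, g c ⊚ C.one c b = g b := by
    intro b a g
    rw [Finset.sum_eq_single b, one, dif_pos rfl, cast_rfl, comp_id]
    · intro c _ hc
      rw [one, dif_neg hc, comp_zero]
    · simp
  have hc : φ.IsChainMap := fun a b => by rw [h1, h2]
  refine ⟨φ, φ, h0, h0, hc, hc, fun a b => ?_, fun a b => ?_⟩ <;>
    · rw [h1 a (fun c => φ.f c b)]
      simp [φ, h0]

end PreComplex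

end

/-! ### Matching the Wakimoto cubes with the Gaitsgory complex -/

section
open EHom Letter

variable {k : Type u} [CommRing k] {n : ℕ} [NeZero n] {H : Type v} [AddCommGroup H] [Module k H]
variable {ρ : AffineRealization k n H} {C : PreComplex ρ} {t : Fin n}
  {e : C.ι → Finset (ZMod n)} {η : C.ι → kˣ}

namespace PreComplex

theorem IsCube.notMem (h : IsCube C (wakimotoLetters t) e η) (a : C.ι) :
    ((t : ℕ) : ZMod n) ∉ e a := fun ht =>
  mem_map_fst_wakimotoLetters.1 ((h.exists_iff _).1 ⟨a, rfl⟩ _ ht) rfl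

theorem IsCube.ne_univ (h : IsCube C (wakimotoLetters t) e η) (a : C.ι) : e a ≠ Finset.univ :=
  fun ha => h.notMem a (ha ▸ Finset.mem_univ _)

theorem IsCube.deg_eq_wakimotoDegree (hn : 2 ≤ n) (h : IsCube C (wakimotoLetters t) e η)
    (a : C.ι) : C.deg a = wakimotoDegree ((t : ℕ) : ZMod n) (e a) :=
  (h.deg_eq a).trans (strandDegree_wakimotoLetters hn (h.notMem a))

theorem IsCube.isDescending (hn : 2 ≤ n) (t : Fin n) (X : Finset (ZMod n)) :
    IsDescending (((wakimotoLetters t).map Prod.fst).filter (· ∈ X)) :=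
  (isDescending_wakimotoLetters hn t).sublist List.filter_sublist

theorem IsCube.exists_rex (hn : 2 ≤ n) (h : IsCube C (wakimotoLetters t) e η)
    {al : Finset (ZMod n) → ZMod n} (hal : ∀ X, X ≠ Finset.univ → al X ∉ X) (a : C.ι) :
    ∃ f : EHom ρ (bsWord (prefWord al (e a))) (C.word a), Rex ρ f := by
  rw [h.word_eq]
  refine _root_.exists_rex (isDescending_prefWord al hn _) (isDescending hn t _) ?_
  rw [bsWord_perm_iff, List.perm_ext_iff_of_nodup (isDescending_prefWord al hn _).nodup
    (isDescending hn t _).nodup]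
  intro x
  rw [mem_prefWord hal (h.ne_univ a), List.mem_filter, decide_eq_true_eq]
  exact ⟨fun hx => ⟨(h.exists_iff _).1 ⟨a, rfl⟩ _ hx, hx⟩, And.right⟩

/-- The words of `C` are equal to coloured words only propositionally, so `Mov.unique` is applied
after generalising them. -/
theorem IsCube.d_unique (hn : 2 ≤ n) (h : IsCube C (wakimotoLetters t) e η) {a b : C.ι}
    {β : Bool} {i : ZMod n} {f f' : EHom ρ (C.word a) (C.word b)} (hf : Mov ρ β i f)
    (hf' : Mov ρ β i f') : f = f' := by
  have key : ∀ {v w : List (Letter n)} (l m : List (ZMod n)) (f f' : EHom ρ v w), l.Nodup →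
      m.Nodup → v = bsWord l → w = bsWord m → Mov ρ β i f → Mov ρ β i f' → f = f' := by
    rintro _ _ l m f f' hl hm rfl rfl hf hf'
    exact hf.unique hl hm hf'
  exact key _ _ f f' (isDescending hn t _).nodup (isDescending hn t _).nodup (h.word_eq a)
    (h.word_eq b) hf hf'

/-- The differential of a Wakimoto complex is the corresponding part of the differential of the
twisted standard complex. -/
theorem IsCube.d_eq (hn : 2 ≤ n) (h : IsCube C (wakimotoLetters t) e η)
    {al : Finset (ZMod n) → ZMod n} (hal : ∀ X, X ≠ Finset.univ → al X ∉ X) {a b : C.ι}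
    {f : EHom ρ (C.word a) (bsWord (prefWord al (e a)))} (hf : Rex ρ f)
    {g : EHom ρ (bsWord (prefWord al (e b))) (C.word b)} (hg : Rex ρ g) :
    (((η a)⁻¹ : kˣ) • f) ⊚ (if wakimotoDegree ((t : ℕ) : ZMod n) (e b) =
      wakimotoDegree ((t : ℕ) : ZMod n) (e a) + 1 then signedDots ρ al (e a) (e b) else 0) ⊚
      (η b • g) = C.d a b := by
  by_cases hi : ∃ i, (i, decide (i ∉ e a)) ∈ wakimotoLetters t ∧ e b = toggle i (e a)
  · obtain ⟨i, hi, hb⟩ := hi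
    have hi' := mem_wakimotoLetters.1 hi
    have hlt : i ∉ e a ↔ i.val < ((t : ℕ) : ZMod n).val := by
      rw [val_fin]
      exact decide_eq_decide.1 hi'.2
    rw [if_pos (by rw [hb]; exact wakimotoDegree_toggle.2 hlt), signedDots_toggle hb]
    have hm := ((signedDot_mov (ρ := ρ) hn hal (h.ne_univ a) (h.ne_univ b) hb).rex_comp hf).comp_rex
      hg
    have := h.d_unique hn hm (h.dot a b i hi hb).mov
    rw [Units.smul_def, Units.smul_def, smul_comp, smul_comp, comp_smul, this, ← Units.smul_def,
      ← Units.smul_def, smul_smul, smul_smul,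
      mul_comm (η a), inv_mul_eq_div, div_mul_eq_mul_div, mul_inv_cancel_left, div_self', one_smul]
  · have hi' : ∀ i, (i, decide (i ∉ e a)) ∈ wakimotoLetters t → e b ≠ toggle i (e a) :=
      fun i h1 h2 => hi ⟨i, h1, h2⟩
    rw [h.d_eq_zero a b hi']
    split_ifs with hdeg
    · rw [signedDots_eq_zero, comp_zero, zero_comp]
      intro i hb
      refine hi' i (mem_wakimotoLetters.2 ⟨?_, ?_⟩) hb
      -- The strand `t` is absent from all summands of the cube, so it cannot be the one added.
      · rintro rfl
        refine h.notMem b ?_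
        rw [hb, mem_toggle]
        exact Or.inl ⟨rfl, h.notMem a⟩
      · have := (wakimotoDegree_toggle (c := ((t : ℕ) : ZMod n))).1 (hb ▸ hdeg)
        rw [val_fin] at this
        exact decide_eq_decide.2 this
    · rw [comp_zero, zero_comp]

end PreComplex

/-- No Gaussian elimination is needed: the word has distinct letters, so the Rouquier complex itself
is perverse and the homotopy equivalence is the identity. -/
theorem isWakimotoComplex_rouquier (hn : 2 ≤ n) (t : Fin n) :
    IsWakimotoComplex (Pi.single t (1 : ℤ)) (rouquier ρ (wakimotoWord t)) := by
  refine ⟨PreComplex.isComplex_rouquier _, ?_, wakimotoWord t, ?_,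
    PreComplex.isHomotopyEquivalent_refl _⟩
  · obtain ⟨e, η, h⟩ := PreComplex.exists_isCube_rouquier (ρ := ρ)
      (isDescending_wakimotoLetters hn t).nodup
    intro a
    exact ⟨h.shift_eq a, 1, up, _, Or.inl rfl, (PreComplex.IsCube.isDescending hn t _).nodup,
      congrArg (List.cons up) (h.word_eq a)⟩
  · rw [braidOf_wakimotoWord, translation_single]

theorem hasWakimotoFiltration_standardGaitsgory (hn : 2 ≤ n) {al : Finset (ZMod n) → ZMod n}
    (hal : ∀ X, X ≠ Finset.univ → al X ∉ X) :
    HasWakimotoFiltration (standardGaitsgory ρ al) (fun t : Fin n => Pi.single t (1 : ℤ)) := by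
  refine ⟨standardGaitsgory_isMultFreePerverse hn, fun t => rouquier ρ (wakimotoWord t),
    isWakimotoComplex_rouquier hn, ?_⟩
  choose e η h using fun t : Fin n => PreComplex.exists_isCube_rouquier (ρ := ρ)
    (isDescending_wakimotoLetters hn t).nodup
  let R : Fin n → PreComplex ρ := fun t => rouquier ρ ((wakimotoLetters t).map braidLetter)
  change ∀ t, PreComplex.IsCube (R t) _ _ _ at h
  choose θ hθ using fun (t : Fin n) (a : (R t).ι) => (h t).exists_rex hn hal a
  choose θ' hθ' h1 h2 using fun (t : Fin n) (a : (R t).ι) => (hθ t a).symm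
  let c : Fin n → ZMod n := fun t => ((t : ℕ) : ZMod n)
  have hcs := fun (t : Fin n) (a : (R t).ι) => mem_chainSet_wakimotoDegree ((h t).notMem a)
  -- The bijection `(t, X) ↦ (p, X)`, with `p` the degree of `X` in the cube at `t`. For fixed `X`
  -- the degree recovers the number of absent strands below `t`, and hence `t`.
  let E₀ : (Σ t, (R t).ι) → (twistedStandard ρ al).ι := fun x =>
    ⟨⟨wakimotoDegree (c x.1) (e x.1 x.2), mem_Icc_of_mem_chainSet (hcs x.1 x.2)⟩,
      ⟨e x.1 x.2, hcs x.1 x.2⟩⟩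
  have hE₀ : Function.Bijective E₀ := by
    constructor
    · rintro ⟨t, a⟩ ⟨s, b⟩ hE
      have hp : wakimotoDegree (c t) (e t a) = wakimotoDegree (c s) (e s b) :=
        congrArg (fun z : (twistedStandard ρ al).ι => (z.1 : ℤ)) hE
      have hX : e t a = e s b :=
        congrArg (fun z : (twistedStandard ρ al).ι => (z.2 : Finset (ZMod n))) hE
      have hts : c t = c s := by
        have hb := (h s).notMem b
        rw [← hX] at hp hb
        refine absentBelow_injective ((h t).notMem a) hb ?_
        unfold wakimotoDegree at hp
        omega
      have : t = s := Fin.ext (by rw [← val_fin t, ← val_fin s]; exact congrArg ZMod.val hts)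
      subst this
      rw [(h t).injective hX]
    · rintro ⟨⟨p, hp⟩, ⟨X, hX⟩⟩
      obtain ⟨x, hx, hxp⟩ := exists_wakimotoDegree_eq hX
      let t : Fin n := ⟨x.val, ZMod.val_lt x⟩
      have ht : c t = x := ZMod.natCast_zmod_val x
      obtain ⟨a, ha⟩ := ((h t).exists_iff X).2 fun y hy => by
        rw [mem_map_fst_wakimotoLetters]
        rintro rfl
        exact hx (ht ▸ hy)
      subst ha
      refine ⟨⟨t, a⟩, ?_⟩
      have hp' : wakimotoDegree (c t) (e t a) = p := by rw [ht]; exact hxp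
      subst hp'
      rfl
  let E := Equiv.ofBijective E₀ hE₀
  -- The differential of `F` is transported along the bijection by rex moves and the signs `η`,
  -- which makes the isomorphism automatic. What has to be shown is that its diagonal blocks are
  -- those of the cubes and that it is triangular.
  let D : ∀ x y : (Σ t, (R t).ι), EHom ρ ((R x.1).word x.2) ((R y.1).word y.2) := fun x y =>
    (((η x.1 x.2)⁻¹ : kˣ) • θ' x.1 x.2) ⊚
      (if wakimotoDegree (c y.1) (e y.1 y.2) = wakimotoDegree (c x.1) (e x.1 x.2) + 1 then
        signedDots ρ al (e x.1 x.2) (e y.1 y.2) else 0) ⊚ (η y.1 y.2 • θ y.1 y.2)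
  have hdeg : ∀ x : (Σ t, (R t).ι), (R x.1).deg x.2 = wakimotoDegree (c x.1) (e x.1 x.2) :=
    fun x => (h x.1).deg_eq_wakimotoDegree hn x.2
  have hshift : ∀ x : (Σ t, (R t).ι), (R x.1).shift x.2 = wakimotoDegree (c x.1) (e x.1 x.2) :=
    fun x => ((h x.1).shift_eq x.2).trans (hdeg x)
  have hDdeg : ∀ x y, (D x y).HasDegree ((R y.1).shift y.2 - (R x.1).shift x.2) := by
    intro x y
    rw [hshift, hshift]
    exact (((hθ' x.1 x.2).hasDegree.smul _).comp ((twistedStandard ρ al).d_degree (E x) (E y))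
      (zero_add _)).comp ((hθ y.1 y.2).hasDegree.smul _) (add_zero _)
  have hD0 : ∀ x y, (R y.1).deg y.2 ≠ (R x.1).deg x.2 + 1 → D x y = 0 := by
    intro x y hxy
    rw [hdeg, hdeg] at hxy
    simp only [D]
    rw [if_neg hxy, comp_zero, zero_comp]
  have hDlow : ∀ x y, x.1 < y.1 → D x y = 0 := by
    intro x y hxy
    simp only [D]
    split_ifs with hd
    · rw [signedDots_eq_zero, comp_zero, zero_comp]
      intro i hi
      rw [hi] at hd
      -- A nonzero dot would not raise the index, contrary to `x.1 < y.1`.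
      have := le_of_wakimotoDegree_toggle ((h x.1).notMem x.2) hd
      rw [val_fin, val_fin] at this
      exact absurd hxy (by simpa using this)
    · rw [comp_zero, zero_comp]
  let cv : PreComplex.Convolution fun t => rouquier ρ (wakimotoWord t) :=
    { d := fun x y => EHom.cons up (D x y)
      d_eq_zero := fun x y hxy => (congrArg (EHom.cons up) (hD0 x y hxy)).trans (cons_zero _)
      d_degree := fun x y => (hDdeg x y).cons up
      d_diag := fun t a b => congrArg (EHom.cons up) ((h t).d_eq hn hal (hθ' t a) (hθ t b))
      d_lower := fun x y hxy => (congrArg (EHom.cons up) (hDlow x y hxy)).trans (cons_zero _) }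
  refine ⟨cv, PreComplex.isIsomorphic_of_equiv (C := standardGaitsgory ρ al) (D := cv.total) E
    (fun x => EHom.cons up (η x.1 x.2 • θ x.1 x.2))
    (fun x => EHom.cons up (((η x.1 x.2)⁻¹ : kˣ) • θ' x.1 x.2)) ?_ ?_ ?_ ?_ ?_ ?_ ?_⟩
  · exact fun x => cons_units_smul_comp (h1 x.1 x.2) (mul_inv_cancel _)
  · exact fun x => cons_units_smul_comp (h2 x.1 x.2) (inv_mul_cancel _)
  · exact fun x => ((hθ x.1 x.2).hasDegree.smul _).cons up
  · exact fun x => ((hθ' x.1 x.2).hasDegree.smul _).cons up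
  · exact fun x => (hdeg x).symm
  · exact fun x => (hshift x).symm
  · intro x y
    exact (cons_comp ..).trans (congrArg (· ⊚ _) (cons_comp ..))

end

theorem mainTheorem3 {k : Type u} [CommRing k] {n : ℕ} [NeZero n] (hn : 2 ≤ n)
    {H : Type v} [AddCommGroup H] [Module k H] [Module.Free k H] [Module.Finite k H]
    (ρ : AffineRealization k n H)
    (al : Finset (ZMod n) → ZMod n) (hal : ∀ X, X ≠ Finset.univ → al X ∉ X) :
    (standardGaitsgory ρ al).IsPseudocomplex ∧
    (ρ.delta = 0 → (standardGaitsgory ρ al).IsComplex) ∧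
    HasWakimotoFiltration (standardGaitsgory ρ al) (fun t : Fin n => Pi.single t (1 : ℤ)) ∧
    IsWeightFiltration (fun t : Fin n => (Pi.single t (1 : ℤ) : Fin n → ℤ)) ∧
    ∀ t : Fin n, Module.finrank ℂ (weightSpace (Pi.single t (1 : ℤ) : Fin n → ℤ)) = 1 := 
  ⟨standardGaitsgory_isPseudocomplex hn hal,
    fun h => (standardGaitsgory_isPseudocomplex hn hal).isComplex h,
    hasWakimotoFiltration_standardGaitsgory hn hal, isWeightFiltration_single,
    finrank_weightSpace_single⟩
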